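/- A spherical polygon is a closed region of the unit sphere $S^2$ bounded by a simple closed curve consisting of $n\ge 3$ great-circle arcs of length less than $\pi$; it need not be convex, and its interior angles lie in $(0,2\pi)$. An edge-to-edge tiling of $S^2$ is a finite family of spherical polygons (the tiles) that cover $S^2$ and have pairwise disjoint interiors, such that every vertex of a tile that lies in another tile is also a vertex of that tile, and such that at least three tiles meet at every vertex. Let $m\ge 4$. Let $P$ be a regular spherical $m$-gon with all edges of length $x$ and all angles equal to $\alpha$. Let $Q$ be a spherical quadrilateral with edges $x,y,x,y$ in cyclic order, where $x\ne y$, and with angles $\beta,\gamma,\beta,\gamma$ in cyclic order, where $\beta>\gamma$. Consider an edge-to-edge tiling of $S^2$ in which every tile is congruent (by an isometry of the sphere, possibly orientation-reversing) to $P$ or to $Q$, and in which both prototiles occur. Then the tiling has no vertex of type $\alpha\beta^2$. That is, there is no vertex at which exactly three tile corners meet, one of them a corner of a copy of $P$ and the other two corners of angle $\beta$ of copies of $Q$. -/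

import Mathlib

/-- Euclidean three-space. -/
abbrev E3 : Type := EuclideanSpace ℝ (Fin 3)

/-- The unit sphere, with the topology induced from three-space. -/
abbrev S2 : Type := Metric.sphere (0 : E3) 1

/-- The great-circle arc of length less than `π` between two points of the sphere that are
neither equal nor antipodal. -/
def arc (p q : S2) : Set S2 :=
  {z | ∃ a b : ℝ, 0 ≤ a ∧ 0 ≤ b ∧ (z : E3) = a • (p : E3) + b • (q : E3)}

/-- `IsInteriorAngle R p q r θ`: the region `R` has at its corner `p`, between the arcs
from `p` to `q` and from `p` to `r`, the interior angle `θ`, where `0 < θ < 2π`.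
Here `u` is the unit tangent vector at `p` that points to `q`, and `(u, e)` is an
orthonormal basis of the tangent plane at `p`. The arc to `r` leaves `p` in the direction at
angle `θ` from `u`, and near `p` the region `R` consists exactly of the points that are seen
from `p` in a direction at an angle between `0` and `θ`. -/
def IsInteriorAngle (R : Set S2) (p q r : S2) (θ : ℝ) : Prop :=
  0 < θ ∧ θ < 2 * Real.pi ∧
  ∃ u e : E3, Orthonormal ℝ ![(p : E3), u, e] ∧
    (∃ a b : ℝ, 0 < b ∧ (q : E3) = a • (p : E3) + b • u) ∧
    (∃ a b : ℝ, 0 < b ∧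
      (r : E3) = a • (p : E3) + b • (Real.cos θ • u + Real.sin θ • e)) ∧
    ∀ᶠ z : S2 in nhds p,
      z ∈ R ↔ ∃ a b φ : ℝ, 0 ≤ b ∧ 0 ≤ φ ∧ φ ≤ θ ∧
        (z : E3) = a • (p : E3) + b • (Real.cos φ • u + Real.sin φ • e)

/-- A (simple, not necessarily convex) spherical polygon with `n ≥ 3` sides: a closed region of
the sphere, bounded by a simple closed curve made of `n` great-circle arcs, each shorter
than `π`. The vertices are listed in cyclic order, in one of the two directions. -/
structure SphericalPolygon (n : ℕ) where
  three_le : 3 ≤ n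
  /-- the vertices, in cyclic order; the `i`-th edge joins the vertices `i` and `i + 1` -/
  vertex : ZMod n → S2
  vertex_ne : ∀ i, vertex i ≠ vertex (i + 1)
  vertex_ne_neg : ∀ i, vertex i ≠ -vertex (i + 1)
  /-- consecutive edges meet only in their common vertex -/
  edge_inter_next : ∀ i,
    arc (vertex i) (vertex (i + 1)) ∩ arc (vertex (i + 1)) (vertex (i + 1 + 1)) = {vertex (i + 1)}
  /-- other pairs of edges are disjoint -/
  edge_disjoint : ∀ i j, i ≠ j → j ≠ i + 1 → i ≠ j + 1 →
    Disjoint (arc (vertex i) (vertex (i + 1))) (arc (vertex j) (vertex (j + 1)))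
  /-- the closed region that is bounded by the edges -/
  region : Set S2
  frontier_region : frontier region = ⋃ i, arc (vertex i) (vertex (i + 1))
  region_eq_closure : region = closure (interior region)
  interior_connected : IsConnected (interior region)
  /-- the interior angles; the next condition determines them -/
  angle : ZMod n → ℝ
  isInteriorAngle : ∀ i,
    IsInteriorAngle region (vertex i) (vertex (i + 1)) (vertex (i - 1)) (angle i)

namespace SphericalPolygon

/-- The length of the `i`-th edge. -/
noncomputable def edgeLength {n : ℕ} (P : SphericalPolygon n) (i : ZMod n) : ℝ :=
  InnerProductGeometry.angle (P.vertex i : E3) (P.vertex (i + 1) : E3)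

/-- A regular polygon: all edges have length `x` and all angles are `α`. -/
def IsRegular {n : ℕ} (P : SphericalPolygon n) (x α : ℝ) : Prop :=
  (∀ i, P.edgeLength i = x) ∧ ∀ i, P.angle i = α

/-- A quadrilateral with equal opposite edges: its edges are `x, y, x, y` in cyclic
order, with `x ≠ y`, and its angles are `β, γ, β, γ` in cyclic order. -/
def HasEqualOppositeEdges (Q : SphericalPolygon 4) (x y β γ : ℝ) : Prop :=
  x ≠ y ∧
  Q.edgeLength 0 = x ∧ Q.edgeLength 1 = y ∧ Q.edgeLength 2 = x ∧ Q.edgeLength 3 = y ∧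
  Q.angle 0 = β ∧ Q.angle 1 = γ ∧ Q.angle 2 = β ∧ Q.angle 3 = γ

/-- Congruence of polygons: an isometry of the sphere (a rotation, or a rotation followed by a
reflection) takes the region of `P` to the region of `P'` and the vertices of `P` to those
of `P'`, where the cyclic order may be shifted or reversed. -/
def Congruent {n k : ℕ} (P : SphericalPolygon n) (P' : SphericalPolygon k) : Prop :=
  ∃ (g : E3 ≃ₗᵢ[ℝ] E3) (σ : ZMod k ≃ ZMod n),
    ((∀ i, σ (i + 1) = σ i + 1) ∨ (∀ i, σ (i + 1) = σ i - 1)) ∧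
    (∀ i, (P'.vertex i : E3) = g (P.vertex (σ i))) ∧
    (∀ z : S2, z ∈ P'.region ↔ ∃ w ∈ P.region, (z : E3) = g w)

end SphericalPolygon

/-- An edge-to-edge tiling of the sphere by finitely many polygons, all of whose vertices have
degree at least three. -/
structure SphericalTiling where
  numTiles : ℕ
  sides : Fin numTiles → ℕ
  tile : ∀ j, SphericalPolygon (sides j)
  cover : ⋃ j, (tile j).region = Set.univ
  disjoint_interior : Pairwise fun j k =>
    Disjoint (interior (tile j).region) (interior (tile k).region)
  /-- a vertex of a tile that lies in another tile is a vertex of that tile too -/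
  edge_to_edge : ∀ j i k, (tile j).vertex i ∈ (tile k).region →
    ∃ l, (tile k).vertex l = (tile j).vertex i
  /-- the degree of a vertex is the number of corners of tiles that meet there -/
  three_le_degree : ∀ j i,
    3 ≤ {c : Σ k, ZMod (sides k) | (tile c.1).vertex c.2 = (tile j).vertex i}.ncard

namespace SphericalTiling

/-- The corners of tiles that meet at the point `v`. A corner is a tile together with the index
of one of its vertices. -/
def cornersAt (T : SphericalTiling) (v : S2) : Set (Σ k, ZMod (T.sides k)) :=
  {c | (T.tile c.1).vertex c.2 = v}

/-- A dihedral tiling with prototiles `P` and `Q`: each tile is congruent to one of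
them, and both of them occur. -/
def IsDihedral (T : SphericalTiling) {n k : ℕ} (P : SphericalPolygon n)
    (Q : SphericalPolygon k) : Prop :=
  (∀ j, P.Congruent (T.tile j) ∨ Q.Congruent (T.tile j)) ∧
  (∃ j, P.Congruent (T.tile j)) ∧ (∃ j, Q.Congruent (T.tile j))

/-- `T` has a vertex of type `α^a β^b γ^c`: there meet exactly `a` corners of tiles congruent
to `P`, and, of tiles congruent to `Q`, exactly `b` corners of angle `β` and exactly `c`
corners of angle `γ`. -/
def HasVertexOfType (T : SphericalTiling) {n k : ℕ} (P : SphericalPolygon n)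
    (Q : SphericalPolygon k) (β γ : ℝ) (a b c : ℕ) : Prop :=
  ∃ v : S2, (T.cornersAt v).Nonempty ∧
    {s ∈ T.cornersAt v | P.Congruent (T.tile s.1)}.ncard = a ∧
    {s ∈ T.cornersAt v | Q.Congruent (T.tile s.1) ∧ (T.tile s.1).angle s.2 = β}.ncard = b ∧
    {s ∈ T.cornersAt v | Q.Congruent (T.tile s.1) ∧ (T.tile s.1).angle s.2 = γ}.ncard = c

end SphericalTiling

/-! Suppose that a vertex `αβ²` exists, so that `α + 2β = 2π`. Three facts then restrict every
vertex of the tiling. (i) The angle sum of `Q` exceeds `2π`, so `β + γ > π` and hence `α < 2γ`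
(`quadrilateral_angle_sum`). Here `γ < β < π`, so the diagonal between the two `β`-corners cuts `Q`
into two positively oriented triangles, each of angle sum greater than `π`. (ii) A regular spherical
`m`-gon has `mα > (m - 2)π`, so `α > π/2` for `m ≥ 4` (`IsRegular.angle_gt`). Its vertices run
around a circle, and simplicity of the boundary makes them go round exactly once. (iii) At each
vertex the number of corners of `Q` is even (`even_num`). Each of them has one side `x` and one side
`y`, corners of `P` have sides `x` only, and every side at the vertex belongs to two corners. With
the angle sum `2π` at a vertex, these leave only `αβ²`, `α³`, `α²γ²`, `αγ⁴` and vertices without `α`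
that have more `γ` than `β` (`vertex_types`).

At the vertex `αβ²` the sides of `P` are shared with copies of `Q`, and a side of `Q` has `β` at one
end and `γ` at the other. So the next vertex of that copy of `P` contains both `α` and `γ`: it is
`α²γ²` or `αγ⁴`. Each of these, combined with `α³` or with the other one, would force `α = 2γ`, so
these do not occur together.

If `α²γ²` occurs, then `α + γ = π`, so `α < 2π/3` and `m < 6`. Around the copy of `P`, tracing which
sides are shared with copies of `Q` shows that the types repeat with period three
(`types_periodic`), which is impossible for `m = 4` or `5`.

If `αγ⁴` occurs, each corner of `P` is at a vertex `αβ²` or `αγ⁴`, and no two consecutive corners of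
a copy of `P` are at vertices `αβ²`. Then `γ` outnumbers `β` in the whole tiling, although each copy
of `Q` has two of each (`not_alternating`).

The geometry underneath is the cyclic arrangement of corners at a vertex (`VertexArrangement`). It
comes from reading the tiles near the vertex as arcs that tile the circle of directions. -/

open scoped RealInnerProductSpace

/-! ### Vector algebra in three-space -/

/-- The vector product. -/
noncomputable def cross3 (a b : E3) : E3 :=
  !₂[a 1 * b 2 - a 2 * b 1, a 2 * b 0 - a 0 * b 2, a 0 * b 1 - a 1 * b 0]

/-- The triple product. -/
noncomputable def det3 (a b c : E3) : ℝ := ⟪cross3 a b, c⟫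

theorem inner_eq_coords (a b : E3) : ⟪a, b⟫ = a 0 * b 0 + a 1 * b 1 + a 2 * b 2 := by
  simp [PiLp.inner_apply, Fin.sum_univ_three, mul_comm]

theorem cross3_zero (a b : E3) : cross3 a b 0 = a 1 * b 2 - a 2 * b 1 := rfl
theorem cross3_one (a b : E3) : cross3 a b 1 = a 2 * b 0 - a 0 * b 2 := rfl
theorem cross3_two (a b : E3) : cross3 a b 2 = a 0 * b 1 - a 1 * b 0 := rfl

theorem E3.ext_coords {a b : E3} (h0 : a 0 = b 0) (h1 : a 1 = b 1) (h2 : a 2 = b 2) : a = b := by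
  ext i
  fin_cases i <;> assumption

theorem det3_eq (a b c : E3) : det3 a b c = (a 1 * b 2 - a 2 * b 1) * c 0 +
    (a 2 * b 0 - a 0 * b 2) * c 1 + (a 0 * b 1 - a 1 * b 0) * c 2 := by
  rw [det3, inner_eq_coords, cross3_zero, cross3_one, cross3_two]

theorem det3_cyclic (a b c : E3) : det3 a b c = det3 b c a := by
  simp only [det3_eq]; ring

theorem inner_cross3_cross3 (a b c d : E3) :
    ⟪cross3 a b, cross3 c d⟫ = ⟪a, c⟫ * ⟪b, d⟫ - ⟪a, d⟫ * ⟪b, c⟫ := by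
  simp only [inner_eq_coords, cross3_zero, cross3_one, cross3_two]; ring

theorem inner_cross3_left (a b : E3) : ⟪a, cross3 a b⟫ = 0 := by
  simp only [inner_eq_coords, cross3_zero, cross3_one, cross3_two]; ring

theorem inner_cross3_right (a b : E3) : ⟪b, cross3 a b⟫ = 0 := by
  simp only [inner_eq_coords, cross3_zero, cross3_one, cross3_two]; ring

theorem cross3_swap (a b : E3) : cross3 b a = -cross3 a b := by
  apply E3.ext_coords <;> simp [cross3_zero, cross3_one, cross3_two] <;> ring

theorem cross3_add_right (a b c : E3) : cross3 a (b + c) = cross3 a b + cross3 a c := by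
  apply E3.ext_coords <;> simp [cross3_zero, cross3_one, cross3_two] <;> ring

theorem cross3_smul_right (a b : E3) (t : ℝ) : cross3 a (t • b) = t • cross3 a b := by
  apply E3.ext_coords <;> simp [cross3_zero, cross3_one, cross3_two] <;> ring

theorem cross3_add_left (a b c : E3) : cross3 (a + b) c = cross3 a c + cross3 b c := by
  apply E3.ext_coords <;> simp [cross3_zero, cross3_one, cross3_two] <;> ring

theorem cross3_smul_left (a b : E3) (t : ℝ) : cross3 (t • a) b = t • cross3 a b := by
  apply E3.ext_coords <;> simp [cross3_zero, cross3_one, cross3_two] <;> ring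

theorem cross3_self (a : E3) : cross3 a a = 0 := by
  apply E3.ext_coords <;> simp [cross3_zero, cross3_one, cross3_two] <;> ring

theorem cross3_cross3 (a b c : E3) :
    cross3 a (cross3 b c) = ⟪a, c⟫ • b - ⟪a, b⟫ • c := by
  apply E3.ext_coords <;>
    simp [cross3_zero, cross3_one, cross3_two, inner_eq_coords] <;> ring

theorem S2.inner_self (p : S2) : ⟪(p : E3), (p : E3)⟫ = 1 := by
  rw [real_inner_self_eq_norm_sq, norm_eq_of_mem_sphere]; norm_num

/-! ### Orthonormal frames and directions at a point -/

/-- An orthonormal triple of vectors in three-space. -/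
structure Frame (p u e : E3) : Prop where
  pp : ⟪p, p⟫ = 1
  uu : ⟪u, u⟫ = 1
  ee : ⟪e, e⟫ = 1
  pu : ⟪p, u⟫ = 0
  pe : ⟪p, e⟫ = 0
  ue : ⟪u, e⟫ = 0

theorem frame_iff {p u e : E3} : Orthonormal ℝ ![p, u, e] ↔ Frame p u e := by
  rw [orthonormal_iff_ite]
  constructor
  · intro h
    exact ⟨by simpa using h 0 0, by simpa using h 1 1, by simpa using h 2 2,
      by simpa using h 0 1, by simpa using h 0 2, by simpa using h 1 2⟩
  · intro h i j
    have h1 : ⟪u, p⟫ = 0 := by rw [real_inner_comm]; exact h.pu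
    have h2 : ⟪e, p⟫ = 0 := by rw [real_inner_comm]; exact h.pe
    have h3 : ⟪e, u⟫ = 0 := by rw [real_inner_comm]; exact h.ue
    fin_cases i <;> fin_cases j <;>
      simp [-inner_self_eq_norm_sq_to_K, h.pp, h.uu, h.ee, h.pu, h.pe,
        h.ue, h1, h2, h3]

namespace Frame

variable {p u e : E3}

theorem up (h : Frame p u e) : ⟪u, p⟫ = 0 := by rw [real_inner_comm]; exact h.pu
theorem ep (h : Frame p u e) : ⟪e, p⟫ = 0 := by rw [real_inner_comm]; exact h.pe
theorem eu (h : Frame p u e) : ⟪e, u⟫ = 0 := by rw [real_inner_comm]; exact h.ue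

theorem expand (h : Frame p u e) (w : E3) : w = ⟪p, w⟫ • p + ⟪u, w⟫ • u + ⟪e, w⟫ • e := by
  have ho := frame_iff.2 h
  have hc : Fintype.card (Fin 3) = Module.finrank ℝ E3 := by simp
  let B := basisOfOrthonormalOfCardEqFinrank ho hc
  have hB : (B : Fin 3 → E3) = ![p, u, e] := coe_basisOfOrthonormalOfCardEqFinrank ho hc
  have hB' : Orthonormal ℝ B := by rw [hB]; exact ho
  have := (B.toOrthonormalBasis hB').sum_repr' w
  simp only [Module.Basis.coe_toOrthonormalBasis, hB, Fin.sum_univ_three] at this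
  simpa using this.symm

theorem eq_cross3 (h : Frame p u e) :
    e = det3 p u e • cross3 p u ∧ (det3 p u e = 1 ∨ det3 p u e = -1) := by
  have hexp := h.expand (cross3 p u)
  rw [inner_cross3_left, inner_cross3_right, real_inner_comm] at hexp
  simp only [zero_smul, zero_add] at hexp
  change cross3 p u = det3 p u e • e at hexp
  have hn : ⟪cross3 p u, cross3 p u⟫ = 1 := by
    rw [inner_cross3_cross3, h.pp, h.uu, h.pu]; norm_num
  have hd : det3 p u e * det3 p u e = 1 := by
    rw [hexp, inner_smul_left, inner_smul_right, h.ee] at hn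
    simpa using hn
  refine ⟨?_, mul_self_eq_one_iff.1 hd⟩
  conv_rhs => rw [hexp]
  rw [smul_smul, hd, one_smul]

theorem of_cross3 {p u : E3} (hp : ⟪p, p⟫ = 1) (hu : ⟪u, u⟫ = 1) (hpu : ⟪p, u⟫ = 0) :
    Frame p u (cross3 p u) :=
  ⟨hp, hu, by rw [inner_cross3_cross3, hp, hu, hpu]; norm_num, hpu, inner_cross3_left _ _,
    inner_cross3_right _ _⟩

end Frame

/-- The unit vector at angle `φ` from `u` in the plane with orthonormal basis `(u, e)`. -/
noncomputable def dir (u e : E3) (φ : ℝ) : E3 := Real.cos φ • u + Real.sin φ • e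

theorem dir_add (u e : E3) (φ ψ : ℝ) :
    dir u e (φ + ψ) = Real.cos ψ • dir u e φ + Real.sin ψ • dir u e (φ + Real.pi / 2) := by
  simp only [dir, Real.cos_add, Real.sin_add, Real.cos_pi_div_two, Real.sin_pi_div_two]
  module

theorem dir_add_int_mul (u e : E3) (φ : ℝ) (k : ℤ) : dir u e (φ + 2 * Real.pi * k) = dir u e φ := by
  have : φ + 2 * Real.pi * k = φ + k * (2 * Real.pi) := by ring
  simp only [dir, this, Real.cos_add_int_mul_two_pi, Real.sin_add_int_mul_two_pi]

theorem exists_dir_eq_of_sq {x y : ℝ} (h : x ^ 2 + y ^ 2 = 1) :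
    ∃ φ : ℝ, x = Real.cos φ ∧ y = Real.sin φ := by
  have hz : ‖(⟨x, y⟩ : ℂ)‖ = 1 := by
    rw [← sq_eq_sq₀ (norm_nonneg _) zero_le_one, Complex.sq_norm, Complex.normSq_mk]
    linarith
  have hz0 : (⟨x, y⟩ : ℂ) ≠ 0 := by
    intro h0; rw [h0, norm_zero] at hz; norm_num at hz
  refine ⟨Complex.arg ⟨x, y⟩, ?_, ?_⟩
  · rw [Complex.cos_arg hz0, hz]; simp
  · rw [Complex.sin_arg, hz]; simp

namespace Frame

variable {p u e : E3}

theorem inner_dir (h : Frame p u e) (φ : ℝ) : ⟪p, dir u e φ⟫ = 0 := by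
  simp [dir, inner_add_right, inner_smul_right, h.pu, h.pe]

theorem inner_dir_self (h : Frame p u e) (φ : ℝ) : ⟪dir u e φ, dir u e φ⟫ = 1 := by
  simp only [dir, inner_add_right, inner_add_left, inner_smul_right, inner_smul_left, h.uu, h.ee,
    h.ue, h.eu, RCLike.conj_to_real]
  have := Real.sin_sq_add_cos_sq φ
  linarith

theorem exists_dir_eq (h : Frame p u e) {w : E3} (hpw : ⟪p, w⟫ = 0) (hw : ⟪w, w⟫ = 1) :
    ∃ φ, w = dir u e φ := by
  have hx := h.expand w
  rw [hpw, zero_smul, zero_add] at hx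
  have : ⟪u, w⟫ ^ 2 + ⟪e, w⟫ ^ 2 = 1 := by
    rw [hx] at hw
    simp only [inner_add_right, inner_add_left, inner_smul_right, inner_smul_left, h.uu, h.ee,
    h.ue, h.eu, RCLike.conj_to_real] at hw
    linarith
  obtain ⟨φ, h1, h2⟩ := exists_dir_eq_of_sq this
  exact ⟨φ, by rw [dir, ← h1, ← h2]; exact hx⟩

theorem dir_inj (h : Frame p u e) {φ ψ : ℝ} (hd : dir u e φ = dir u e ψ) :
    ∃ k : ℤ, φ = ψ + 2 * Real.pi * k := by
  have h1 : Real.cos φ = Real.cos ψ := by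
    have := congrArg (fun w => ⟪u, w⟫) hd
    simpa only [dir, inner_add_right, inner_smul_right, h.uu, h.ue, mul_one, mul_zero,
      add_zero] using this
  have h2 : Real.sin φ = Real.sin ψ := by
    have := congrArg (fun w => ⟪e, w⟫) hd
    simpa only [dir, inner_add_right, inner_smul_right, h.ee, h.eu, mul_one, mul_zero,
      zero_add] using this
  obtain ⟨k, hk⟩ := Real.Angle.angle_eq_iff_two_pi_dvd_sub.1 (Real.Angle.cos_sin_inj h1 h2)
  exact ⟨k, by linarith⟩

/-- Polar coordinates at `p` are unique. -/
theorem polar_inj (h : Frame p u e) {a b a' b' φ ψ : ℝ} (hb : 0 < b) (hb' : 0 ≤ b')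
    (heq : a • p + b • dir u e φ = a' • p + b' • dir u e ψ) :
    a = a' ∧ b = b' ∧ ∃ k : ℤ, φ = ψ + 2 * Real.pi * k := by
  have ha : a = a' := by
    have := congrArg (fun w => ⟪p, w⟫) heq
    simpa only [inner_add_right, inner_smul_right, h.pp, h.inner_dir, mul_one, mul_zero,
      add_zero] using this
  rw [ha] at heq
  have h2 := add_left_cancel heq
  have h3 : b = b' := by
    have := congrArg (fun w => ⟪w, w⟫) h2
    simp only [inner_smul_left, inner_smul_right, h.inner_dir_self, RCLike.conj_to_real] at this
    nlinarith
  rw [← h3] at h2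
  exact ⟨ha, h3, h.dir_inj (smul_right_injective _ hb.ne' h2)⟩

/-- Two frames at the same point differ by a rotation and possibly a reflection. -/
theorem change (h : Frame p u e) {u' e' : E3} (h' : Frame p u' e') :
    ∃ (A : ℝ) (s : ℝ), (s = 1 ∨ s = -1) ∧ ∀ φ, dir u' e' φ = dir u e (A + s * φ) := by
  obtain ⟨A, hA⟩ := h.exists_dir_eq h'.pu h'.uu
  obtain ⟨B, hB⟩ := h.exists_dir_eq h'.pe h'.ee
  have h0 : Real.cos (B - A) = 0 := by
    have := h'.ue
    rw [hA, hB] at this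
    simp only [dir, inner_add_right, inner_add_left, inner_smul_right, inner_smul_left, h.uu, h.ee,
      h.ue, h.eu, RCLike.conj_to_real] at this
    rw [Real.cos_sub]; linarith
  have hs : Real.sin (B - A) = 1 ∨ Real.sin (B - A) = -1 := by
    rw [← sq_eq_one_iff]
    have := Real.sin_sq_add_cos_sq (B - A)
    rw [h0] at this; linarith
  refine ⟨A, Real.sin (B - A), hs, fun φ => ?_⟩
  have hBA : B = A + (B - A) := by ring
  have e1 : dir u' e' φ = Real.cos φ • dir u e A + Real.sin φ • dir u e B := by
    conv_lhs => rw [dir, hA, hB]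
  have e2 : dir u e B = Real.sin (B - A) • dir u e (A + Real.pi / 2) := by
    conv_lhs => rw [hBA]
    rw [dir_add, h0, zero_smul, zero_add]
  rw [e1, e2, dir_add u e A (_ * φ)]
  rcases hs with hs | hs <;> rw [hs] <;> simp

end Frame

/-! ### Regions that are sectors near a point -/

/-- The angle `ψ` is represented modulo `2π` in the interval `[A, A + θ]`. -/
def InArc (A θ ψ : ℝ) : Prop :=
  ∃ k : ℤ, A ≤ ψ + 2 * Real.pi * k ∧ ψ + 2 * Real.pi * k ≤ A + θ

theorem inArc_add_int_mul {A θ ψ : ℝ} (k : ℤ) :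
    InArc A θ (ψ + 2 * Real.pi * k) ↔ InArc A θ ψ := by
  constructor
  · rintro ⟨l, h1, h2⟩
    refine ⟨k + l, ?_, ?_⟩ <;> push_cast <;> linarith
  · rintro ⟨l, h1, h2⟩
    refine ⟨l - k, ?_, ?_⟩ <;> push_cast <;> linarith

theorem inArc_shift {A B θ ψ : ℝ} : InArc A θ (ψ + B) ↔ InArc (A - B) θ ψ := by
  constructor <;> rintro ⟨l, h1, h2⟩ <;> exact ⟨l, by linarith, by linarith⟩

theorem inArc_neg {A θ ψ : ℝ} : InArc A θ (-ψ) ↔ InArc (-A - θ) θ ψ := by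
  constructor <;> rintro ⟨l, h1, h2⟩ <;>
  exact ⟨-l, by push_cast; linarith, by push_cast; linarith⟩

/-- `R` is near `p` the sector of the directions in `[A, A + θ]`, in the frame `(u, e)`. -/
def IsSector (R : Set S2) (p : S2) (u e : E3) (A θ : ℝ) : Prop :=
  -- The condition `0 < b` leaves out `p` itself, which has no direction.
  ∀ᶠ z : S2 in nhds p, ∀ a b ψ : ℝ, 0 < b → (z : E3) = a • (p : E3) + b • dir u e ψ →
    (z ∈ R ↔ InArc A θ ψ)

/-- The point `q` is seen from `p` in the direction `w`. -/
def Sees (p q : S2) (w : E3) : Prop := ∃ a b : ℝ, 0 < b ∧ (q : E3) = a • (p : E3) + b • w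

theorem IsInteriorAngle.exists_frame {R : Set S2} {p q r : S2} {θ : ℝ}
    (h : IsInteriorAngle R p q r θ) :
    0 < θ ∧ θ < 2 * Real.pi ∧ ∃ u e : E3, Frame (p : E3) u e ∧ Sees p q (dir u e 0) ∧
      Sees p r (dir u e θ) ∧ IsSector R p u e 0 θ := by
  obtain ⟨h0, h1, u, e, ho, hq, hr, hz⟩ := h
  have hf := frame_iff.1 ho
  refine ⟨h0, h1, u, e, hf, ?_, hr, ?_⟩
  · simpa [Sees, dir] using hq
  · refine hz.mono fun z hz a b ψ hb hzz => hz.trans ?_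
    constructor
    · rintro ⟨a', b', φ, hb', h1, h2, h3⟩
      obtain ⟨-, -, k, hk⟩ := hf.polar_inj hb hb' (hzz.symm.trans h3)
      exact ⟨-k, by rw [hk]; push_cast; linarith, by rw [hk]; push_cast; linarith⟩
    · rintro ⟨k, h1, h2⟩
      refine ⟨a, b, _, hb.le, h1, by linarith, ?_⟩
      rw [hzz, ← dir_add_int_mul u e ψ k]
      rfl

/-- A reflection reverses the arc of directions, so its old end becomes its start. This accounts for
`B - A - θ`. -/
theorem IsSector.change {R : Set S2} {p : S2} {u e u' e' : E3} {A θ B s : ℝ}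
    (hs : s = 1 ∨ s = -1) (hc : ∀ φ, dir u' e' φ = dir u e (B + s * φ))
    (h : IsSector R p u' e' A θ) :
    IsSector R p u e (if s = 1 then B + A else B - A - θ) θ := by
  refine h.mono fun z hz a b ψ hb hzz => ?_
  have := hz a b (s * (ψ - B)) hb (by
    rw [hc, hzz]; rcases hs with rfl | rfl <;> simp)
  rw [this]
  rcases hs with rfl | rfl
  · rw [if_pos rfl, one_mul, sub_eq_add_neg, inArc_shift]
    ring_nf
  · rw [if_neg (by norm_num)]
    have e1 : -1 * (ψ - B) = -(ψ + -B) := by ring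
    rw [e1, inArc_neg, inArc_shift]
    ring_nf

/-! ### Tilings of the circle by arcs -/

/-- Congruence of real numbers modulo `2π`. -/
def AngEq (a b : ℝ) : Prop := ∃ k : ℤ, a = b + 2 * Real.pi * k

theorem AngEq.symm {a b : ℝ} (h : AngEq a b) : AngEq b a := by
  obtain ⟨k, hk⟩ := h
  exact ⟨-k, by push_cast; linarith⟩

theorem AngEq.trans {a b c : ℝ} (h : AngEq a b) (h' : AngEq b c) : AngEq a c := by
  obtain ⟨k, hk⟩ := h
  obtain ⟨l, hl⟩ := h'
  exact ⟨k + l, by push_cast; linarith⟩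

theorem AngEq.add_right {a b : ℝ} (h : AngEq a b) (c : ℝ) : AngEq (a + c) (b + c) := by
  obtain ⟨k, hk⟩ := h
  exact ⟨k, by linarith⟩

theorem AngEq.inArc {a b A θ : ℝ} (h : AngEq a b) : InArc A θ a ↔ InArc A θ b := by
  obtain ⟨k, rfl⟩ := h
  exact inArc_add_int_mul k

theorem not_angEq_of_lt {a b : ℝ} (h : b < a) (h' : a < b + 2 * Real.pi) : ¬AngEq a b := by
  rintro ⟨k, hk⟩
  have hpi := Real.pi_pos
  have h1 : (0 : ℝ) < k := by nlinarith
  have h2 : (k : ℝ) < 1 := by nlinarith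
  norm_cast at h1 h2
  omega

theorem not_inArc_of_lt {A θ ψ : ℝ} (h : A + θ < ψ) (h' : ψ < A + 2 * Real.pi) :
    ¬InArc A θ ψ := by
  rintro ⟨k, h1, h2⟩
  have hpi := Real.pi_pos
  have h3 : (k : ℝ) < 0 := by nlinarith
  have h4 : (-1 : ℝ) < k := by nlinarith
  norm_cast at h3
  have h5 : (-1 : ℤ) < k := by exact_mod_cast h4
  omega

theorem inArc_of_le {A θ ψ : ℝ} (h : A ≤ ψ) (h' : ψ ≤ A + θ) : InArc A θ ψ :=
  ⟨0, by simpa using h, by simpa using h'⟩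

theorem AngEq.inArc_left {a A B θ : ℝ} (h : AngEq A B) : InArc A θ a ↔ InArc B θ a := by
  obtain ⟨k, rfl⟩ := h
  have := inArc_shift (A := B) (B := -(2 * Real.pi * k)) (θ := θ) (ψ := a)
  rw [sub_neg_eq_add] at this
  rw [← this]
  have h2 := inArc_add_int_mul (A := B) (θ := θ) (ψ := a) (-k)
  rw [← h2]
  push_cast
  ring_nf

/-- As balls of `AddCircle`, arcs inherit closedness and a measure. -/
theorem inArc_iff_mem_closedBall {A θ ψ : ℝ} :
    InArc A θ ψ ↔
      (ψ : AddCircle (2 * Real.pi)) ∈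
        Metric.closedBall ((A + θ / 2 : ℝ) : AddCircle (2 * Real.pi)) (θ / 2) := by
  rw [← Set.mem_preimage, AddCircle.coe_real_preimage_closedBall_eq_iUnion, Set.mem_iUnion]
  simp only [Real.closedBall_eq_Icc, Set.mem_Icc, zsmul_eq_mul]
  constructor
  · rintro ⟨k, h1, h2⟩
    exact ⟨-k, by push_cast; linarith, by push_cast; linarith⟩
  · rintro ⟨k, h1, h2⟩
    exact ⟨-k, by push_cast; linarith, by push_cast; linarith⟩

theorem isClosed_inArc (A θ : ℝ) : IsClosed {ψ | InArc A θ ψ} := by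
  simp only [inArc_iff_mem_closedBall]
  exact Metric.isClosed_closedBall.preimage (AddCircle.continuous_mk' _)

/-- A finite family of arcs `[A c, A c + θ c]` that covers the circle, where different arcs
meet in end points only. -/
structure CircleTiling {ι : Type*} (A θ : ι → ℝ) : Prop where
  pos : ∀ c, 0 < θ c
  lt : ∀ c, θ c < 2 * Real.pi
  cover : ∀ ψ, ∃ c, InArc (A c) (θ c) ψ
  overlap : ∀ c c' ψ, c ≠ c' → InArc (A c) (θ c) ψ → InArc (A c') (θ c') ψ →
    AngEq ψ (A c) ∨ AngEq ψ (A c + θ c)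

namespace CircleTiling

variable {ι : Type*} {A θ : ι → ℝ}

/-- Two arcs with a common start also share the points shortly after it, which are not end points.
-/
theorem start_inj (h : CircleTiling A θ) {c c' : ι} (hc : AngEq (A c) (A c')) : c = c' := by
  by_contra hne
  obtain ⟨ε, h0, h1⟩ := exists_between (lt_min (h.pos c) (h.pos c'))
  have h2 := lt_of_lt_of_le h1 (min_le_left _ _)
  have h3 := lt_of_lt_of_le h1 (min_le_right _ _)
  have h4 := h.lt c
  have h5 : InArc (A c') (θ c') (A c + ε) := by
    rw [(hc.add_right ε).inArc]
    exact inArc_of_le (by linarith) (by linarith)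
  rcases h.overlap c c' _ hne (inArc_of_le (by linarith) (by linarith)) h5 with h6 | h6
  · exact not_angEq_of_lt (by linarith) (by linarith) h6
  · exact not_angEq_of_lt (by linarith) (by linarith) h6.symm

theorem end_inj (h : CircleTiling A θ) {c c' : ι} (hc : AngEq (A c + θ c) (A c' + θ c')) :
    c = c' := by
  by_contra hne
  obtain ⟨ε, h0, h1⟩ := exists_between (lt_min (h.pos c) (h.pos c'))
  have h2 := lt_of_lt_of_le h1 (min_le_left _ _)
  have h3 := lt_of_lt_of_le h1 (min_le_right _ _)
  have h4 := h.lt c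
  have h5 : InArc (A c') (θ c') (A c + θ c - ε) := by
    rw [sub_eq_add_neg, (hc.add_right (-ε)).inArc]
    exact inArc_of_le (by linarith) (by linarith)
  rcases h.overlap c c' _ hne (inArc_of_le (by linarith) (by linarith)) h5 with h6 | h6
  · exact not_angEq_of_lt (by linarith) (by linarith) h6
  · exact not_angEq_of_lt (by linarith) (by linarith) h6.symm

/-- Finitely many arcs cover the points just after the end of `c`, so one arc contains such points
arbitrarily close to that end. Being closed, it contains the end itself, which must be one of its
end points; it cannot be its last point by `end_inj`. -/
theorem exists_next [Finite ι] (h : CircleTiling A θ) (c : ι) :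
    ∃ c', AngEq (A c') (A c + θ c) := by
  have h1 : ∃ c', ∃ᶠ ε in nhdsWithin (0 : ℝ) (Set.Ioi 0), InArc (A c') (θ c') (A c + θ c + ε) := by
    by_contra hcon
    simp only [not_exists, Filter.not_frequently] at hcon
    obtain ⟨ε, hε⟩ := (Filter.eventually_all.2 hcon).exists
    obtain ⟨c', hc'⟩ := h.cover (A c + θ c + ε)
    exact hε c' hc'
  obtain ⟨c', hf⟩ := h1
  have hne : c ≠ c' := by
    rintro rfl
    have h2 : ∀ᶠ ε in nhdsWithin (0 : ℝ) (Set.Ioi 0), ε ∈ Set.Ioo 0 (2 * Real.pi - θ c) :=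
      Ioo_mem_nhdsGT (by have := h.lt c; linarith)
    obtain ⟨ε, h3, h4, h5⟩ := (hf.and_eventually h2).exists
    exact not_inArc_of_lt (by linarith) (by linarith) h3
  have hD : InArc (A c') (θ c') (A c + θ c) := by
    have ht : Filter.Tendsto (fun ε => A c + θ c + ε) (nhdsWithin (0 : ℝ) (Set.Ioi 0))
        (nhds (A c + θ c)) := by
      have : Filter.Tendsto (fun ε => A c + θ c + ε) (nhds (0 : ℝ)) (nhds (A c + θ c + 0)) :=
        (continuous_const.add continuous_id).tendsto 0
      rw [add_zero] at this
      exact this.mono_left nhdsWithin_le_nhds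
    exact (isClosed_inArc (A c') (θ c')).mem_of_frequently_of_tendsto hf ht
  have hD' : InArc (A c) (θ c) (A c + θ c) := inArc_of_le (by have := h.pos c; linarith) le_rfl
  rcases h.overlap c' c _ hne.symm hD hD' with h6 | h6
  · exact ⟨c', h6.symm⟩
  · exact absurd (h.end_inj h6) hne

/-- The arcs overlap in null sets only, so their lengths add up to the measure of the circle. -/
theorem sum_eq [Fintype ι] (h : CircleTiling A θ) : ∑ c, θ c = 2 * Real.pi := by
  have : Fact (0 < 2 * Real.pi) := ⟨Real.two_pi_pos⟩
  let S : ι → Set (AddCircle (2 * Real.pi)) := fun c =>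
    Metric.closedBall ((A c + θ c / 2 : ℝ) : AddCircle (2 * Real.pi)) (θ c / 2)
  have hS : ∀ c, MeasureTheory.volume (S c) = ENNReal.ofReal (θ c) := by
    intro c
    rw [AddCircle.volume_closedBall, min_eq_right (by have := h.lt c; linarith)]
    congr 1; ring
  have hpt : ∀ x : AddCircle (2 * Real.pi), MeasureTheory.volume ({x} : Set _) = 0 := by
    intro x
    rw [← Metric.closedBall_zero, AddCircle.volume_closedBall, mul_zero,
      min_eq_right Real.two_pi_pos.le, ENNReal.ofReal_zero]
  have hU : ⋃ c, S c = Set.univ := by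
    rw [Set.eq_univ_iff_forall]
    intro x
    induction x using QuotientAddGroup.induction_on with
    | H ψ =>
      obtain ⟨c, hc⟩ := h.cover ψ
      exact Set.mem_iUnion.2 ⟨c, inArc_iff_mem_closedBall.1 hc⟩
  have hd : Pairwise (Function.onFun (MeasureTheory.AEDisjoint MeasureTheory.volume) S) := by
    intro c c' hne
    refine MeasureTheory.measure_mono_null (t := {((A c : ℝ) : AddCircle (2 * Real.pi))} ∪
      {((A c + θ c : ℝ) : AddCircle (2 * Real.pi))}) ?_ (MeasureTheory.measure_union_null (hpt _)
        (hpt _))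
    rintro x ⟨h1, h2⟩
    have key : ∀ a b : ℝ, AngEq a b → (a : AddCircle (2 * Real.pi)) = b := by
      rintro a b ⟨k, rfl⟩
      have : 2 * Real.pi * (k : ℝ) = k • (2 * Real.pi) := by rw [zsmul_eq_mul]; ring
      rw [this, AddCircle.coe_add, AddCircle.coe_zsmul, AddCircle.coe_period]
      simp
    induction x using QuotientAddGroup.induction_on with
    | H ψ =>
      rcases h.overlap c c' ψ hne (inArc_iff_mem_closedBall.2 h1)
        (inArc_iff_mem_closedBall.2 h2) with h3 | h3
      · left; exact key _ _ h3
      · right; exact key _ _ h3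
  have hm := MeasureTheory.measure_iUnion₀ hd
    (fun c => Metric.isClosed_closedBall.measurableSet.nullMeasurableSet)
  rw [hU, AddCircle.measure_univ, tsum_fintype] at hm
  simp only [hS] at hm
  rw [← ENNReal.ofReal_sum_of_nonneg (fun c _ => (h.pos c).le)] at hm
  exact ((ENNReal.ofReal_eq_ofReal_iff Real.two_pi_pos.le
    (Finset.sum_nonneg fun c _ => (h.pos c).le)).1 hm).symm

/-- The sum is a multiple of `2π` that lies strictly between `0` and `4π`. -/
theorem add_eq_of_mutual (h : CircleTiling A θ) {c c' : ι} (h1 : AngEq (A c') (A c + θ c))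
    (h2 : AngEq (A c) (A c' + θ c')) : θ c + θ c' = 2 * Real.pi := by
  obtain ⟨k, hk⟩ := h1
  obtain ⟨l, hl⟩ := h2
  have h3 : θ c + θ c' = 2 * Real.pi * (-(k + l) : ℤ) := by push_cast; linarith
  have a1 := h.pos c
  have a2 := h.pos c'
  have a3 := h.lt c
  have a4 := h.lt c'
  have hpi := Real.pi_pos
  generalize (-(k + l) : ℤ) = j at h3
  have h4 : (0 : ℝ) < j := by nlinarith
  have h5 : (j : ℝ) < 2 := by nlinarith
  have h6 : j = 1 := by
    have h4' : 0 < j := by exact_mod_cast h4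
    have h5' : j < 2 := by exact_mod_cast h5
    omega
  rw [h3, h6]; simp

end CircleTiling

/-! ### Interior angles are determined by the region, and invariant under isometries -/

namespace Frame

variable {p : S2} {u e : E3}

theorem norm_polar (h : Frame (p : E3) u e) (ψ t : ℝ) :
    ‖Real.cos t • (p : E3) + Real.sin t • dir u e ψ‖ = 1 := by
  have h1 : ⟪dir u e ψ, (p : E3)⟫ = 0 := by rw [real_inner_comm]; exact h.inner_dir ψ
  have h2 : ⟪Real.cos t • (p : E3) + Real.sin t • dir u e ψ,
      Real.cos t • (p : E3) + Real.sin t • dir u e ψ⟫ = 1 := by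
    simp only [inner_add_left, inner_add_right, inner_smul_left, inner_smul_right, h.pp,
      h.inner_dir, h.inner_dir_self, h1, RCLike.conj_to_real]
    have := Real.sin_sq_add_cos_sq t
    linarith
  rw [real_inner_self_eq_norm_sq] at h2
  exact (pow_eq_one_iff_of_nonneg (norm_nonneg _) two_ne_zero).1 h2

/-- The point at distance `t` from `p` in the direction `ψ`. -/
noncomputable def polar (h : Frame (p : E3) u e) (ψ t : ℝ) : S2 :=
  ⟨Real.cos t • (p : E3) + Real.sin t • dir u e ψ, by simpa using h.norm_polar ψ t⟩

theorem coe_polar (h : Frame (p : E3) u e) (ψ t : ℝ) :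
    (h.polar ψ t : E3) = Real.cos t • (p : E3) + Real.sin t • dir u e ψ := rfl

theorem tendsto_polar (h : Frame (p : E3) u e) (ψ : ℝ) :
    Filter.Tendsto (h.polar ψ) (nhdsWithin 0 (Set.Ioi 0)) (nhds p) := by
  have hc : Continuous (h.polar ψ) := by
    apply Continuous.subtype_mk
    fun_prop
  have h0 : h.polar ψ 0 = p := by
    apply Subtype.ext
    rw [coe_polar]; simp
  have := hc.tendsto 0
  rw [h0] at this
  exact this.mono_left nhdsWithin_le_nhds

theorem eventually_sin_pos : ∀ᶠ t : ℝ in nhdsWithin 0 (Set.Ioi 0), 0 < Real.sin t := by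
  have : ∀ᶠ t : ℝ in nhdsWithin 0 (Set.Ioi 0), t ∈ Set.Ioo 0 Real.pi := Ioo_mem_nhdsGT Real.pi_pos
  exact this.mono fun t ht => Real.sin_pos_of_pos_of_lt_pi ht.1 ht.2

end Frame

theorem IsSector.eventually_polar {R : Set S2} {p : S2} {u e : E3} {A θ : ℝ}
    (hs : IsSector R p u e A θ) (h : Frame (p : E3) u e) (ψ : ℝ) :
    ∀ᶠ t in nhdsWithin 0 (Set.Ioi 0), h.polar ψ t ∈ R ↔ InArc A θ ψ := by
  filter_upwards [(h.tendsto_polar ψ).eventually hs, Frame.eventually_sin_pos] with t ht hst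
  exact ht _ _ _ hst (h.coe_polar ψ t)

theorem IsSector.inArc_iff {R : Set S2} {p : S2} {u e : E3} {A θ A' θ' : ℝ}
    (h : Frame (p : E3) u e) (hs : IsSector R p u e A θ) (hs' : IsSector R p u e A' θ') (ψ : ℝ) :
    InArc A θ ψ ↔ InArc A' θ' ψ := by
  obtain ⟨t, h1, h2⟩ := ((hs.eventually_polar h ψ).and (hs'.eventually_polar h ψ)).exists
  exact h1.symm.trans h2

theorem Sees.angEq {p q : S2} {u e : E3} {φ ψ : ℝ} (h : Frame (p : E3) u e)
    (h1 : Sees p q (dir u e φ)) (h2 : Sees p q (dir u e ψ)) : AngEq φ ψ := by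
  obtain ⟨a, b, hb, hq⟩ := h1
  obtain ⟨a', b', hb', hq'⟩ := h2
  exact (h.polar_inj hb hb'.le (hq.symm.trans hq')).2.2

theorem Sees.congr {p q : S2} {u e : E3} {φ ψ : ℝ} (h : AngEq φ ψ)
    (h1 : Sees p q (dir u e φ)) : Sees p q (dir u e ψ) := by
  obtain ⟨k, rfl⟩ := h
  rwa [dir_add_int_mul] at h1

/-- The interior angle at `p`, in an arbitrary frame at `p`. -/
theorem IsInteriorAngle.exists_arc {R : Set S2} {p q r : S2} {θ : ℝ} {u e : E3}
    (h : IsInteriorAngle R p q r θ) (hf : Frame (p : E3) u e) :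
    ∃ A, IsSector R p u e A θ ∧
      ((Sees p q (dir u e A) ∧ Sees p r (dir u e (A + θ))) ∨
        (Sees p r (dir u e A) ∧ Sees p q (dir u e (A + θ)))) := by
  obtain ⟨-, -, u', e', hf', hq, hr, hs⟩ := h.exists_frame
  obtain ⟨B, s, hs1, hc⟩ := hf.change hf'
  have hsec := hs.change hs1 hc
  rw [hc] at hq hr
  refine ⟨_, hsec, ?_⟩
  rcases hs1 with rfl | rfl
  · left
    rw [if_pos rfl, add_zero]
    rw [one_mul] at hq hr
    rw [add_zero] at hq
    exact ⟨hq, hr⟩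
  · right
    rw [if_neg (by norm_num)]
    refine ⟨?_, ?_⟩
    · convert hr using 2; ring
    · convert hq using 2; ring

/-- Both angles describe the same set of directions, with `q` at one end. If `q` is the start of
both arcs, the longer one has a direction too many. -/
theorem IsInteriorAngle.unique {R : Set S2} {p q r : S2} {θ θ' : ℝ}
    (h : IsInteriorAngle R p q r θ) (h' : IsInteriorAngle R p q r θ') : θ = θ' := by
  wlog hlt : θ < θ' generalizing θ θ'
  · rcases lt_trichotomy θ θ' with h1 | h1 | h1
    · exact absurd h1 hlt
    · exact h1
    · exact (this h' h h1).symm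
  exfalso
  obtain ⟨h0, h1, u, e, hf, hq, hr, hs⟩ := h.exists_frame
  obtain ⟨A, hs', hA⟩ := h'.exists_arc hf
  have h0' := h'.1
  have h1' := h'.2.1
  have hiff := hs.inArc_iff hf hs'
  rcases hA with ⟨hA, -⟩ | ⟨-, hA⟩
  · have hAe : AngEq A 0 := hA.angEq hf hq
    have h3 : InArc A θ' θ' := by
      rw [hAe.inArc_left]; exact inArc_of_le h0'.le (by linarith)
    exact not_inArc_of_lt (by linarith) (by linarith) ((hiff _).2 h3)
  -- Here the arcs leave the direction of `q` on opposite sides. A direction just inside the first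
  -- one is missed by the second, because `θ' < 2π`.
  · have hAe : AngEq A (-θ') := by
      have := (hA.angEq hf hq).add_right (-θ')
      simpa using this
    obtain ⟨ε, e0, e1⟩ := exists_between (lt_min h0 (sub_pos.2 h1'))
    have e2 := lt_of_lt_of_le e1 (min_le_left _ _)
    have e3 := lt_of_lt_of_le e1 (min_le_right _ _)
    have h3 := (hiff ε).1 (inArc_of_le e0.le (by linarith))
    rw [hAe.inArc_left] at h3
    exact not_inArc_of_lt (by linarith) (by linarith) h3

theorem dir_reverse (u e : E3) (θ φ : ℝ) :
    dir (dir u e θ) (Real.sin θ • u - Real.cos θ • e) φ = dir u e (θ - φ) := by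
  simp only [dir, Real.cos_sub, Real.sin_sub]
  module

theorem Frame.reverse {p u e : E3} (h : Frame p u e) (θ : ℝ) :
    Frame p (dir u e θ) (Real.sin θ • u - Real.cos θ • e) := by
  have h2 : Real.sin θ • u - Real.cos θ • e = dir u e (θ - Real.pi / 2) := by
    simp only [dir, Real.cos_sub, Real.sin_sub, Real.cos_pi_div_two, Real.sin_pi_div_two]
    module
  refine ⟨h.pp, h.inner_dir_self _, h2 ▸ h.inner_dir_self _, h.inner_dir _, h2 ▸ h.inner_dir _, ?_⟩
  simp only [dir, inner_add_left, inner_sub_right, inner_smul_left, inner_smul_right, h.uu, h.ee,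
    h.ue, h.eu, RCLike.conj_to_real]
  ring

theorem IsInteriorAngle.symm {R : Set S2} {p q r : S2} {θ : ℝ}
    (h : IsInteriorAngle R p q r θ) : IsInteriorAngle R p r q θ := by
  obtain ⟨h0, h1, u, e, ho, hq, hr, hz⟩ := h
  refine ⟨h0, h1, dir u e θ, Real.sin θ • u - Real.cos θ • e,
    frame_iff.2 ((frame_iff.1 ho).reverse θ), hr, ?_, ?_⟩
  · have := dir_reverse u e θ θ
    rw [sub_self] at this
    change ∃ a b : ℝ, 0 < b ∧ (q : E3) = a • (p : E3) +
      b • dir (dir u e θ) (Real.sin θ • u - Real.cos θ • e) θ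
    rw [this]
    simpa [dir] using hq
  · refine hz.mono fun z hz => hz.trans ?_
    have key : ∀ φ, Real.cos φ • dir u e θ + Real.sin φ • (Real.sin θ • u - Real.cos θ • e) =
      dir u e (θ - φ) := dir_reverse u e θ
    simp only [key]
    constructor
    · rintro ⟨a, b, φ, hb, h2, h3, h4⟩
      refine ⟨a, b, θ - φ, hb, by linarith, by linarith, ?_⟩
      rw [sub_sub_cancel]; exact h4
    · rintro ⟨a, b, φ, hb, h2, h3, h4⟩
      exact ⟨a, b, θ - φ, hb, by linarith, by linarith, h4⟩

/-- The action of a linear isometry on the sphere. -/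
noncomputable def sphereMap (g : E3 ≃ₗᵢ[ℝ] E3) (z : S2) : S2 :=
  ⟨g z, by rw [mem_sphere_zero_iff_norm, g.norm_map]; exact norm_eq_of_mem_sphere z⟩

theorem continuous_sphereMap (g : E3 ≃ₗᵢ[ℝ] E3) : Continuous (sphereMap g) :=
  Continuous.subtype_mk (g.continuous.comp continuous_subtype_val) _

/-- Frames of either handedness are admitted, so reflections carry interior angles to interior
angles just as rotations do. -/
theorem IsInteriorAngle.map {R R' : Set S2} {p q r p' q' r' : S2} {θ : ℝ} (g : E3 ≃ₗᵢ[ℝ] E3)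
    (hp : (p' : E3) = g p) (hq : (q' : E3) = g q) (hr : (r' : E3) = g r)
    (hR : ∀ z : S2, z ∈ R' ↔ ∃ w ∈ R, (z : E3) = g w)
    (h : IsInteriorAngle R p q r θ) : IsInteriorAngle R' p' q' r' θ := by
  obtain ⟨h0, h1, u, e, ho, ⟨a, b, hb, hq1⟩, ⟨a', b', hb', hr1⟩, hz⟩ := h
  refine ⟨h0, h1, g u, g e, ?_, ⟨a, b, hb, ?_⟩, ⟨a', b', hb', ?_⟩, ?_⟩
  · have := ho.comp_linearIsometryEquiv g
    convert this using 1
    ext i : 1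
    fin_cases i <;> simp [hp]
  · rw [hq, hq1, hp]; simp
  · rw [hr, hr1, hp]; simp
  · have hc : Filter.Tendsto (sphereMap g.symm) (nhds p') (nhds p) := by
      have : sphereMap g.symm p' = p := by
        apply Subtype.ext
        change g.symm (p' : E3) = p
        rw [hp]; simp
      rw [← this]
      exact (continuous_sphereMap g.symm).tendsto p'
    refine (hc.eventually hz).mono fun z hz => ?_
    have h3 : z ∈ R' ↔ sphereMap g.symm z ∈ R := by
      rw [hR]
      constructor
      · rintro ⟨w, hw, hzw⟩
        have : sphereMap g.symm z = w := by
          apply Subtype.ext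
          change g.symm (z : E3) = w
          rw [hzw]; simp
        rwa [this]
      · intro hw
        exact ⟨_, hw, (g.apply_symm_apply (z : E3)).symm⟩
    rw [h3, hz]
    have key : ∀ w : E3, ((sphereMap g.symm z : S2) : E3) = w ↔ (z : E3) = g w := by
      intro w
      change g.symm (z : E3) = w ↔ _
      exact g.toLinearEquiv.symm_apply_eq
    simp only [key, hp, map_add, map_smul]

namespace SphericalPolygon

theorem Congruent.sides_eq {n k : ℕ} {P : SphericalPolygon n} {P' : SphericalPolygon k}
    (h : P.Congruent P') : k = n := by
  obtain ⟨g, σ, -⟩ := h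
  have h1 := P.three_le
  have h2 := P'.three_le
  have : NeZero n := ⟨by omega⟩
  have : NeZero k := ⟨by omega⟩
  have := Fintype.card_congr σ
  rwa [ZMod.card, ZMod.card] at this

theorem edgeLength_eq_of_map {n k : ℕ} {P : SphericalPolygon n} {P' : SphericalPolygon k}
    {g : E3 ≃ₗᵢ[ℝ] E3} {σ : ZMod k → ZMod n}
    (hv : ∀ i, (P'.vertex i : E3) = g (P.vertex (σ i))) (i : ZMod k) :
    P'.edgeLength i =
      InnerProductGeometry.angle (P.vertex (σ i) : E3) (P.vertex (σ (i + 1)) : E3) := by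
  rw [edgeLength, hv, hv]
  exact g.toLinearIsometry.angle_map _ _

/-- Corresponding sides and angles of congruent polygons are equal. -/
theorem Congruent.exists_equiv {n k : ℕ} {P : SphericalPolygon n} {P' : SphericalPolygon k}
    (h : P.Congruent P') : ∃ σ : ZMod k ≃ ZMod n, (∀ i, P'.angle i = P.angle (σ i)) ∧
      ((∀ i, σ (i + 1) = σ i + 1 ∧ P'.edgeLength i = P.edgeLength (σ i)) ∨
        (∀ i, σ (i + 1) = σ i - 1 ∧ P'.edgeLength i = P.edgeLength (σ i - 1))) := by
  obtain ⟨g, σ, hσ, hv, hR⟩ := h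
  refine ⟨σ, ?_, ?_⟩
  · intro i
    have h1 := (P.isInteriorAngle (σ i)).map g (hv i)
      (q' := sphereMap g (P.vertex (σ i + 1))) rfl (r' := sphereMap g (P.vertex (σ i - 1))) rfl hR
    rcases hσ with hσ | hσ
    · have e1 : sphereMap g (P.vertex (σ i + 1)) = P'.vertex (i + 1) := by
        apply Subtype.ext; rw [hv, hσ]; rfl
      have e2 : sphereMap g (P.vertex (σ i - 1)) = P'.vertex (i - 1) := by
        apply Subtype.ext
        have := hσ (i - 1)
        rw [sub_add_cancel] at this
        rw [hv, this, add_sub_cancel_right]; rfl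
      rw [e1, e2] at h1
      exact (P'.isInteriorAngle i).unique h1
    · have e1 : sphereMap g (P.vertex (σ i - 1)) = P'.vertex (i + 1) := by
        apply Subtype.ext; rw [hv, hσ]; rfl
      have e2 : sphereMap g (P.vertex (σ i + 1)) = P'.vertex (i - 1) := by
        apply Subtype.ext
        have := hσ (i - 1)
        rw [sub_add_cancel] at this
        rw [hv, this, sub_add_cancel]; rfl
      rw [e1, e2] at h1
      exact (P'.isInteriorAngle i).unique h1.symm
  · refine hσ.imp (fun hσ i => ⟨hσ i, ?_⟩) (fun hσ i => ⟨hσ i, ?_⟩)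
    · rw [edgeLength_eq_of_map hv, hσ]; rfl
    · rw [edgeLength_eq_of_map hv, hσ, InnerProductGeometry.angle_comm, edgeLength, sub_add_cancel]

end SphericalPolygon

/-! ### Arcs -/

theorem left_mem_arc (p q : S2) : p ∈ arc p q := ⟨1, 0, by simp⟩

theorem arc_comm (p q : S2) : arc p q = arc q p := by
  ext z
  constructor <;> rintro ⟨a, b, ha, hb, h⟩ <;> exact ⟨b, a, hb, ha, by rw [h, add_comm]⟩

theorem nonneg_comb_ne_zero {p q : S2} (h : p ≠ -q) {a b : ℝ} (ha : 0 ≤ a) (hb : 0 ≤ b)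
    (hab : 0 < a + b) : a • (p : E3) + b • (q : E3) ≠ 0 := by
  intro h0
  have h1 : a • (p : E3) = -(b • (q : E3)) := eq_neg_of_add_eq_zero_left h0
  have h2 : a = b := by
    have := congrArg norm h1
    rwa [norm_neg, norm_smul, norm_smul, norm_eq_of_mem_sphere, norm_eq_of_mem_sphere, mul_one,
      mul_one, Real.norm_of_nonneg ha, Real.norm_of_nonneg hb] at this
  subst h2
  apply h
  have ha0 : a ≠ 0 := by intro h; rw [h] at hab; simp at hab
  apply Subtype.ext
  rw [← smul_neg] at h1
  exact smul_right_injective _ ha0 h1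

/-- Radial projection to the sphere. -/
noncomputable def toSphere (w : E3) : S2 :=
  -- An arbitrary value at the origin; the lemmas that evaluate the projection assume a nonzero
  -- argument.
  if h : w = 0 then ⟨EuclideanSpace.single 0 1, by simp⟩
  else ⟨‖w‖⁻¹ • w, by simp [norm_smul, norm_ne_zero_iff.2 h]⟩

theorem coe_toSphere {w : E3} (h : w ≠ 0) : (toSphere w : E3) = ‖w‖⁻¹ • w := by
  simp [toSphere, h]

theorem toSphere_smul (z : S2) {c : ℝ} (hc : 0 < c) : toSphere (c • (z : E3)) = z := by
  have hz : (z : E3) ≠ 0 := ne_zero_of_mem_unit_sphere z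
  apply Subtype.ext
  rw [coe_toSphere (smul_ne_zero hc.ne' hz), norm_smul, norm_eq_of_mem_sphere, mul_one, smul_smul,
    Real.norm_of_nonneg hc.le, inv_mul_cancel₀ hc.ne', one_smul]

theorem continuousAt_toSphere {w : E3} (h : w ≠ 0) : ContinuousAt toSphere w := by
  rw [Topology.IsInducing.subtypeVal.continuousAt_iff]
  have h1 : ContinuousAt (fun w : E3 => ‖w‖⁻¹ • w) w :=
    (continuousAt_id.norm.inv₀ (norm_ne_zero_iff.2 h)).smul continuousAt_id
  refine h1.congr ?_
  filter_upwards [isOpen_ne.mem_nhds h] with w hw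
  exact (coe_toSphere hw).symm

theorem toSphere_mem_arc {p q : S2} {a b : ℝ} (ha : 0 ≤ a) (hb : 0 ≤ b)
    (h : a • (p : E3) + b • (q : E3) ≠ 0) : toSphere (a • (p : E3) + b • (q : E3)) ∈ arc p q :=
  ⟨‖a • (p : E3) + b • (q : E3)‖⁻¹ * a, ‖a • (p : E3) + b • (q : E3)‖⁻¹ * b,
    mul_nonneg (by positivity) ha, mul_nonneg (by positivity) hb, by
      rw [coe_toSphere h, smul_add, smul_smul, smul_smul]⟩

theorem isClosed_arc {p q : S2} (h : p ≠ -q) : IsClosed (arc p q) := by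
  have hne : ∀ τ ∈ Set.Icc (0 : ℝ) 1, (1 - τ) • (p : E3) + τ • (q : E3) ≠ 0 := fun τ hτ =>
    nonneg_comb_ne_zero h (by linarith [hτ.2]) hτ.1 (by linarith)
  have : arc p q = (fun τ : ℝ => toSphere ((1 - τ) • (p : E3) + τ • (q : E3))) ''
      Set.Icc (0 : ℝ) 1 := by
    ext z
    constructor
    · rintro ⟨a, b, ha, hb, hz⟩
      have hab : 0 < a + b := by
        by_contra hcon
        have ha0 : a = 0 := by linarith
        have hb0 : b = 0 := by linarith
        rw [ha0, hb0] at hz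
        exact ne_zero_of_mem_unit_sphere z (by simpa using hz)
      refine ⟨b / (a + b), ⟨by positivity, by rw [div_le_one hab]; linarith⟩, ?_⟩
      have : (1 - b / (a + b)) • (p : E3) + (b / (a + b)) • (q : E3) = (a + b)⁻¹ • (z : E3) := by
        rw [hz, smul_add, smul_smul, smul_smul]
        congr 2 <;> field_simp
        ring
      dsimp only
      rw [this]
      exact toSphere_smul z (inv_pos.2 hab)
    · rintro ⟨τ, hτ, rfl⟩
      dsimp only
      exact toSphere_mem_arc (by linarith [hτ.2]) hτ.1 (hne τ hτ)
  rw [this]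
  refine (isCompact_Icc.image_of_continuousOn fun τ hτ => ?_).isClosed
  exact ((continuousAt_toSphere (hne τ hτ)).comp (f := fun τ : ℝ => (1 - τ) • (p : E3) +
    τ • (q : E3)) (by fun_prop)).continuousWithinAt

/-- If two points are seen in the same direction, one of them lies on the arc to the other. -/
theorem Sees.mem_arc_or {p q r : S2} {w : E3} (hq : Sees p q w) (hr : Sees p r w) :
    q ∈ arc p r ∨ r ∈ arc p q := by
  obtain ⟨a, b, hb, hq⟩ := hq
  obtain ⟨a', b', hb', hr⟩ := hr
  rcases le_total (b * a') (a * b') with h | h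
  · left
    refine ⟨a - b * a' / b', b / b', ?_, by positivity, ?_⟩
    · rw [sub_nonneg, div_le_iff₀ hb']; exact h
    · rw [hr, hq, smul_add, smul_smul, smul_smul, div_mul_cancel₀ _ hb'.ne', ← add_assoc,
        ← add_smul]
      congr 2
      ring
  · right
    refine ⟨a' - b' * a / b, b' / b, ?_, by positivity, ?_⟩
    · rw [sub_nonneg, div_le_iff₀ hb]; linarith
    · rw [hr, hq, smul_add, smul_smul, smul_smul, div_mul_cancel₀ _ hb.ne', ← add_assoc,
        ← add_smul]
      congr 2
      ring

theorem Sees.angEq_of_polar_mem_arc {p q : S2} {u e : E3} {φ ψ t : ℝ} (h : Frame (p : E3) u e)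
    (hq : Sees p q (dir u e φ)) (ht : 0 < Real.sin t) (hm : h.polar ψ t ∈ arc p q) :
    AngEq ψ φ := by
  obtain ⟨a, b, hb, hq⟩ := hq
  obtain ⟨a', b', ha', hb', hz⟩ := hm
  have h1 : Real.cos t • (p : E3) + Real.sin t • dir u e ψ =
      (a' + b' * a) • (p : E3) + (b' * b) • dir u e φ := by
    rw [← h.coe_polar, hz, hq]; module
  exact (h.polar_inj ht (by positivity) h1).2.2

/-! ### Vertices and edges of polygons -/

namespace SphericalPolygon

variable {n : ℕ} (P : SphericalPolygon n)

include P in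
theorem add_one_ne (i : ZMod n) : i + 1 ≠ i := by
  have := P.three_le
  have : Fact (1 < n) := ⟨by omega⟩
  intro h
  exact one_ne_zero (add_eq_left.1 h)

theorem eq_or_eq_of_vertex_mem_arc {l i : ZMod n}
    (h : P.vertex l ∈ arc (P.vertex i) (P.vertex (i + 1))) : l = i ∨ l = i + 1 := by
  by_contra hcon
  push Not at hcon
  obtain ⟨h1, h2⟩ := hcon
  by_cases h3 : i = l + 1
  · subst h3
    have := P.edge_inter_next l
    have hm : P.vertex l ∈ ({P.vertex (l + 1)} : Set S2) := by
      rw [← this]; exact ⟨left_mem_arc _ _, h⟩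
    exact P.vertex_ne l hm
  · exact Set.disjoint_left.1 (P.edge_disjoint l i h1 h3 h2) (left_mem_arc _ _) h

theorem vertex_injective : Function.Injective P.vertex := by
  intro l i h
  have h1 : P.vertex l ∈ arc (P.vertex i) (P.vertex (i + 1)) := by
    rw [h]; exact left_mem_arc _ _
  rcases P.eq_or_eq_of_vertex_mem_arc h1 with h2 | h2
  · exact h2
  · rw [h2] at h
    exact absurd h.symm (P.vertex_ne i)

/-- `i'` is one of the two neighbours of `i`. -/
def IsNext (i i' : ZMod n) : Prop := i' = i + 1 ∨ i' = i - 1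

variable {P}

theorem IsNext.symm {i i' : ZMod n} (h : IsNext i i') : IsNext i' i := by
  rcases h with rfl | rfl
  · right; ring
  · left; ring

theorem IsNext.arc_eq {i i' : ZMod n} (h : IsNext i i') :
    ∃ j, arc (P.vertex i) (P.vertex i') = arc (P.vertex j) (P.vertex (j + 1)) ∧
      ∀ l, (l = j ∨ l = j + 1) → l = i ∨ l = i' := by
  rcases h with rfl | rfl
  · exact ⟨i, rfl, fun l hl => hl⟩
  · refine ⟨i - 1, ?_, ?_⟩
    · rw [arc_comm, sub_add_cancel]
    · intro l hl
      rw [sub_add_cancel] at hl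
      exact hl.symm

variable (P)

theorem isClosed_region : IsClosed P.region := by
  rw [P.region_eq_closure]; exact isClosed_closure

theorem arc_subset_region {i i' : ZMod n} (h : IsNext i i') :
    arc (P.vertex i) (P.vertex i') ⊆ P.region := by
  obtain ⟨j, hj, -⟩ := h.arc_eq (P := P)
  rw [hj]
  refine Set.Subset.trans ?_ P.isClosed_region.frontier_subset
  rw [P.frontier_region]
  exact Set.subset_iUnion (fun i => arc (P.vertex i) (P.vertex (i + 1))) j

theorem eq_or_eq_of_vertex_mem_side {l i i' : ZMod n} (h : IsNext i i')
    (hl : P.vertex l ∈ arc (P.vertex i) (P.vertex i')) : l = i ∨ l = i' := by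
  obtain ⟨j, hj, hj'⟩ := h.arc_eq (P := P)
  rw [hj] at hl
  exact hj' l (P.eq_or_eq_of_vertex_mem_arc hl)

theorem isClosed_edge (i : ZMod n) : IsClosed (arc (P.vertex i) (P.vertex (i + 1))) :=
  isClosed_arc (P.vertex_ne_neg i)

/-- Near a vertex, the frontier consists of the two adjacent edges. -/
theorem eventually_polar_notMem_frontier {i : ZMod n} {v : S2} (hv : P.vertex i = v) {u e : E3}
    (h : Frame (v : E3) u e) {φ φ' ψ : ℝ}
    (h1 : Sees v (P.vertex (i + 1)) (dir u e φ)) (h2 : Sees v (P.vertex (i - 1)) (dir u e φ'))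
    (hφ : ¬AngEq ψ φ) (hφ' : ¬AngEq ψ φ') :
    ∀ᶠ t in nhdsWithin 0 (Set.Ioi 0), h.polar ψ t ∉ frontier P.region := by
  subst hv
  have := P.three_le
  have : NeZero n := ⟨by omega⟩
  have key : ∀ j : ZMod n, ∀ᶠ t in nhdsWithin 0 (Set.Ioi 0),
      h.polar ψ t ∉ arc (P.vertex j) (P.vertex (j + 1)) := by
    intro j
    by_cases hj : P.vertex i ∈ arc (P.vertex j) (P.vertex (j + 1))
    · rcases P.eq_or_eq_of_vertex_mem_arc hj with rfl | rfl
      · filter_upwards [Frame.eventually_sin_pos] with t ht hm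
        exact hφ (h1.angEq_of_polar_mem_arc h ht hm)
      · filter_upwards [Frame.eventually_sin_pos] with t ht hm
        rw [add_sub_cancel_right] at h2
        rw [arc_comm] at hm
        exact hφ' (h2.angEq_of_polar_mem_arc h ht hm)
    · exact (h.tendsto_polar ψ).eventually ((P.isClosed_edge j).isOpen_compl.mem_nhds hj)
  filter_upwards [Filter.eventually_all.2 key] with t ht
  rw [P.frontier_region, Set.mem_iUnion]
  rintro ⟨j, hj⟩
  exact ht j hj

end SphericalPolygon

/-! ### The corners of a tiling at a vertex -/

namespace SphericalTiling

open SphericalPolygon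

variable (T : SphericalTiling)

/-- The vertices of a polygon are distinct, so different corners at a point belong to different
tiles, whose interiors are disjoint. -/
theorem tile_injective_of_corner {v : S2} {c c' : Σ k, ZMod (T.sides k)}
    (hc : c ∈ T.cornersAt v) (hc' : c' ∈ T.cornersAt v) (h : c.1 = c'.1) : c = c' := by
  obtain ⟨k, i⟩ := c
  obtain ⟨k', i'⟩ := c'
  dsimp only at h
  subst h
  have : i = i' := (T.tile k).vertex_injective ((show _ = v from hc).trans
    (show _ = v from hc').symm)
  rw [this]

instance (k : Fin T.numTiles) : NeZero (T.sides k) := ⟨by have := (T.tile k).three_le; omega⟩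

/-- Edges that leave a vertex in the same direction coincide. -/
theorem side_eq_of_sees {v : S2} {k k' : Fin T.numTiles} {i i₁ : ZMod (T.sides k)}
    {i' i₁' : ZMod (T.sides k')} (hv : (T.tile k).vertex i = v) (hv' : (T.tile k').vertex i' = v)
    (hi : IsNext i i₁) (hi' : IsNext i' i₁') {w : E3}
    (hs : Sees v ((T.tile k).vertex i₁) w) (hs' : Sees v ((T.tile k').vertex i₁') w) :
    (T.tile k).vertex i₁ = (T.tile k').vertex i₁' := by
  have ne_of_next : ∀ {k : Fin T.numTiles} {i i₁ : ZMod (T.sides k)}, IsNext i i₁ →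
      (T.tile k).vertex i ≠ (T.tile k).vertex i₁ := by
    intro k i i₁ hi h
    have := (T.tile k).vertex_injective h
    subst this
    rcases hi with hi | hi
    · exact (T.tile k).add_one_ne _ hi.symm
    · exact (T.tile k).add_one_ne i (by nth_rewrite 1 [hi]; ring)
  -- An end of one side that lies on the other side is a vertex of the other tile, hence an end of
  -- the other side, and it is not `v`.
  have main : ∀ {k k' : Fin T.numTiles} {i i₁ : ZMod (T.sides k)}
      {i' i₁' : ZMod (T.sides k')}, (T.tile k).vertex i = v → (T.tile k').vertex i' = v →
      IsNext i i₁ → IsNext i' i₁' → (T.tile k).vertex i₁ ∈ arc v ((T.tile k').vertex i₁') →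
      (T.tile k).vertex i₁ = (T.tile k').vertex i₁' := by
    intro k k' i i₁ i' i₁' hv hv' hi hi' hm
    rw [← hv'] at hm
    obtain ⟨l, hl⟩ := T.edge_to_edge k i₁ k' ((T.tile k').arc_subset_region hi' hm)
    rw [← hl] at hm ⊢
    rcases (T.tile k').eq_or_eq_of_vertex_mem_side hi' hm with rfl | rfl
    · exact absurd (hv.trans (hv'.symm.trans hl)) (ne_of_next hi)
    · rfl
  rcases hs.mem_arc_or hs' with h | h
  · exact main hv hv' hi hi' h
  · exact (main hv' hv hi' hi h).symm

/-- The cyclic arrangement of the corners at a vertex: `st c` and `en c` are the two neighbours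
in its tile of the corner `c`, and the last side of a corner is the first side of the next one. -/
structure VertexArrangement (v : S2) where
  next : Equiv.Perm (T.cornersAt v)
  st : ∀ c : T.cornersAt v, ZMod (T.sides c.1.1)
  en : ∀ c : T.cornersAt v, ZMod (T.sides c.1.1)
  st_en : ∀ c, (st c = c.1.2 + 1 ∧ en c = c.1.2 - 1) ∨ (st c = c.1.2 - 1 ∧ en c = c.1.2 + 1)
  next_ne : ∀ c, next c ≠ c
  vertex_next : ∀ c, (T.tile c.1.1).vertex (en c) =
    (T.tile (next c).1.1).vertex (st (next c))
  st_inj : ∀ c c', (T.tile c.1.1).vertex (st c) = (T.tile c'.1.1).vertex (st c') → c = c'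
  en_inj : ∀ c c', (T.tile c.1.1).vertex (en c) = (T.tile c'.1.1).vertex (en c') → c = c'
  -- `next` is not required to be a single cycle. This field covers the only short cycle that
  -- matters: two corners that follow each other fill the full turn.
  add_angle : ∀ c, next (next c) = c →
    (T.tile c.1.1).angle c.1.2 + (T.tile (next c).1.1).angle (next c).1.2 = 2 * Real.pi
  sum_angle : ∑ᶠ c : T.cornersAt v, (T.tile c.1.1).angle c.1.2 = 2 * Real.pi

/-- Both properties are tested on points close to `v` in a given direction: they lie in some tile,
and they cannot be in the interior of one tile and also in another. -/
theorem circleTiling {v : S2} {u e : E3} (hf : Frame (v : E3) u e)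
    (A : T.cornersAt v → ℝ) (st en : ∀ c : T.cornersAt v, ZMod (T.sides c.1.1))
    (hne : (T.cornersAt v).Nonempty)
    (hs : ∀ c, IsSector (T.tile c.1.1).region v u e (A c) ((T.tile c.1.1).angle c.1.2))
    (hst : ∀ c, Sees v ((T.tile c.1.1).vertex (st c)) (dir u e (A c)))
    (hen : ∀ c, Sees v ((T.tile c.1.1).vertex (en c))
      (dir u e (A c + (T.tile c.1.1).angle c.1.2)))
    (h : ∀ c, (st c = c.1.2 + 1 ∧ en c = c.1.2 - 1) ∨
      (st c = c.1.2 - 1 ∧ en c = c.1.2 + 1)) :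
    CircleTiling A (fun c : T.cornersAt v => (T.tile c.1.1).angle c.1.2) := by
  refine ⟨fun c => ((T.tile c.1.1).isInteriorAngle _).1,
    fun c => ((T.tile c.1.1).isInteriorAngle _).2.1, ?_, ?_⟩
  · intro ψ
    by_contra hcon
    push Not at hcon
    have key : ∀ k, ∀ᶠ t in nhdsWithin 0 (Set.Ioi 0), hf.polar ψ t ∉ (T.tile k).region := by
      intro k
      by_cases hk : ∃ i, (T.tile k).vertex i = v
      · obtain ⟨i, hi⟩ := hk
        let c : T.cornersAt v := ⟨⟨k, i⟩, hi⟩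
        filter_upwards [(hs c).eventually_polar hf ψ] with t ht hm
        exact hcon c (ht.1 hm)
      -- By the edge-to-edge condition a tile without a corner at `v` does not contain `v`; being
      -- closed, it stays away from a neighbourhood of `v`.
      · have hv : v ∉ (T.tile k).region := by
          intro hm
          obtain ⟨⟨j, i⟩, hc⟩ := hne
          obtain ⟨l, hl⟩ := T.edge_to_edge j i k (by
            rw [show (T.tile j).vertex i = v from hc]; exact hm)
          exact hk ⟨l, hl.trans hc⟩
        exact (hf.tendsto_polar ψ).eventually
          ((T.tile k).isClosed_region.isOpen_compl.mem_nhds hv)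
    obtain ⟨t, ht⟩ := (Filter.eventually_all.2 key).exists
    have : hf.polar ψ t ∈ ⋃ j, (T.tile j).region := by rw [T.cover]; trivial
    obtain ⟨k, hk⟩ := Set.mem_iUnion.1 this
    exact ht k hk
  · intro c c' ψ hcc h1 h2
    by_contra hcon
    push Not at hcon
    obtain ⟨n1, n2⟩ := hcon
    have hk : c.1.1 ≠ c'.1.1 := fun hk =>
      hcc (Subtype.ext (T.tile_injective_of_corner c.2 c'.2 hk))
    have hfr : ∀ᶠ t in nhdsWithin 0 (Set.Ioi 0),
        hf.polar ψ t ∉ frontier (T.tile c.1.1).region := by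
      have hv : (T.tile c.1.1).vertex c.1.2 = v := c.2
      have h3 := hst c
      have h4 := hen c
      rcases h c with ⟨e1, e2⟩ | ⟨e1, e2⟩
      · rw [e1] at h3
        rw [e2] at h4
        exact (T.tile c.1.1).eventually_polar_notMem_frontier hv hf h3 h4 n1 n2
      · rw [e1] at h3
        rw [e2] at h4
        exact (T.tile c.1.1).eventually_polar_notMem_frontier hv hf h4 h3 n2 n1
    obtain ⟨t, h3, h4, h5⟩ := (hfr.and (((hs c).eventually_polar hf ψ).and
      ((hs c').eventually_polar hf ψ))).exists
    have h6 := h4.2 h1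
    have h7 := h5.2 h2
    -- In a direction other than the two sides of `c`, nearby points of its tile avoid the frontier.
    -- The other tile is the closure of its interior, so it cannot meet this open interior.
    have h8 : hf.polar ψ t ∈ interior (T.tile c.1.1).region := by
      rw [← self_sdiff_frontier]; exact ⟨h6, h3⟩
    rw [(T.tile c'.1.1).region_eq_closure] at h7
    have h9 := (T.disjoint_interior hk).closure_right isOpen_interior
    exact Set.disjoint_left.1 h9 h8 h7

/-- One frame at `v` is fixed and every corner is read as an arc of directions in it. The successor
map of the resulting circle tiling is injective, hence a permutation. -/
theorem exists_vertexArrangement {v : S2} (hne : (T.cornersAt v).Nonempty) :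
    Nonempty (T.VertexArrangement v) := by
  obtain ⟨c₀, hc₀⟩ := hne
  obtain ⟨-, -, u, e, hf, -⟩ := ((T.tile c₀.1).isInteriorAngle c₀.2).exists_frame
  rw [show (T.tile c₀.1).vertex c₀.2 = v from hc₀] at hf
  have hex : ∀ c : T.cornersAt v, ∃ (A : ℝ) (st en : ZMod (T.sides c.1.1)),
      IsSector (T.tile c.1.1).region v u e A ((T.tile c.1.1).angle c.1.2) ∧
      Sees v ((T.tile c.1.1).vertex st) (dir u e A) ∧
      Sees v ((T.tile c.1.1).vertex en) (dir u e (A + (T.tile c.1.1).angle c.1.2)) ∧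
      ((st = c.1.2 + 1 ∧ en = c.1.2 - 1) ∨ (st = c.1.2 - 1 ∧ en = c.1.2 + 1)) := by
    intro c
    have h := (T.tile c.1.1).isInteriorAngle c.1.2
    rw [show (T.tile c.1.1).vertex c.1.2 = v from c.2] at h
    obtain ⟨A, hA, h1 | h1⟩ := h.exists_arc hf
    · exact ⟨A, _, _, hA, h1.1, h1.2, Or.inl ⟨rfl, rfl⟩⟩
    · exact ⟨A, _, _, hA, h1.1, h1.2, Or.inr ⟨rfl, rfl⟩⟩
  choose A st en hs hst hen hse using hex
  have hC := T.circleTiling hf A st en ⟨c₀, hc₀⟩ hs hst hen hse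
  have hfin : Finite (T.cornersAt v) := inferInstance
  have := Fintype.ofFinite (T.cornersAt v)
  have hstn : ∀ c, IsNext c.1.2 (st c) := fun c => (hse c).imp And.left And.left
  have henn : ∀ c, IsNext c.1.2 (en c) := fun c => (hse c).symm.imp And.right And.right
  choose nx hnx using hC.exists_next
  have hinj : Function.Injective nx := by
    intro c c' h
    have h1 := hnx c
    rw [h] at h1
    exact hC.end_inj (h1.symm.trans (hnx c'))
  refine ⟨⟨Equiv.ofBijective nx (Finite.injective_iff_bijective.1 hinj), st, en, hse, ?_, ?_, ?_, ?_,
    ?_, ?_⟩⟩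
  · intro c h
    have h1 := hnx c
    rw [show nx c = c from h] at h1
    exact not_angEq_of_lt (by linarith [hC.pos c]) (by linarith [hC.lt c]) h1.symm
  · intro c
    exact T.side_eq_of_sees c.2 (nx c).2 (henn c) (hstn (nx c)) (hen c)
      ((hst (nx c)).congr (hnx c))
  · intro c c' h
    have h1 := hst c
    rw [h] at h1
    exact hC.start_inj (h1.angEq hf (hst c'))
  · intro c c' h
    have h1 := hen c
    rw [h] at h1
    exact hC.end_inj (h1.angEq hf (hen c'))
  · intro c h
    have h1 := hnx (nx c)
    rw [show nx (nx c) = c from h] at h1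
    exact hC.add_eq_of_mutual (hnx c) h1
  · rw [finsum_eq_sum_of_fintype]
    exact hC.sum_eq

end SphericalTiling

/-! ### The corners of a polygon have the same orientation -/

/-- An interior angle together with its orientation: `s = 1` if the region lies to the left of
the arc from `p` to `q`, and `s = -1` if it lies to the right. -/
def IsOrientedAngle (R : Set S2) (p q r : S2) (θ s : ℝ) : Prop :=
  (0 < θ ∧ θ < 2 * Real.pi) ∧ (s = 1 ∨ s = -1) ∧ ∃ u e : E3, Frame (p : E3) u e ∧
    e = s • cross3 (p : E3) u ∧ Sees p q (dir u e 0) ∧ Sees p r (dir u e θ) ∧ IsSector R p u e 0 θ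

theorem IsInteriorAngle.exists_oriented {R : Set S2} {p q r : S2} {θ : ℝ}
    (h : IsInteriorAngle R p q r θ) : ∃ s, IsOrientedAngle R p q r θ s := by
  obtain ⟨h0, h1, u, e, hf, hq, hr, hs⟩ := h.exists_frame
  obtain ⟨he, hd⟩ := hf.eq_cross3
  exact ⟨_, ⟨h0, h1⟩, hd, u, e, hf, he, hq, hr, hs⟩

namespace IsOrientedAngle

variable {R : Set S2} {p q r : S2} {θ s : ℝ}

theorem symm (h : IsOrientedAngle R p q r θ s) : IsOrientedAngle R p r q θ (-s) := by
  obtain ⟨h0, hs1, u, e, hf, he, hq, hr, hs⟩ := h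
  refine ⟨h0, by rcases hs1 with rfl | rfl <;> simp, dir u e θ,
    Real.sin θ • u - Real.cos θ • e, hf.reverse θ, ?_, ?_, ?_, ?_⟩
  · have hss : s * s = 1 := by rcases hs1 with rfl | rfl <;> norm_num
    have h1 : cross3 (p : E3) e = -s • u := by
      rw [he, cross3_smul_right, cross3_cross3, hf.pu, hf.pp]
      module
    have h2 : cross3 (p : E3) u = s • e := by
      rw [he, smul_smul, hss, one_smul]
    rw [dir, cross3_add_right, cross3_smul_right, cross3_smul_right, h1, h2]
    calc Real.sin θ • u - Real.cos θ • e
        = (s * s) • (Real.sin θ • u - Real.cos θ • e) := by rw [hss, one_smul]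
      _ = _ := by module
  · rw [dir_reverse, sub_zero]; exact hr
  · rw [dir_reverse, sub_self]; exact hq
  · have := hs.change (u := dir u e θ) (e := Real.sin θ • u - Real.cos θ • e) (B := θ) (s := -1)
      (Or.inr rfl) (fun φ => by rw [dir_reverse]; congr 1; ring)
    rw [if_neg (by norm_num)] at this
    simpa using this

/-- Side lengths, angle and orientation in terms of scalar and triple products. -/
theorem exists_coords (h : IsOrientedAngle R p q r θ s) : ∃ b b' : ℝ, 0 < b ∧ 0 < b' ∧
    b ^ 2 = 1 - ⟪(p : E3), q⟫ ^ 2 ∧ b' ^ 2 = 1 - ⟪(p : E3), r⟫ ^ 2 ∧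
    ⟪(q : E3), r⟫ - ⟪(p : E3), q⟫ * ⟪(p : E3), r⟫ = b * b' * Real.cos θ ∧
    det3 p q r = s * (b * b' * Real.sin θ) := by
  obtain ⟨h0, hs1, u, e, hf, he, ⟨a, b, hb, hq⟩, ⟨a', b', hb', hr⟩, -⟩ := h
  have hss : s * s = 1 := by rcases hs1 with rfl | rfl <;> norm_num
  have h2 : cross3 (p : E3) u = s • e := by
    rw [he, smul_smul, hss, one_smul]
  have hd0 : dir u e 0 = u := by simp [dir]
  rw [hd0] at hq
  have ha : ⟪(p : E3), q⟫ = a := by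
    rw [hq]
    simp only [inner_add_right, inner_smul_right, hf.pp, hf.pu]; ring
  have ha' : ⟪(p : E3), r⟫ = a' := by
    rw [hr]
    simp only [inner_add_right, inner_smul_right, hf.pp, hf.inner_dir]; ring
  refine ⟨b, b', hb, hb', ?_, ?_, ?_, ?_⟩
  · have := S2.inner_self q
    rw [hq] at this
    simp only [inner_add_left, inner_add_right, inner_smul_left, inner_smul_right, hf.pp, hf.pu,
      hf.up, hf.uu, RCLike.conj_to_real] at this
    rw [ha]; linarith
  · have := S2.inner_self r
    rw [hr] at this
    have hdp : ⟪dir u e θ, (p : E3)⟫ = 0 := by rw [real_inner_comm]; exact hf.inner_dir θ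
    simp only [inner_add_left, inner_add_right, inner_smul_left, inner_smul_right, hf.pp,
      hf.inner_dir, hdp, hf.inner_dir_self, RCLike.conj_to_real] at this
    rw [ha']; linarith
  · rw [ha, ha', hq, hr]
    simp only [dir, inner_add_left, inner_add_right, inner_smul_left, inner_smul_right, hf.pp,
      hf.pu, hf.pe, hf.up, hf.uu, hf.ue, RCLike.conj_to_real]
    ring
  · rw [det3, hq, hr, cross3_add_right, cross3_smul_right, cross3_smul_right, cross3_self, h2]
    simp only [dir, inner_add_left, inner_add_right, inner_smul_left, inner_smul_right,
      hf.ep, hf.eu, hf.ee, smul_zero, inner_zero_left, RCLike.conj_to_real]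
    ring

end IsOrientedAngle

theorem smul_dir_arctan (u e : E3) (x : ℝ) :
    Real.sqrt (1 + x ^ 2) • dir u e (Real.arctan x) = u + x • e := by
  have h : Real.sqrt (1 + x ^ 2) ≠ 0 := (Real.sqrt_pos.2 (by positivity)).ne'
  rw [dir, Real.cos_arctan, Real.sin_arctan, smul_add, smul_smul, smul_smul]
  congr 1
  · rw [mul_one_div_cancel h, one_smul]
  · congr 1; field_simp

theorem dir_neg (u e : E3) (φ : ℝ) : dir u e (-φ) = dir u (-e) φ := by
  simp [dir]

theorem continuousAt_toSphere_parallel {p q n : E3} {x : ℝ × ℝ}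
    (h : (1 - x.2) • p + x.2 • q + x.1 • n ≠ 0) :
    ContinuousAt (fun x : ℝ × ℝ => toSphere ((1 - x.2) • p + x.2 • q + x.1 • n)) x :=
  (continuousAt_toSphere h).comp (f := fun x : ℝ × ℝ => (1 - x.2) • p + x.2 • q + x.1 • n)
    (by fun_prop)

/-- Close to its initial point, the left side (`σ = 1`) or the right side (`σ = -1`) of the first
arc of an oriented angle lies in the region iff `σ` is the orientation. -/
theorem IsOrientedAngle.eventually_side {R : Set S2} {p q r : S2} {θ s : ℝ}
    (h : IsOrientedAngle R p q r θ s) {σ : ℝ} (hσ : σ = 1 ∨ σ = -1) :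
    ∀ᶠ τ in nhdsWithin (0 : ℝ) (Set.Ioi 0), ∀ᶠ κ in nhdsWithin (0 : ℝ) (Set.Ioi 0),
      (toSphere ((1 - τ) • (p : E3) + τ • (q : E3) + κ • σ • cross3 (p : E3) q) ∈ R ↔ s = σ) := by
  obtain ⟨⟨h0, h2π⟩, hs1, u, e, hf, he, ⟨a, b, hb, hq⟩, -, hs⟩ := h
  have hss : s * s = 1 := by rcases hs1 with rfl | rfl <;> norm_num
  have h2 : cross3 (p : E3) u = s • e := by rw [he, smul_smul, hss, one_smul]
  have hd0 : dir u e 0 = u := by simp [dir]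
  rw [hd0] at hq
  have hraw : ∀ τ κ : ℝ, (1 - τ) • (p : E3) + τ • (q : E3) + κ • σ • cross3 (p : E3) q =
      (1 - τ + τ * a) • (p : E3) + b • (τ • u + (κ * (σ * s)) • e) := by
    intro τ κ
    have hc : cross3 (p : E3) q = b • (s • e) := by
      rw [hq, cross3_add_right, cross3_smul_right, cross3_smul_right, cross3_self, h2]; simp
    rw [hc, hq]; module
  have hne : ∀ τ κ : ℝ, 0 < τ →
      (1 - τ) • (p : E3) + τ • (q : E3) + κ • σ • cross3 (p : E3) q ≠ 0 := by
    intro τ κ hτ h0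
    rw [hraw] at h0
    have := congrArg (fun w => ⟪u, w⟫) h0
    simp only [inner_add_right, inner_smul_right, hf.up, hf.uu, hf.ue, inner_zero_right] at this
    nlinarith [mul_pos hb hτ]
  have hcont : ∀ x : ℝ × ℝ, 0 < x.2 ∨ x = (0, 0) → ContinuousAt (fun x : ℝ × ℝ =>
      toSphere ((1 - x.2) • (p : E3) + x.2 • (q : E3) + x.1 • σ • cross3 (p : E3) q)) x := by
    intro x hx
    refine continuousAt_toSphere_parallel ?_
    rcases hx with hx | rfl
    · exact hne _ _ hx
    · have := ne_zero_of_mem_unit_sphere p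
      simpa using this
  have hp : toSphere ((1 - 0 : ℝ) • (p : E3) + (0 : ℝ) • (q : E3) +
      (0 : ℝ) • σ • cross3 (p : E3) q) = p := by
    have := toSphere_smul p one_pos
    simpa using this
  have ht0 : Filter.Tendsto (fun τ : ℝ => toSphere ((1 - τ) • (p : E3) + τ • (q : E3) +
      (0 : ℝ) • σ • cross3 (p : E3) q)) (nhdsWithin 0 (Set.Ioi 0)) (nhds p) := by
    have h3 := (hcont (0, 0) (Or.inr rfl)).comp (f := fun τ : ℝ => ((0 : ℝ), τ))
      (x := 0) (by fun_prop)
    have h4 : Filter.Tendsto _ _ _ := h3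
    simp only [Function.comp_def] at h4
    rw [hp] at h4
    exact h4.mono_left nhdsWithin_le_nhds
  -- The sector description also holds near the point of the edge with parameter `τ`. So `κ` can be
  -- chosen after `τ`, which lets both ends of an edge use the same `κ` later.
  filter_upwards [ht0.eventually (eventually_eventually_nhds.2 hs), self_mem_nhdsWithin]
    with τ hτ hτ0
  have hτ0 : 0 < τ := hτ0
  have ht1 : Filter.Tendsto (fun κ : ℝ => toSphere ((1 - τ) • (p : E3) + τ • (q : E3) +
      κ • σ • cross3 (p : E3) q)) (nhdsWithin 0 (Set.Ioi 0))
      (nhds (toSphere ((1 - τ) • (p : E3) + τ • (q : E3) + (0 : ℝ) • σ • cross3 (p : E3) q))) := by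
    have h3 := (hcont (0, τ) (Or.inl hτ0)).comp (f := fun κ : ℝ => (κ, τ))
      (x := 0) (by fun_prop)
    have h4 : Filter.Tendsto _ _ _ := h3
    exact h4.mono_left nhdsWithin_le_nhds
  have ht2 : Filter.Tendsto (fun κ : ℝ => Real.arctan (κ / τ)) (nhdsWithin 0 (Set.Ioi 0))
      (nhds 0) := by
    have : Continuous fun κ : ℝ => Real.arctan (κ / τ) :=
      Real.continuous_arctan.comp (continuous_id.div_const τ)
    have h3 := this.tendsto 0
    rw [zero_div, Real.arctan_zero] at h3
    exact h3.mono_left nhdsWithin_le_nhds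
  filter_upwards [ht1.eventually hτ, self_mem_nhdsWithin,
    ht2.eventually_lt_const (lt_min h0 (sub_pos.2 h2π))] with κ hκ hκ0 hφ
  have hκ0 : 0 < κ := hκ0
  have hφ0 : 0 < Real.arctan (κ / τ) := Real.arctan_pos.2 (by positivity)
  have hφ1 := lt_of_lt_of_le hφ (min_le_left _ _)
  have hφ2 := lt_of_lt_of_le hφ (min_le_right _ _)
  set w := (1 - τ) • (p : E3) + τ • (q : E3) + κ • σ • cross3 (p : E3) q with hw
  have hw0 : w ≠ 0 := hne τ κ hτ0
  have hN : 0 < ‖w‖⁻¹ := inv_pos.2 (norm_pos_iff.2 hw0)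
  have hsq : 0 < Real.sqrt (1 + (κ / τ) ^ 2) := Real.sqrt_pos.2 (by positivity)
  have hrep : ∀ ψ : ℝ, dir u ((σ * s) • e) (Real.arctan (κ / τ)) = dir u e ψ →
      (toSphere w : E3) = (‖w‖⁻¹ * (1 - τ + τ * a)) • (p : E3) +
        (‖w‖⁻¹ * b * τ * Real.sqrt (1 + (κ / τ) ^ 2)) • dir u e ψ := by
    intro ψ hψ
    have h5 : τ • u + (κ * (σ * s)) • e =
        τ • (Real.sqrt (1 + (κ / τ) ^ 2) • dir u e ψ) := by
      rw [← hψ, smul_dir_arctan, smul_add, smul_smul, smul_smul]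
      congr 2; field_simp
    rw [coe_toSphere hw0]
    have hw2 := hw.trans ((hraw τ κ).trans (by rw [h5]))
    generalize ‖w‖⁻¹ = N
    rw [hw2]
    module
  have hpos : 0 < ‖w‖⁻¹ * b * τ * Real.sqrt (1 + (κ / τ) ^ 2) := by positivity
  by_cases hsσ : s = σ
  · subst hsσ
    rw [hκ _ _ (Real.arctan (κ / τ)) hpos (hrep _ (by rw [hss, one_smul]))]
    simp only [iff_true]
    exact inArc_of_le hφ0.le (by linarith)
  · have hm : σ * s = -1 := by
      revert hsσ
      rcases hs1 with rfl | rfl <;> rcases hσ with rfl | rfl <;> norm_num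
    rw [hκ _ _ (-Real.arctan (κ / τ)) hpos (hrep _ (by rw [hm, dir_neg]; simp))]
    simp only [hsσ, iff_false]
    -- Taken in `[0, 2π)`, the direction on the wrong side lies beyond the end `θ` of the sector
    -- once the arctangent is below `2π - θ`.
    have h6 : AngEq (-Real.arctan (κ / τ)) (2 * Real.pi - Real.arctan (κ / τ)) :=
      ⟨-1, by push_cast; ring⟩
    rw [h6.inArc]
    exact not_inArc_of_lt (by linarith) (by linarith)

/-- Off the frontier, the interior and the complement of the closure separate the space. -/
theorem IsPreconnected.mem_iff_mem_of_disjoint_frontier {X : Type*} [TopologicalSpace X]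
    {S R : Set X} (hS : IsPreconnected S) (hd : ∀ x ∈ S, x ∉ frontier R) {x y : X} (hx : x ∈ S)
    (hy : y ∈ S) : x ∈ R ↔ y ∈ R := by
  have key : ∀ {x y : X}, x ∈ S → y ∈ S → x ∈ R → y ∈ R := by
    intro x y hx hy hxR
    have hsub : S ⊆ interior R ∪ (closure R)ᶜ := by
      intro z hz
      by_cases hz' : z ∈ closure R
      · left
        by_contra hi
        exact hd z hz ⟨hz', hi⟩
      · exact Or.inr hz'
    have hdis : Disjoint (interior R) (closure R)ᶜ :=
      Set.disjoint_left.2 fun z h1 h2 => h2 (interior_subset_closure h1)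
    have hxi : x ∈ interior R := by
      by_contra hi
      exact hd x hx ⟨subset_closure hxR, hi⟩
    exact interior_subset (hS.subset_left_of_subset_union isOpen_interior
      isClosed_closure.isOpen_compl hdis hsub ⟨x, hx, hxi⟩ hy)
  exact ⟨key hx hy, key hy hx⟩

theorem toSphere_comb_mem_arc {p q : S2} (h : p ≠ -q) {τ : ℝ} (h0 : 0 ≤ τ) (h1 : τ ≤ 1) :
    toSphere ((1 - τ) • (p : E3) + τ • (q : E3)) ∈ arc p q :=
  toSphere_mem_arc (sub_nonneg.2 h1) h0
    (nonneg_comb_ne_zero h (sub_nonneg.2 h1) h0 (by linarith))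

theorem toSphere_comb_ne_left {p q : S2} (h : p ≠ -q) (h' : p ≠ q) {τ : ℝ} (h0 : 0 < τ)
    (h1 : τ ≤ 1) : toSphere ((1 - τ) • (p : E3) + τ • (q : E3)) ≠ p := by
  intro heq
  have hne := nonneg_comb_ne_zero h (sub_nonneg.2 h1) h0.le (by linarith)
  set w := (1 - τ) • (p : E3) + τ • (q : E3) with hw
  have h2 : (p : E3) = ‖w‖⁻¹ • w := by rw [← coe_toSphere hne, heq]
  have hN : ‖w‖ ≠ 0 := norm_ne_zero_iff.2 hne
  have h3 : ‖w‖ • (p : E3) = w := by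
    conv_lhs => rw [h2]
    rw [smul_smul, mul_inv_cancel₀ hN, one_smul]
  have h4 : τ • (q : E3) = (‖w‖ - (1 - τ)) • (p : E3) := by
    rw [sub_smul, h3, hw]; abel
  have h5 := congrArg norm h4
  rw [norm_smul, norm_smul, norm_eq_of_mem_sphere, norm_eq_of_mem_sphere, mul_one, mul_one,
    Real.norm_of_nonneg h0.le, Real.norm_eq_abs] at h5
  rcases eq_or_eq_neg_of_abs_eq h5.symm with h6 | h6
  · rw [h6] at h4
    exact h' (Subtype.ext (smul_right_injective _ h0.ne' h4).symm)
  · rw [h6, neg_smul, ← smul_neg] at h4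
    apply h
    apply Subtype.ext
    have := smul_right_injective _ h0.ne' h4
    change (p : E3) = -(q : E3)
    rw [this, neg_neg]

namespace SphericalPolygon

variable {n : ℕ} (P : SphericalPolygon n)

theorem cross3_vertex_ne_zero (i : ZMod n) :
    cross3 (P.vertex i : E3) (P.vertex (i + 1)) ≠ 0 := by
  obtain ⟨s, h⟩ := (P.isInteriorAngle i).exists_oriented
  obtain ⟨b, -, hb, -, h1, -⟩ := h.exists_coords
  intro h0
  have h2 := inner_cross3_cross3 (P.vertex i : E3) (P.vertex (i + 1)) (P.vertex i)
    (P.vertex (i + 1))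
  rw [h0, inner_zero_left, S2.inner_self, S2.inner_self,
    real_inner_comm (P.vertex i : E3) (P.vertex (i + 1))] at h2
  nlinarith

/-- A path that runs close to an edge, on one side of it, avoids the frontier. -/
theorem eventually_parallel_notMem_frontier (i : ZMod n) {τ₀ τ₁ : ℝ} (h0 : 0 < τ₀) (h1 : τ₁ < 1) :
    ∀ᶠ κ in nhdsWithin (0 : ℝ) (Set.Ioi 0), ∀ τ ∈ Set.Icc τ₀ τ₁,
      (1 - τ) • (P.vertex i : E3) + τ • (P.vertex (i + 1) : E3) +
        κ • cross3 (P.vertex i : E3) (P.vertex (i + 1)) ≠ 0 ∧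
      toSphere ((1 - τ) • (P.vertex i : E3) + τ • (P.vertex (i + 1) : E3) +
        κ • cross3 (P.vertex i : E3) (P.vertex (i + 1))) ∉ frontier P.region := by
  have := P.three_le
  have : NeZero n := ⟨by omega⟩
  set p := P.vertex i with hp
  set q := P.vertex (i + 1) with hq
  set c := cross3 (p : E3) q with hc
  have hc0 : c ≠ 0 := P.cross3_vertex_ne_zero i
  have hpq : p ≠ -q := P.vertex_ne_neg i
  have hin : ∀ τ κ : ℝ, ⟪c, (1 - τ) • (p : E3) + τ • (q : E3) + κ • c⟫ = κ * ⟪c, c⟫ := by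
    intro τ κ
    have e1 : ⟪c, (p : E3)⟫ = 0 := by rw [real_inner_comm]; exact inner_cross3_left _ _
    have e2 : ⟪c, (q : E3)⟫ = 0 := by rw [real_inner_comm]; exact inner_cross3_right _ _
    simp only [inner_add_right, inner_smul_right, e1, e2]; ring
  have hcc : 0 < ⟪c, c⟫ := real_inner_self_pos.2 hc0
  have hnz : ∀ τ κ : ℝ, 0 < κ → (1 - τ) • (p : E3) + τ • (q : E3) + κ • c ≠ 0 := by
    intro τ κ hκ h
    have := hin τ κ
    rw [h, inner_zero_right] at this
    nlinarith [mul_pos hκ hcc]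
  have hbase : ∀ τ ∈ Set.Icc τ₀ τ₁, (1 - τ) • (p : E3) + τ • (q : E3) + (0 : ℝ) • c ≠ 0 := by
    intro τ hτ
    rw [zero_smul, add_zero]
    exact nonneg_comb_ne_zero hpq (by linarith [hτ.2]) (by linarith [hτ.1]) (by linarith)
  have hother : ∀ j : ZMod n, j ≠ i → ∀ᶠ κ in nhds (0 : ℝ), ∀ τ ∈ Set.Icc τ₀ τ₁,
      toSphere ((1 - τ) • (p : E3) + τ • (q : E3) + κ • c) ∉
        arc (P.vertex j) (P.vertex (j + 1)) := by
    intro j hj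
    -- Compactness of the parameter interval turns a bound on `κ` for each `τ` into a common one.
    refine isCompact_Icc.eventually_forall_of_forall_eventually fun τ hτ => ?_
    have hcont : ContinuousAt (fun x : ℝ × ℝ =>
        toSphere ((1 - x.2) • (p : E3) + x.2 • (q : E3) + x.1 • c)) (0, τ) :=
      continuousAt_toSphere_parallel (hbase τ hτ)
    refine hcont.eventually ((P.isClosed_edge j).isOpen_compl.mem_nhds ?_)
    dsimp only
    rw [zero_smul, add_zero]
    have hm : toSphere ((1 - τ) • (p : E3) + τ • (q : E3)) ∈ arc p q :=
      toSphere_comb_mem_arc hpq (by linarith [hτ.1]) (by linarith [hτ.2])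
    intro hmj
    by_cases h3 : j = i + 1
    · subst h3
      have : toSphere ((1 - τ) • (p : E3) + τ • (q : E3)) ∈ ({q} : Set S2) := by
        rw [hq, ← P.edge_inter_next i]
        exact ⟨hm, hmj⟩
      rw [Set.mem_singleton_iff, add_comm] at this
      have h4 := toSphere_comb_ne_left (p := q) (q := p) (τ := 1 - τ)
        (fun h => hpq (by rw [h, neg_neg])) (P.vertex_ne i).symm (by linarith [hτ.2])
        (by linarith [hτ.1])
      rw [sub_sub_cancel] at h4
      exact h4 this
    · by_cases h4 : i = j + 1
      · have : toSphere ((1 - τ) • (p : E3) + τ • (q : E3)) ∈ ({p} : Set S2) := by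
          have h5 := P.edge_inter_next j
          rw [← h4] at h5 hmj
          rw [hp, ← h5]
          exact ⟨hmj, hm⟩
        exact toSphere_comb_ne_left hpq (P.vertex_ne i) (by linarith [hτ.1]) (by linarith [hτ.2])
          this
      · exact Set.disjoint_left.1 (P.edge_disjoint i j hj.symm h3 h4) hm hmj
  have hall : ∀ᶠ κ in nhds (0 : ℝ), ∀ j : ZMod n, j ≠ i → ∀ τ ∈ Set.Icc τ₀ τ₁,
      toSphere ((1 - τ) • (p : E3) + τ • (q : E3) + κ • c) ∉
        arc (P.vertex j) (P.vertex (j + 1)) := by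
    rw [Filter.eventually_all]
    intro j
    by_cases hj : j = i
    · exact Filter.Eventually.of_forall fun κ h => absurd hj h
    · exact (hother j hj).mono fun κ h _ => h
  filter_upwards [nhdsWithin_le_nhds hall, self_mem_nhdsWithin] with κ hκ hκ0 τ hτ
  have hκ0 : 0 < κ := hκ0
  refine ⟨hnz τ κ hκ0, ?_⟩
  rw [P.frontier_region, Set.mem_iUnion]
  rintro ⟨j, hj⟩
  -- The path avoids its own edge because it has a positive inner product with `p × q`, while this
  -- product vanishes on the edge.
  by_cases hji : j = i
  · subst hji
    obtain ⟨a, b, -, -, hz⟩ := hj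
    rw [coe_toSphere (hnz τ κ hκ0)] at hz
    have h5 := congrArg (fun w => ⟪c, w⟫) hz
    have e1 : ⟪c, (p : E3)⟫ = 0 := by rw [real_inner_comm]; exact inner_cross3_left _ _
    have e2 : ⟪c, (q : E3)⟫ = 0 := by rw [real_inner_comm]; exact inner_cross3_right _ _
    simp only [inner_smul_right, hin, inner_add_right] at h5
    rw [← hp, ← hq, e1, e2] at h5
    have : 0 < ‖(1 - τ) • (p : E3) + τ • (q : E3) + κ • c‖⁻¹ :=
      inv_pos.2 (norm_pos_iff.2 (hnz τ κ hκ0))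
    nlinarith [mul_pos this (mul_pos hκ0 hcc)]
  · exact hκ j hji τ hτ hj

/-- A path just to the left of the edge does not meet the frontier, so it is in the region near both
ends or near neither. Near each end, the orientation of the corner decides which. -/
theorem orientation_next {i : ZMod n} {s s' : ℝ}
    (h : IsOrientedAngle P.region (P.vertex i) (P.vertex (i + 1)) (P.vertex (i - 1)) (P.angle i) s)
    (h' : IsOrientedAngle P.region (P.vertex (i + 1)) (P.vertex (i + 1 + 1))
      (P.vertex (i + 1 - 1)) (P.angle (i + 1)) s') : s = s' := by
  rw [add_sub_cancel_right] at h'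
  have e1 := h.eventually_side (Or.inl rfl)
  have e2 := h'.symm.eventually_side (Or.inr rfl)
  have e3 : ∀ᶠ τ in nhdsWithin (0 : ℝ) (Set.Ioi 0), τ ∈ Set.Ioo (0 : ℝ) (1 / 2) :=
    Ioo_mem_nhdsGT (by norm_num)
  obtain ⟨τ₀, h1, h2, h3⟩ := (e1.and e3).exists
  obtain ⟨τ₁, h4, h5, h6⟩ := (e2.and e3).exists
  have e4 := P.eventually_parallel_notMem_frontier i h2 (show 1 - τ₁ < 1 by linarith)
  obtain ⟨κ, ⟨h7, h8⟩, h9⟩ := ((h1.and h4).and e4).exists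
  have hle : τ₀ ≤ 1 - τ₁ := by linarith
  have hpre := isPreconnected_Icc.image (fun τ : ℝ =>
    toSphere ((1 - τ) • (P.vertex i : E3) + τ • (P.vertex (i + 1) : E3) +
        κ • cross3 (P.vertex i : E3) (P.vertex (i + 1)))) (s := Set.Icc τ₀ (1 - τ₁))
    (fun τ hτ => ((continuousAt_toSphere (h9 τ hτ).1).comp (f := fun τ : ℝ =>
      (1 - τ) • (P.vertex i : E3) + τ • (P.vertex (i + 1) : E3) +
        κ • cross3 (P.vertex i : E3) (P.vertex (i + 1))) (by fun_prop)).continuousWithinAt)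
  have hiff := hpre.mem_iff_mem_of_disjoint_frontier (R := P.region)
    (by rintro x ⟨τ, hτ, rfl⟩; exact (h9 τ hτ).2)
    (Set.mem_image_of_mem _ (Set.left_mem_Icc.2 hle))
    (Set.mem_image_of_mem _ (Set.right_mem_Icc.2 hle))
  rw [one_smul] at h7
  -- Left of the edge is right of the reversed edge: the vector product changes sign.
  have h10 : (1 - τ₁) • (P.vertex (i + 1) : E3) + τ₁ • (P.vertex i : E3) +
      κ • (-1 : ℝ) • cross3 (P.vertex (i + 1) : E3) (P.vertex i) =
      (1 - (1 - τ₁)) • (P.vertex i : E3) + (1 - τ₁) • (P.vertex (i + 1) : E3) +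
        κ • cross3 (P.vertex i : E3) (P.vertex (i + 1)) := by
    rw [cross3_swap (P.vertex i : E3) (P.vertex (i + 1))]
    module
  rw [h10] at h8
  have h11 : s = 1 ↔ -s' = -1 := h7.symm.trans (hiff.trans h8)
  revert h11
  rcases h.2.1 with rfl | rfl <;> rcases h'.2.1 with rfl | rfl <;> norm_num

/-- All corners of a polygon have the same orientation. -/
theorem exists_orientation : ∃ s : ℝ, (s = 1 ∨ s = -1) ∧ ∀ i, IsOrientedAngle P.region
    (P.vertex i) (P.vertex (i + 1)) (P.vertex (i - 1)) (P.angle i) s := by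
  have := P.three_le
  have : NeZero n := ⟨by omega⟩
  choose s hs using fun i => (P.isInteriorAngle i).exists_oriented
  have h1 : ∀ k : ℕ, s (k : ZMod n) = s 0 := by
    intro k
    induction k with
    | zero => simp
    | succ k ih =>
      rw [← ih]
      push_cast
      exact (P.orientation_next (hs _) (hs _)).symm
  have h2 : ∀ i, s i = s 0 := by
    intro i
    have := h1 i.val
    rwa [ZMod.natCast_zmod_val] at this
  exact ⟨s 0, (hs 0).2.1, fun i => h2 i ▸ hs i⟩

end SphericalPolygon

/-! ### Spherical triangles and convex quadrilaterals -/

/-- This is the Gram determinant of three unit vectors. -/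
theorem det3_sq (p q r : S2) : det3 p q r ^ 2 = 1 + 2 * ⟪(q : E3), r⟫ * ⟪(p : E3), r⟫ *
    ⟪(p : E3), q⟫ - ⟪(q : E3), r⟫ ^ 2 - ⟪(p : E3), r⟫ ^ 2 - ⟪(p : E3), q⟫ ^ 2 := by
  have h : det3 (p : E3) q r ^ 2 = ⟪(p : E3), p⟫ * ⟪(q : E3), q⟫ * ⟪(r : E3), r⟫ +
      2 * ⟪(q : E3), r⟫ * ⟪(p : E3), r⟫ * ⟪(p : E3), q⟫ - ⟪(p : E3), p⟫ * ⟪(q : E3), r⟫ ^ 2 -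
      ⟪(q : E3), q⟫ * ⟪(p : E3), r⟫ ^ 2 - ⟪(r : E3), r⟫ * ⟪(p : E3), q⟫ ^ 2 := by
    simp only [det3_eq, inner_eq_coords]; ring
  rw [h, S2.inner_self, S2.inner_self, S2.inner_self]; ring

/-- If the product were `±1`, the Gram determinant would be minus a square. -/
theorem one_sub_inner_sq_pos {p q r : S2} (h : 0 < det3 p q r) : 0 < 1 - ⟪(p : E3), q⟫ ^ 2 := by
  have h1 := det3_sq p q r
  have h2 : 0 < det3 (p : E3) q r ^ 2 := by positivity
  have h3 : |⟪(p : E3), (q : E3)⟫| ≤ 1 := by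
    have := abs_real_inner_le_norm (p : E3) (q : E3)
    rwa [norm_eq_of_mem_sphere, norm_eq_of_mem_sphere, mul_one] at this
  have h4 := (sq_le_one_iff_abs_le_one _).2 h3
  rcases h4.lt_or_eq with h5 | h5
  · linarith
  · nlinarith [sq_nonneg (⟪(q : E3), (r : E3)⟫ - ⟪(p : E3), (r : E3)⟫ * ⟪(p : E3), (q : E3)⟫)]

theorem exists_polar_of_sin_pos {ρ x y : ℝ} (hρ : 0 < ρ) (hy : 0 < y) (h : x ^ 2 + y ^ 2 = ρ ^ 2) :
    ∃ A, 0 < A ∧ A < Real.pi ∧ ρ * Real.cos A = x ∧ ρ * Real.sin A = y := by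
  have h1 : (x / ρ) ^ 2 + (y / ρ) ^ 2 = 1 := by
    rw [div_pow, div_pow, ← add_div, h, div_self (by positivity)]
  have hy' : 0 < y / ρ := by positivity
  have h2 : -1 < x / ρ := by nlinarith
  have h3 : x / ρ < 1 := by nlinarith
  refine ⟨Real.arccos (x / ρ), Real.arccos_pos.2 h3, ?_, ?_, ?_⟩
  · refine lt_of_le_of_ne (Real.arccos_le_pi _) fun h => ?_
    rw [Real.arccos_eq_pi] at h
    linarith
  · rw [Real.cos_arccos h2.le h3.le, mul_div_cancel₀ _ hρ.ne']
  · rw [Real.sin_arccos, show 1 - (x / ρ) ^ 2 = (y / ρ) ^ 2 by linarith, Real.sqrt_sq hy'.le,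
      mul_div_cancel₀ _ hρ.ne']

/-- The angle sum of a spherical triangle is greater than `π`. -/
theorem exists_triangle_angles {p q r : S2} (hD : 0 < det3 p q r) :
    ∃ A B C : ℝ, (0 < A ∧ A < Real.pi) ∧ (0 < B ∧ B < Real.pi) ∧ (0 < C ∧ C < Real.pi) ∧
      Real.pi < A + B + C ∧
      (∃ ρ, 0 < ρ ∧ ρ * Real.cos A = ⟪(q : E3), r⟫ - ⟪(p : E3), q⟫ * ⟪(p : E3), r⟫ ∧
        ρ * Real.sin A = det3 p q r) ∧
      (∃ ρ, 0 < ρ ∧ ρ * Real.cos B = ⟪(r : E3), p⟫ - ⟪(q : E3), r⟫ * ⟪(q : E3), p⟫ ∧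
        ρ * Real.sin B = det3 q r p) ∧
      (∃ ρ, 0 < ρ ∧ ρ * Real.cos C = ⟪(p : E3), q⟫ - ⟪(r : E3), p⟫ * ⟪(r : E3), q⟫ ∧
        ρ * Real.sin C = det3 r p q) := by
  have hq : det3 (q : E3) r p = det3 (p : E3) q r := (det3_cyclic _ _ _).symm
  have hr : det3 (r : E3) p q = det3 (p : E3) q r := det3_cyclic _ _ _
  have hsq := det3_sq p q r
  have hc0 := one_sub_inner_sq_pos hD
  have ha0 := one_sub_inner_sq_pos (hq ▸ hD)
  have hb0 := one_sub_inner_sq_pos (hr ▸ hD)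
  rw [hq, hr]
  rw [real_inner_comm (p : E3) (r : E3)] at hb0 ⊢
  rw [real_inner_comm (p : E3) (q : E3), real_inner_comm (q : E3) (r : E3)]
  generalize det3 (p : E3) q r = D at *
  generalize ⟪(q : E3), (r : E3)⟫ = a at *
  generalize ⟪(p : E3), (r : E3)⟫ = b at *
  generalize ⟪(p : E3), (q : E3)⟫ = c at *
  have sa := Real.sq_sqrt ha0.le
  have sb := Real.sq_sqrt hb0.le
  have sc := Real.sq_sqrt hc0.le
  have pa := Real.sqrt_pos.2 ha0
  have pb := Real.sqrt_pos.2 hb0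
  have pc := Real.sqrt_pos.2 hc0
  generalize Real.sqrt (1 - a ^ 2) = x at *
  generalize Real.sqrt (1 - b ^ 2) = y at *
  generalize Real.sqrt (1 - c ^ 2) = z at *
  obtain ⟨A, A0, Aπ, hA, hA'⟩ := exists_polar_of_sin_pos (mul_pos pb pc) hD
    (x := a - c * b) (by rw [mul_pow, sb, sc, hsq]; ring)
  obtain ⟨B, B0, Bπ, hB, hB'⟩ := exists_polar_of_sin_pos (mul_pos pa pc) hD
    (x := b - a * c) (by rw [mul_pow, sa, sc, hsq]; ring)
  obtain ⟨C, C0, Cπ, hC, hC'⟩ := exists_polar_of_sin_pos (mul_pos pa pb) hD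
    (x := c - b * a) (by rw [mul_pow, sa, sb, hsq]; ring)
  refine ⟨A, B, C, ⟨A0, Aπ⟩, ⟨B0, Bπ⟩, ⟨C0, Cπ⟩, ?_, ⟨_, mul_pos pb pc, hA, hA'⟩,
    ⟨_, mul_pos pa pc, hB, hB'⟩, ⟨_, mul_pos pa pb, hC, hC'⟩⟩
  by_contra hle
  push Not at hle
  -- If `A + B ≤ π - C`, monotonicity of the cosine gives `cos A cos B - sin A sin B + cos C ≥ 0`.
  -- Multiplied by `x y z²`, the left side becomes a polynomial in the scalar products, namely `(c -
  -- 1) D²`, which is negative.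
  have h1 : Real.cos (Real.pi - C) ≤ Real.cos (A + B) :=
    Real.cos_le_cos_of_nonneg_of_le_pi (by linarith) (by linarith) (by linarith)
  rw [Real.cos_pi_sub, Real.cos_add] at h1
  have h2 : 0 ≤ (x * y * z ^ 2) * (Real.cos A * Real.cos B - Real.sin A * Real.sin B +
      Real.cos C) := mul_nonneg (by positivity) (by linarith)
  have h3 : (x * y * z ^ 2) * (Real.cos A * Real.cos B - Real.sin A * Real.sin B + Real.cos C) =
      (y * z * Real.cos A) * (x * z * Real.cos B) - (y * z * Real.sin A) * (x * z * Real.sin B) +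
        (x * y * Real.cos C) * z ^ 2 := by ring
  rw [h3, hA, hB, hC, hA', hB', sc] at h2
  have h4 : (a - c * b) * (b - a * c) - D * D + (c - b * a) * (1 - c ^ 2) = (c - 1) * D ^ 2 := by
    have : D * D = D ^ 2 := by ring
    rw [this, hsq]; ring
  rw [h4] at h2
  have h5 : c < 1 := by nlinarith
  nlinarith [mul_pos (sub_pos.2 h5) (pow_pos hD 2)]

theorem angEq_of_polar {ρ ρ' θ φ : ℝ} (hρ : 0 < ρ) (hρ' : 0 < ρ')
    (hc : ρ * Real.cos θ = ρ' * Real.cos φ) (hs : ρ * Real.sin θ = ρ' * Real.sin φ) :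
    AngEq θ φ := by
  have h1 : ρ ^ 2 = ρ' ^ 2 := by
    have e1 := Real.sin_sq_add_cos_sq θ
    have e2 := Real.sin_sq_add_cos_sq φ
    calc ρ ^ 2 = (ρ * Real.cos θ) ^ 2 + (ρ * Real.sin θ) ^ 2 := by
          rw [mul_pow, mul_pow, ← mul_add, add_comm, e1, mul_one]
      _ = ρ' ^ 2 := by rw [hc, hs, mul_pow, mul_pow, ← mul_add, add_comm, e2, mul_one]
  have h2 : ρ = ρ' := by
    rwa [sq_eq_sq₀ hρ.le hρ'.le] at h1
  subst h2
  obtain ⟨k, hk⟩ := Real.Angle.angle_eq_iff_two_pi_dvd_sub.1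
    (Real.Angle.cos_sin_inj (mul_left_cancel₀ hρ.ne' hc) (mul_left_cancel₀ hρ.ne' hs))
  exact ⟨k, by linarith⟩

theorem AngEq.eq_of_mem {θ φ : ℝ} (h : AngEq θ φ) (h0 : 0 < θ) (h1 : θ < 2 * Real.pi)
    (h2 : 0 < φ) (h3 : φ < 2 * Real.pi) : θ = φ := by
  rcases lt_trichotomy θ φ with h4 | h4 | h4
  · exact absurd h.symm (not_angEq_of_lt h4 (by linarith))
  · exact h4
  · exact absurd h (not_angEq_of_lt h4 (by linarith))

/-! ### Cutting a quadrilateral along a diagonal -/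

/-- Read the two quantities attached to an angle at `p` as real and imaginary part of a complex
number whose argument is the angle. The numbers of adjacent angles multiply to a positive multiple
of the number of their sum when `|⟪p, r⟫| < 1`. This is the real part; `polar_mul_det` is the
imaginary part. -/
theorem polar_mul_inner (p q r t : S2) :
    (⟪(q : E3), r⟫ - ⟪(p : E3), q⟫ * ⟪(p : E3), r⟫) *
      (⟪(r : E3), t⟫ - ⟪(p : E3), r⟫ * ⟪(p : E3), t⟫) - det3 p q r * det3 p r t =
    (1 - ⟪(p : E3), r⟫ ^ 2) * (⟪(q : E3), t⟫ - ⟪(p : E3), q⟫ * ⟪(p : E3), t⟫) := by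
  have h : det3 (p : E3) q r * det3 (p : E3) r t = ⟪(p : E3), p⟫ * (⟪(q : E3), r⟫ * ⟪(r : E3), t⟫ -
      ⟪(q : E3), t⟫ * ⟪(r : E3), r⟫) - ⟪(p : E3), r⟫ * (⟪(p : E3), q⟫ * ⟪(r : E3), t⟫ -
      ⟪(q : E3), t⟫ * ⟪(p : E3), r⟫) + ⟪(p : E3), t⟫ * (⟪(p : E3), q⟫ * ⟪(r : E3), r⟫ -
      ⟪(q : E3), r⟫ * ⟪(p : E3), r⟫) := by
    simp only [det3_eq, inner_eq_coords]; ring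
  rw [h, S2.inner_self, S2.inner_self]; ring

theorem polar_mul_det (p q r t : S2) :
    (⟪(q : E3), r⟫ - ⟪(p : E3), q⟫ * ⟪(p : E3), r⟫) * det3 p r t +
      det3 p q r * (⟪(r : E3), t⟫ - ⟪(p : E3), r⟫ * ⟪(p : E3), t⟫) =
    (1 - ⟪(p : E3), r⟫ ^ 2) * det3 p q t := by
  have h : (⟪(p : E3), p⟫ * ⟪(q : E3), r⟫ - ⟪(p : E3), q⟫ * ⟪(p : E3), r⟫) * det3 (p : E3) r t +
      det3 (p : E3) q r * (⟪(p : E3), p⟫ * ⟪(r : E3), t⟫ - ⟪(p : E3), r⟫ * ⟪(p : E3), t⟫) =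
    (⟪(p : E3), p⟫ * ⟪(r : E3), r⟫ - ⟪(p : E3), r⟫ ^ 2) * det3 (p : E3) q t := by
    simp only [det3_eq, inner_eq_coords]; ring
  rwa [S2.inner_self, S2.inner_self, one_mul, one_mul, one_mul] at h

/-- An angle of a quadrilateral is the sum of the angles into which a diagonal divides it. -/
theorem angle_eq_add {p q r t : S2} {θ A B ρ ρ₁ ρ₂ : ℝ} (h0 : 0 < θ) (h1 : θ < 2 * Real.pi)
    (hA0 : 0 < A) (hA1 : A < Real.pi) (hB0 : 0 < B) (hB1 : B < Real.pi)
    (hρ : 0 < ρ) (hρ₁ : 0 < ρ₁) (hρ₂ : 0 < ρ₂) (hr : 0 < 1 - ⟪(p : E3), r⟫ ^ 2)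
    (hc : ρ * Real.cos θ = ⟪(q : E3), t⟫ - ⟪(p : E3), q⟫ * ⟪(p : E3), t⟫)
    (hs : ρ * Real.sin θ = det3 p q t)
    (hAc : ρ₁ * Real.cos A = ⟪(q : E3), r⟫ - ⟪(p : E3), q⟫ * ⟪(p : E3), r⟫)
    (hAs : ρ₁ * Real.sin A = det3 p q r)
    (hBc : ρ₂ * Real.cos B = ⟪(r : E3), t⟫ - ⟪(p : E3), r⟫ * ⟪(p : E3), t⟫)
    (hBs : ρ₂ * Real.sin B = det3 p r t) : θ = A + B := by
  have e1 := polar_mul_inner p q r t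
  have e2 := polar_mul_det p q r t
  rw [← hc, ← hAc, ← hAs, ← hBc, ← hBs] at e1
  rw [← hs, ← hAc, ← hAs, ← hBc, ← hBs] at e2
  refine AngEq.eq_of_mem (angEq_of_polar (mul_pos hr hρ) (mul_pos hρ₁ hρ₂) ?_ ?_) h0 h1
    (by linarith) (by linarith)
  · rw [Real.cos_add]; linarith
  · rw [Real.sin_add]; linarith

/-- Since the angles at `v₁` and `v₃` are less than `π`, the triangles on both sides of the diagonal
`v₀v₂` are positively oriented. Their angles at `v₀` and `v₂` then add up to those of the
quadrilateral, a priori modulo `2π`, but all sums are in `(0, 2π)`. No convexity at `v₀` and `v₂` is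
needed. -/
theorem quadrilateral_angle_sum {R : Set S2} {v₀ v₁ v₂ v₃ : S2} {θ₀ θ₁ θ₂ θ₃ : ℝ}
    (h₀ : IsOrientedAngle R v₀ v₁ v₃ θ₀ 1) (h₁ : IsOrientedAngle R v₁ v₂ v₀ θ₁ 1)
    (h₂ : IsOrientedAngle R v₂ v₃ v₁ θ₂ 1) (h₃ : IsOrientedAngle R v₃ v₀ v₂ θ₃ 1)
    (hl₁ : θ₁ < Real.pi) (hl₃ : θ₃ < Real.pi) : 2 * Real.pi < θ₀ + θ₁ + θ₂ + θ₃ := by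
  obtain ⟨a₀, b₀, pa₀, pb₀, -, -, c₀, d₀⟩ := h₀.exists_coords
  obtain ⟨a₁, b₁, pa₁, pb₁, -, -, c₁, d₁⟩ := h₁.exists_coords
  obtain ⟨a₂, b₂, pa₂, pb₂, -, -, c₂, d₂⟩ := h₂.exists_coords
  obtain ⟨a₃, b₃, pa₃, pb₃, -, -, c₃, d₃⟩ := h₃.exists_coords
  rw [one_mul] at d₀ d₁ d₂ d₃
  have hD : 0 < det3 (v₀ : E3) v₁ v₂ := by
    rw [det3_cyclic, d₁]
    exact mul_pos (mul_pos pa₁ pb₁) (Real.sin_pos_of_pos_of_lt_pi h₁.1.1 hl₁)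
  have hD' : 0 < det3 (v₀ : E3) v₂ v₃ := by
    rw [← det3_cyclic, d₃]
    exact mul_pos (mul_pos pa₃ pb₃) (Real.sin_pos_of_pos_of_lt_pi h₃.1.1 hl₃)
  obtain ⟨A, B, C, ⟨A0, A1⟩, ⟨B0, B1⟩, ⟨C0, C1⟩, hsum, ⟨α, α0, αc, αs⟩, ⟨β, β0, βc, βs⟩,
    ⟨γ, γ0, γc, γs⟩⟩ := exists_triangle_angles hD
  obtain ⟨A', C', B', ⟨A0', A1'⟩, ⟨C0', C1'⟩, ⟨B0', B1'⟩, hsum', ⟨α', α0', αc', αs'⟩,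
    ⟨γ', γ0', γc', γs'⟩, ⟨β', β0', βc', βs'⟩⟩ := exists_triangle_angles hD'
  have hr : 0 < 1 - ⟪(v₀ : E3), v₂⟫ ^ 2 := one_sub_inner_sq_pos hD'
  have hr' : 0 < 1 - ⟪(v₂ : E3), v₀⟫ ^ 2 := by rwa [real_inner_comm]
  have e₀ : θ₀ = A + A' := angle_eq_add h₀.1.1 h₀.1.2 A0 A1 A0' A1' (mul_pos pa₀ pb₀) α0 α0' hr
    c₀.symm d₀.symm αc αs αc' αs'
  have e₂ : θ₂ = C' + C := angle_eq_add h₂.1.1 h₂.1.2 C0' C1' C0 C1 (mul_pos pa₂ pb₂) γ0' γ0 hr'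
    c₂.symm d₂.symm γc' γs' γc γs
  have hpi := Real.pi_pos
  have e₁ : θ₁ = B := (angEq_of_polar (mul_pos pa₁ pb₁) β0 (c₁.symm.trans βc.symm)
    (d₁.symm.trans βs.symm)).eq_of_mem h₁.1.1 h₁.1.2 B0 (by linarith)
  have e₃ : θ₃ = B' := (angEq_of_polar (mul_pos pa₃ pb₃) β0' (c₃.symm.trans βc'.symm)
    (d₃.symm.trans βs'.symm)).eq_of_mem h₃.1.1 h₃.1.2 B0' (by linarith)
  linarith

namespace SphericalPolygon

theorem pi_lt_add_of_hasEqualOppositeEdges {Q : SphericalPolygon 4} {x y β γ : ℝ}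
    (hQ : Q.HasEqualOppositeEdges x y β γ) (hγ : γ < Real.pi) : Real.pi < β + γ := by
  obtain ⟨-, -, -, -, -, h0, h1, h2, h3⟩ := hQ
  obtain ⟨s, hs, ho⟩ := Q.exists_orientation
  have o0 := ho 0
  have o1 := ho 1
  have o2 := ho 2
  have o3 := ho 3
  rw [h0] at o0
  rw [h1] at o1
  rw [h2] at o2
  rw [h3] at o3
  have e0 : (0 : ZMod 4) + 1 = 1 ∧ (0 : ZMod 4) - 1 = 3 ∧ (1 : ZMod 4) + 1 = 2 ∧
    (1 : ZMod 4) - 1 = 0 ∧ (2 : ZMod 4) + 1 = 3 ∧ (2 : ZMod 4) - 1 = 1 ∧ (3 : ZMod 4) + 1 = 0 ∧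
    (3 : ZMod 4) - 1 = 2 := by decide
  obtain ⟨e1, e2, e3, e4, e5, e6, e7, e8⟩ := e0
  rw [e1, e2] at o0
  rw [e3, e4] at o1
  rw [e5, e6] at o2
  rw [e7, e8] at o3
  rcases hs with rfl | rfl
  · have := quadrilateral_angle_sum o0 o1 o2 o3 hγ hγ
    linarith
  -- For a clockwise polygon the vertices are read in the opposite order.
  · have p0 := o0.symm
    have p1 := o1.symm
    have p2 := o2.symm
    have p3 := o3.symm
    rw [neg_neg] at p0 p1 p2 p3
    have := quadrilateral_angle_sum p0 p3 p2 p1 hγ hγ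
    linarith

end SphericalPolygon

/-! ### Regular polygons -/

/-- The first side of a corner with sides of equal length, in terms of the second side. -/
theorem IsOrientedAngle.eq_of_equal_sides {R : Set S2} {p q r : S2} {θ s c : ℝ}
    (h : IsOrientedAngle R p q r θ s) (hq : ⟪(p : E3), q⟫ = c) (hr : ⟪(p : E3), r⟫ = c) :
    (q : E3) = (c * (1 - Real.cos θ)) • (p : E3) + Real.cos θ • (r : E3) -
      (s * Real.sin θ) • cross3 (p : E3) r := by
  obtain ⟨b, b', hb, hb', hb2, hb2', -⟩ := h.exists_coords
  obtain ⟨-, hs1, u, e, hf, he, ⟨a₁, b₁, hb₁, hq'⟩, ⟨a₂, b₂, hb₂, hr'⟩, -⟩ := h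
  have hss : s * s = 1 := by rcases hs1 with rfl | rfl <;> norm_num
  have h2 : cross3 (p : E3) u = s • e := by rw [he, smul_smul, hss, one_smul]
  have h3 : cross3 (p : E3) e = -s • u := by
    rw [he, cross3_smul_right, cross3_cross3, hf.pu, hf.pp]
    module
  have hd0 : dir u e 0 = u := by simp [dir]
  rw [hd0] at hq'
  have ha₁ : a₁ = c := by
    rw [← hq, hq']
    simp only [inner_add_right, inner_smul_right, hf.pp, hf.pu]; ring
  have ha₂ : a₂ = c := by
    rw [← hr, hr']
    simp only [inner_add_right, inner_smul_right, hf.pp, hf.inner_dir]; ring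
  have e1 : c * c + b₁ * b₁ = 1 := by
    have := S2.inner_self q
    rw [hq', ha₁] at this
    simp only [inner_add_left, inner_add_right, inner_smul_left, inner_smul_right, hf.pp, hf.pu,
      hf.up, hf.uu, RCLike.conj_to_real] at this
    linarith
  have e2 : c * c + b₂ * b₂ = 1 := by
    have := S2.inner_self r
    rw [hr', ha₂] at this
    have hdp : ⟪dir u e θ, (p : E3)⟫ = 0 := by rw [real_inner_comm]; exact hf.inner_dir θ
    simp only [inner_add_left, inner_add_right, inner_smul_left, inner_smul_right, hf.pp,
      hf.inner_dir, hdp, hf.inner_dir_self, RCLike.conj_to_real] at this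
    linarith
  have hbb : b₂ = b₁ := (mul_self_inj hb₂.le hb₁.le).1 (by linarith)
  have hcr : cross3 (p : E3) r = (b₁ * s) • (Real.cos θ • e - Real.sin θ • u) := by
    rw [hr', cross3_add_right, cross3_smul_right, cross3_smul_right, cross3_self, hbb, dir,
      cross3_add_right, cross3_smul_right, cross3_smul_right, h2, h3]
    module
  rw [hcr, hr', hq', ha₁, ha₂, hbb, dir]
  have e3 := Real.sin_sq_add_cos_sq θ
  have e4 : s * Real.sin θ * (b₁ * s) = b₁ * Real.sin θ := by
    calc s * Real.sin θ * (b₁ * s) = (s * s) * (b₁ * Real.sin θ) := by ring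
      _ = _ := by rw [hss, one_mul]
  rw [smul_smul, e4]
  have e5 : b₁ • u = (b₁ * (Real.sin θ ^ 2 + Real.cos θ ^ 2)) • u := by rw [e3, mul_one]
  rw [e5]
  module

/-! ### The vertices of a regular polygon lie on a circle -/

/-- The vertices of a rotating frame: a point that moves on a circle by steps of angle `2t`. -/
theorem dir_step {n f N : E3} (hf : Frame n f N) (hN : N = cross3 n f) {h r ψ t s C S Cα Sα : ℝ}
    (hC : C ^ 2 + S ^ 2 = 1) (hα : Cα ^ 2 + Sα ^ 2 = 1) (hct : Real.cos t = C * Sα)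
    (hst : Real.sin t ≠ 0) (hs : s * s = 1) (hh : h = s * C * Cα / Real.sin t)
    (hr : r = S / Real.sin t) :
    h • n + r • dir f N (ψ + 2 * t) =
      ((C ^ 2 - S ^ 2) * (1 - (Cα ^ 2 - Sα ^ 2))) • (h • n + r • dir f N ψ) +
      (Cα ^ 2 - Sα ^ 2) • (h • n + r • dir f N (ψ - 2 * t)) -
      (s * (2 * Sα * Cα)) • cross3 (h • n + r • dir f N ψ) (h • n + r • dir f N (ψ - 2 * t)) := by
  have hnN : cross3 n N = -f := by
    rw [hN, cross3_cross3, hf.pu, hf.pp]; module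
  have hfN : cross3 f N = n := by
    rw [hN, cross3_cross3, hf.uu, hf.up]; module
  have hfn : cross3 f n = -N := by rw [cross3_swap, ← hN]
  have hNn : cross3 N n = f := by rw [cross3_swap, hnN, neg_neg]
  have hNf : cross3 N f = -n := by rw [cross3_swap, hfN]
  set F := dir f N ψ with hF
  set G := dir f N (ψ + Real.pi / 2) with hG
  have hG' : G = -Real.sin ψ • f + Real.cos ψ • N := by
    rw [hG, dir, Real.cos_add_pi_div_two, Real.sin_add_pi_div_two]
  have cnF : cross3 n F = G := by
    rw [hG', hF, dir, cross3_add_right, cross3_smul_right, cross3_smul_right, hnN, ← hN]; module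
  have cnG : cross3 n G = -F := by
    rw [hG', hF, dir, cross3_add_right, cross3_smul_right, cross3_smul_right, hnN, ← hN]; module
  have cFn : cross3 F n = -G := by rw [cross3_swap, cnF]
  have cFG : cross3 F G = n := by
    rw [hG', hF, dir]
    simp only [cross3_add_right, cross3_add_left, cross3_smul_right, cross3_smul_left, cross3_self,
      hfN, hNf]
    have := Real.sin_sq_add_cos_sq ψ
    calc _ = (Real.sin ψ ^ 2 + Real.cos ψ ^ 2) • n := by module
      _ = n := by rw [this, one_smul]
  have c2 : Real.cos (2 * t) = 1 - 2 * Real.sin t ^ 2 := by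
    rw [Real.cos_two_mul]; have := Real.sin_sq_add_cos_sq t; linarith
  have s2 : Real.sin (2 * t) = 2 * Real.sin t * (C * Sα) := by rw [Real.sin_two_mul, hct]
  have hst2 : Real.sin t ^ 2 = 1 - (C * Sα) ^ 2 := by
    have := Real.sin_sq_add_cos_sq t; rw [← hct]; linarith
  have d1 : dir f N (ψ + 2 * t) = Real.cos (2 * t) • F + Real.sin (2 * t) • G := dir_add _ _ _ _
  have d2 : dir f N (ψ - 2 * t) = Real.cos (2 * t) • F - Real.sin (2 * t) • G := by
    rw [sub_eq_add_neg, dir_add, Real.cos_neg, Real.sin_neg]; module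
  have hcr : cross3 (h • n + r • F) (h • n + r • dir f N (ψ - 2 * t)) =
      (-(r ^ 2 * Real.sin (2 * t))) • n + (h * r * Real.sin (2 * t)) • F -
        (h * r * (1 - Real.cos (2 * t))) • G := by
    rw [d2]
    simp only [sub_eq_add_neg, smul_add, smul_neg, ← neg_smul, smul_smul, cross3_add_right,
      cross3_add_left, cross3_smul_right, cross3_smul_left, cross3_self, cnF, cnG, cFn, cFG]
    module
  rw [hcr, d1, d2]
  -- The components of the claim along the axis `n`, the radial direction `F` and the tangential
  -- direction `G`.
  have k1 : h = (C ^ 2 - S ^ 2) * (1 - (Cα ^ 2 - Sα ^ 2)) * h + (Cα ^ 2 - Sα ^ 2) * h +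
      s * (2 * Sα * Cα) * (r ^ 2 * Real.sin (2 * t)) := by
    rw [s2, hh, hr]
    field_simp
    have hS : S ^ 2 = 1 - C ^ 2 := by linarith
    have hCα : Cα ^ 2 = 1 - Sα ^ 2 := by linarith
    rw [hS, hCα]
    ring
  have k2 : r * Real.cos (2 * t) = (C ^ 2 - S ^ 2) * (1 - (Cα ^ 2 - Sα ^ 2)) * r +
      (Cα ^ 2 - Sα ^ 2) * (r * Real.cos (2 * t)) -
      s * (2 * Sα * Cα) * (h * r * Real.sin (2 * t)) := by
    have hS : S ^ 2 = 1 - C ^ 2 := by linarith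
    have hCα : Cα ^ 2 = 1 - Sα ^ 2 := by linarith
    have : s * (2 * Sα * Cα) * (h * r * Real.sin (2 * t)) =
        4 * (s * s) * Sα ^ 2 * Cα ^ 2 * C ^ 2 * r := by
      rw [s2, hh]; field_simp; ring
    rw [this, c2, hst2, hs, hS, hCα]
    ring
  have k3 : r * Real.sin (2 * t) = -(Cα ^ 2 - Sα ^ 2) * (r * Real.sin (2 * t)) +
      s * (2 * Sα * Cα) * (h * r * (1 - Real.cos (2 * t))) := by
    have hCα : Cα ^ 2 = 1 - Sα ^ 2 := by linarith
    have : s * (2 * Sα * Cα) * (h * r * (1 - Real.cos (2 * t))) =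
        4 * (s * s) * Sα * Cα ^ 2 * C * r * Real.sin t := by
      rw [c2, hh]; field_simp; ring
    rw [this, s2, hs, hCα]
    ring
  linear_combination (norm := module) k1 • n + k2 • F + k3 • G

/-- A sequence of points with constant steps and constant turning angle runs on a circle. -/
theorem exists_circle {w : ℕ → S2} {x α s : ℝ} (hx0 : 0 < x) (hx1 : x < Real.pi) (hα0 : 0 < α)
    (hα1 : α < Real.pi) (hs : s * s = 1) (hin : ⟪(w 0 : E3), w 1⟫ = Real.cos x)
    (hrec : ∀ k, (w (k + 2) : E3) = (Real.cos x * (1 - Real.cos α)) • (w (k + 1) : E3) +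
      Real.cos α • (w k : E3) - (s * Real.sin α) • cross3 (w (k + 1) : E3) (w k)) :
    ∃ (n f N : E3) (h r t : ℝ), Frame n f N ∧ 0 < r ∧ 0 < t ∧ t < Real.pi / 2 ∧
      Real.cos t = Real.cos (x / 2) * Real.sin (α / 2) ∧
      ∀ k : ℕ, (w k : E3) = h • n + r • dir f N ((2 * k - 1) * t) := by
  have hC0 : 0 < Real.cos (x / 2) := Real.cos_pos_of_mem_Ioo ⟨by linarith, by linarith⟩
  have hS0 : 0 < Real.sin (x / 2) := Real.sin_pos_of_pos_of_lt_pi (by linarith) (by linarith)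
  have hCα0 : 0 < Real.cos (α / 2) := Real.cos_pos_of_mem_Ioo ⟨by linarith, by linarith⟩
  have hSα0 : 0 < Real.sin (α / 2) := Real.sin_pos_of_pos_of_lt_pi (by linarith) (by linarith)
  have hCS := Real.cos_sq_add_sin_sq (x / 2)
  have hCSα := Real.cos_sq_add_sin_sq (α / 2)
  have hcx : Real.cos x = Real.cos (x / 2) ^ 2 - Real.sin (x / 2) ^ 2 := by
    rw [← Real.cos_two_mul', mul_div_cancel₀ _ two_ne_zero]
  have hcα : Real.cos α = Real.cos (α / 2) ^ 2 - Real.sin (α / 2) ^ 2 := by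
    rw [← Real.cos_two_mul', mul_div_cancel₀ _ two_ne_zero]
  have hsα : Real.sin α = 2 * Real.sin (α / 2) * Real.cos (α / 2) := by
    rw [← Real.sin_two_mul, mul_div_cancel₀ _ two_ne_zero]
  rw [hcx] at hin
  simp only [hcx, hcα, hsα] at hrec
  generalize Real.cos (x / 2) = C at *
  generalize Real.sin (x / 2) = S at *
  generalize Real.cos (α / 2) = Cα at *
  generalize Real.sin (α / 2) = Sα at *
  have hC1 : C < 1 := by nlinarith
  have hSα1 : Sα < 1 := by nlinarith
  have hCS1 : C * Sα < 1 := by nlinarith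
  set t := Real.arccos (C * Sα) with ht
  have hct : Real.cos t = C * Sα := Real.cos_arccos (by nlinarith [mul_pos hC0 hSα0]) hCS1.le
  have ht0 : 0 < t := Real.arccos_pos.2 hCS1
  have ht1 : t < Real.pi / 2 := by
    rw [ht, Real.arccos_lt_pi_div_two]; exact mul_pos hC0 hSα0
  have hst0 : 0 < Real.sin t := Real.sin_pos_of_pos_of_lt_pi ht0 (by linarith)
  have hst2 : Real.sin t ^ 2 = 1 - (C * Sα) ^ 2 := by
    have := Real.sin_sq_add_cos_sq t; rw [← hct]; linarith
  clear_value t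
  -- `M` is the midpoint of the first edge and `N` its direction there. The axis of rotation `n` is
  -- sought in the plane perpendicular to `N`; the coefficients `a` and `b` below are its
  -- components.
  let M : E3 := (2 * C)⁻¹ • ((w 0 : E3) + w 1)
  let N : E3 := (2 * S)⁻¹ • ((w 1 : E3) - w 0)
  have hin' : ⟪(w 1 : E3), w 0⟫ = C ^ 2 - S ^ 2 := by rw [real_inner_comm]; exact hin
  have hM : ⟪M, M⟫ = 1 := by
    simp only [M, inner_smul_left, inner_smul_right, inner_add_left, inner_add_right, hin, hin',
      S2.inner_self, RCLike.conj_to_real]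
    field_simp
    linarith
  have hN : ⟪N, N⟫ = 1 := by
    simp only [N, inner_smul_left, inner_smul_right, inner_sub_left, inner_sub_right, hin, hin',
      S2.inner_self, RCLike.conj_to_real]
    field_simp
    linarith
  have hMN : ⟪M, N⟫ = 0 := by
    simp only [M, N, inner_smul_left, inner_smul_right, inner_sub_right, inner_add_left, hin, hin',
      S2.inner_self, RCLike.conj_to_real]
    ring
  have hF : Frame M N (cross3 M N) := Frame.of_cross3 hM hN hMN
  set K := cross3 M N with hK
  have hKM : cross3 K M = N := by
    rw [cross3_swap, hK, cross3_cross3, hMN, hM]; module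
  have hMK : cross3 M K = -N := by rw [cross3_swap, hKM]
  have w0 : (w 0 : E3) = C • M - S • N := by
    simp only [M, N, smul_smul]
    rw [show C * (2 * C)⁻¹ = 1 / 2 by field_simp, show S * (2 * S)⁻¹ = 1 / 2 by field_simp]
    module
  have w1 : (w 1 : E3) = C • M + S • N := by
    simp only [M, N, smul_smul]
    rw [show C * (2 * C)⁻¹ = 1 / 2 by field_simp, show S * (2 * S)⁻¹ = 1 / 2 by field_simp]
    module
  let a := s * Cα / Real.sin t
  let b := S * Sα / Real.sin t
  have hab : a * a + b * b = 1 := by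
    have : a * a + b * b = ((s * s) * Cα ^ 2 + S ^ 2 * Sα ^ 2) / Real.sin t ^ 2 := by
      simp only [a, b]; field_simp
    rw [this, hs, hst2, div_eq_one_iff_eq (by rw [← hst2]; positivity)]
    nlinarith
  let n : E3 := a • M + b • K
  let f : E3 := b • M - a • K
  have hfr : Frame n f N := by
    refine ⟨?_, ?_, hN, ?_, ?_, ?_⟩ <;>
    · simp only [n, f, inner_smul_left, inner_smul_right, inner_add_left, inner_add_right,
        inner_sub_left, inner_sub_right, hF.pp, hF.pe, hF.pu, hF.ee, hF.ep, hF.eu,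
        RCLike.conj_to_real]
      linarith
  have hNc : N = cross3 n f := by
    simp only [n, f, sub_eq_add_neg, ← neg_smul, cross3_add_right, cross3_add_left,
      cross3_smul_right, cross3_smul_left, cross3_self, hKM, hMK]
    have : N = (a * a + b * b) • N := by rw [hab, one_smul]
    conv_lhs => rw [this]
    module
  have hM' : M = a • n + b • f := by
    have : M = (a * a + b * b) • M := by rw [hab, one_smul]
    conv_lhs => rw [this]
    simp only [n, f]
    module
  let r := S / Real.sin t
  let h := s * C * Cα / Real.sin t
  have e1 : C * a = h := by simp only [a, h]; ring
  have e2 : C * b = r * Real.cos t := by rw [hct]; simp only [b, r]; ring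
  have e3 : r * Real.sin t = S := by simp only [r]; field_simp
  refine ⟨n, f, N, h, r, t, hfr, by positivity, ht0, ht1, hct, ?_⟩
  -- The recurrence has order two, so two consecutive points are carried along. The odd multiples of
  -- `t` put the midpoint of the first edge at angle `0`.
  have key : ∀ k : ℕ, (w k : E3) = h • n + r • dir f N ((2 * k - 1) * t) ∧
      (w (k + 1) : E3) = h • n + r • dir f N ((2 * ((k + 1 : ℕ) : ℝ) - 1) * t) := by
    intro k
    induction k with
    | zero =>
      have z0 : (2 * ((0 : ℕ) : ℝ) - 1) * t = -t := by push_cast; ring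
      have z1 : (2 * ((0 + 1 : ℕ) : ℝ) - 1) * t = t := by push_cast; ring
      rw [z0, z1, zero_add, w0, w1, hM', dir, dir, Real.cos_neg, Real.sin_neg, ← e3, smul_add,
        smul_smul, smul_smul, e1, e2]
      constructor <;> module
    | succ k ih =>
      refine ⟨ih.2, ?_⟩
      have := dir_step (ψ := (2 * ((k + 1 : ℕ) : ℝ) - 1) * t) hfr hNc hCS hCSα hct hst0.ne' hs
        (show h = s * C * Cα / Real.sin t from rfl) (show r = S / Real.sin t from rfl)
      rw [hrec k]
      have z1 : (2 * ((k + 1 + 1 : ℕ) : ℝ) - 1) * t =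
          (2 * ((k + 1 : ℕ) : ℝ) - 1) * t + 2 * t := by push_cast; ring
      have z2 : (2 * (k : ℝ) - 1) * t = (2 * ((k + 1 : ℕ) : ℝ) - 1) * t - 2 * t := by
        push_cast; ring
      rw [z1, this, ih.2, ih.1, z2]
  exact fun k => (key k).1

/-- The two chords are mirror images in the axis at angle `μ`, so they cross on it. The coefficients
are the same up to order, so the identity survives a shift along the axis of the circle. -/
theorem dir_crossing (f N : E3) (μ A B : ℝ) :
    Real.sin B • dir f N (μ - A) + Real.sin A • dir f N (μ + B) =
      Real.sin B • dir f N (μ + A) + Real.sin A • dir f N (μ - B) := by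
  simp only [dir, Real.cos_add, Real.cos_sub, Real.sin_add, Real.sin_sub]
  module

namespace SphericalPolygon

theorem natCast_eq_natCast {m a b : ℕ} (ha : a < m) (hb : b < m)
    (h : (a : ZMod m) = (b : ZMod m)) : a = b := by
  rw [ZMod.natCast_eq_natCast_iff'] at h
  rwa [Nat.mod_eq_of_lt ha, Nat.mod_eq_of_lt hb] at h

/-- The angle of a regular spherical polygon exceeds that of the plane polygon. -/
theorem IsRegular.angle_gt {m : ℕ} (hm : 4 ≤ m) {P : SphericalPolygon m} {x α : ℝ}
    (hP : P.IsRegular x α) : (m - 2) * Real.pi < m * α := by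
  have hpi := Real.pi_pos
  have hm0 : (4 : ℝ) ≤ m := by exact_mod_cast hm
  have hα0 : 0 < α := by rw [← hP.2 0]; exact (P.isInteriorAngle 0).1
  by_cases hα1 : Real.pi ≤ α
  · nlinarith
  push Not at hα1
  obtain ⟨s, hs, ho⟩ := P.exists_orientation
  have hss : s * s = 1 := by rcases hs with rfl | rfl <;> norm_num
  have hcos : ∀ i, ⟪(P.vertex i : E3), P.vertex (i + 1)⟫ = Real.cos x := by
    intro i
    have h1 := hP.1 i
    rw [edgeLength] at h1
    rw [← h1, InnerProductGeometry.cos_angle, norm_eq_of_mem_sphere, norm_eq_of_mem_sphere]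
    simp
  have hx : 0 < x ∧ x < Real.pi := by
    have h0 : 0 ≤ x := by rw [← hP.1 0]; exact InnerProductGeometry.angle_nonneg _ _
    have h1 : x ≤ Real.pi := by rw [← hP.1 0]; exact InnerProductGeometry.angle_le_pi _ _
    obtain ⟨b, -, hb, -, hb2, -⟩ := (ho 0).exists_coords
    rw [hcos] at hb2
    have h2 : 0 < Real.sin x ^ 2 := by
      have := Real.sin_sq_add_cos_sq x; nlinarith
    refine ⟨lt_of_le_of_ne h0 ?_, lt_of_le_of_ne h1 ?_⟩
    · rintro rfl; simp at h2
    · rintro rfl; simp at h2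
  let w : ℕ → S2 := fun k => P.vertex (k : ZMod m)
  have hrec : ∀ k, (w (k + 2) : E3) = (Real.cos x * (1 - Real.cos α)) • (w (k + 1) : E3) +
      Real.cos α • (w k : E3) - (s * Real.sin α) • cross3 (w (k + 1) : E3) (w k) := by
    intro k
    have h1 := ho ((k : ZMod m) + 1)
    have e1 : (k : ZMod m) + 1 + 1 = ((k + 2 : ℕ) : ZMod m) := by push_cast; ring
    have e2 : (k : ZMod m) + 1 - 1 = (k : ZMod m) := by ring
    have e3 : (k : ZMod m) + 1 = ((k + 1 : ℕ) : ZMod m) := by push_cast; ring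
    have h2 := hcos ((k : ZMod m) + 1)
    have h3 := hcos (k : ZMod m)
    rw [real_inner_comm] at h3
    rw [hP.2] at h1
    rw [e1, e2, e3] at h1
    rw [e1, e3] at h2
    rw [e3] at h3
    exact h1.eq_of_equal_sides h2 h3
  obtain ⟨n, f, N, h, r, t, hfr, hr, ht0, ht1, hct, hw⟩ := exists_circle (w := w) hx.1 hx.2 hα0 hα1
    hss (by have := hcos 0; simpa [w] using this) hrec
  have hclosed : w m = w 0 := by simp [w]
  have hinj : ∀ a b, a < m → b < m → w a = w b → a = b := fun a b ha hb hab =>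
    natCast_eq_natCast ha hb (P.vertex_injective hab)
  have hang : ∀ a b : ℕ, AngEq ((2 * a - 1) * t) ((2 * b - 1) * t) → w a = w b := by
    rintro a b ⟨k, hk⟩
    apply Subtype.ext
    rw [hw, hw, hk, dir_add_int_mul]
  -- The polygon closes after `m` steps of `2t`, so `mt = πk` with `k` the number of turns.
  -- Simplicity must give `k = 1`.
  obtain ⟨-, -, k, hk⟩ := hfr.polar_inj hr hr.le
    ((hw m).symm.trans ((congrArg Subtype.val hclosed).trans (hw 0)))
  have hmt : m * t = Real.pi * k := by
    push_cast at hk; linarith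
  have hk0 : (0 : ℝ) < k := by
    by_contra hneg
    push Not at hneg
    nlinarith [mul_pos (show (0 : ℝ) < m by linarith) ht0]
  have hk1 : (k : ℝ) < 2 := by
    by_contra hk2
    push Not at hk2
    have hmt2 : 2 * Real.pi ≤ m * t := by rw [hmt]; nlinarith
    -- With at least two turns, the edge from `j` to `j + 1` is the first edge turned by `2jt`,
    -- which modulo `2π` lies in `[0, 2t)`. So it starts at vertex `0` or crosses the first edge.
    obtain ⟨j, hj1, hj2⟩ : ∃ j : ℕ, Real.pi ≤ j * t ∧ j * t < Real.pi + t := by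
      refine ⟨⌈Real.pi / t⌉₊, ?_, ?_⟩
      · have := Nat.le_ceil (Real.pi / t)
        rwa [div_le_iff₀ ht0] at this
      · have := Nat.ceil_lt_add_one (show 0 ≤ Real.pi / t by positivity)
        have h2 := mul_lt_mul_of_pos_right this ht0
        rwa [add_mul, div_mul_cancel₀ _ ht0.ne', one_mul] at h2
    have hj3 : 3 ≤ j := by
      by_contra hlt
      have : (j : ℝ) ≤ 2 := by exact_mod_cast (by omega : j ≤ 2)
      nlinarith
    have hjm : j + 2 ≤ m := by
      by_contra hlt
      have h1 : (m : ℝ) ≤ j + 1 := by exact_mod_cast (by omega : m ≤ j + 1)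
      nlinarith
    rcases hj1.eq_or_lt with hj4 | hj4
    · have := hinj j 0 (by omega) (by omega) (hang j 0 ⟨1, by push_cast; linarith⟩)
      omega
    · set δ := j * t - Real.pi with hδ
      have hA : 0 < Real.sin (t + δ) := Real.sin_pos_of_pos_of_lt_pi (by linarith) (by linarith)
      have hB : 0 < Real.sin (t - δ) := Real.sin_pos_of_pos_of_lt_pi (by linarith) (by linarith)
      have d0 : (w 0 : E3) = h • n + r • dir f N (δ - (t + δ)) := by
        rw [hw 0]; congr 3; push_cast; ring
      have d1 : (w 1 : E3) = h • n + r • dir f N (δ + (t - δ)) := by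
        rw [hw 1]; congr 3; push_cast; ring
      have d2 : (w j : E3) = h • n + r • dir f N (δ - (t - δ)) := by
        rw [hw j, ← dir_add_int_mul f N (δ - (t - δ)) 1]; congr 3
        rw [hδ]; push_cast; ring
      have d3 : (w (j + 1) : E3) = h • n + r • dir f N (δ + (t + δ)) := by
        rw [hw (j + 1), ← dir_add_int_mul f N (δ + (t + δ)) 1]; congr 3
        rw [hδ]; push_cast; ring
      have hcross : Real.sin (t - δ) • (w 0 : E3) + Real.sin (t + δ) • (w 1 : E3) =
          Real.sin (t + δ) • (w j : E3) + Real.sin (t - δ) • (w (j + 1) : E3) := by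
        have := dir_crossing f N δ (t + δ) (t - δ)
        rw [d0, d1, d2, d3]
        linear_combination (norm := module) r • this
      have hne : Real.sin (t - δ) • (w 0 : E3) + Real.sin (t + δ) • (w 1 : E3) ≠ 0 := by
        refine nonneg_comb_ne_zero ?_ hB.le hA.le (by linarith)
        have := P.vertex_ne_neg 0
        simpa [w] using this
      have m1 := toSphere_mem_arc hB.le hA.le hne
      have m2 := toSphere_mem_arc hA.le hB.le (hcross ▸ hne)
      rw [← hcross] at m2
      have e1 : w 1 = P.vertex (((0 : ℕ) : ZMod m) + 1) := by simp [w]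
      have e2 : w (j + 1) = P.vertex ((j : ZMod m) + 1) := by simp [w]
      have c1 : ((0 : ℕ) : ZMod m) ≠ (j : ZMod m) := fun hc => by
        have := natCast_eq_natCast (by omega) (by omega) hc
        omega
      have c2 : (j : ZMod m) ≠ ((0 : ℕ) : ZMod m) + 1 := fun hc => by
        have := natCast_eq_natCast (m := m) (a := j) (b := 1) (by omega) (by omega)
          (by rw [hc]; simp)
        omega
      have c3 : ((0 : ℕ) : ZMod m) ≠ (j : ZMod m) + 1 := fun hc => by
        have := natCast_eq_natCast (m := m) (a := 0) (b := j + 1) (by omega) (by omega)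
          (by rw [hc]; simp)
        omega
      generalize toSphere _ = z at m1 m2
      rw [e1] at m1
      rw [e2] at m2
      exact Set.disjoint_left.1 (P.edge_disjoint _ _ c1 c2 c3) m1 m2
  have hk2 : k = 1 := by
    have h1 : 0 < k := by exact_mod_cast hk0
    have h2 : k < 2 := by exact_mod_cast hk1
    omega
  rw [hk2, Int.cast_one, mul_one] at hmt
  -- With `t = π/m`, the relation `cos t = cos (x/2) sin (α/2)` gives `cos t < sin (α/2)`, hence
  -- `π/m > π/2 - α/2`.
  have hlt : Real.cos t < Real.cos (Real.pi / 2 - α / 2) := by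
    rw [Real.cos_pi_div_two_sub, hct]
    have hS : 0 < Real.sin (α / 2) := Real.sin_pos_of_pos_of_lt_pi (by linarith) (by linarith)
    have hC : Real.cos (x / 2) < 1 := by
      have h1 := Real.sin_sq_add_cos_sq (x / 2)
      have h2 : 0 < Real.sin (x / 2) := Real.sin_pos_of_pos_of_lt_pi (by linarith [hx.1])
        (by linarith [hx.2])
      nlinarith
    nlinarith
  have hgt : Real.pi / 2 - α / 2 < t := by
    by_contra hle
    push Not at hle
    exact absurd (Real.cos_le_cos_of_nonneg_of_le_pi ht0.le (by linarith) hle) (not_le.2 hlt)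
  nlinarith

end SphericalPolygon

/-! ### Dihedral tilings by regular polygons and quadrilaterals with equal opposite edges -/

namespace SphericalTiling

open SphericalPolygon

variable {T : SphericalTiling}

namespace VertexArrangement

variable {v : S2} (A : T.VertexArrangement v)

theorem isNext_st (c : T.cornersAt v) : IsNext c.1.2 (A.st c) :=
  (A.st_en c).imp And.left And.left

theorem isNext_en (c : T.cornersAt v) : IsNext c.1.2 (A.en c) :=
  (A.st_en c).symm.imp And.right And.right

theorem eq_st_or_eq_en (c : T.cornersAt v) {i : ZMod (T.sides c.1.1)} (h : IsNext c.1.2 i) :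
    i = A.st c ∨ i = A.en c := by
  rcases A.st_en c with ⟨h1, h2⟩ | ⟨h1, h2⟩ <;> rw [h1, h2]
  · exact h
  · exact Or.symm h

theorem vertex_prev (c : T.cornersAt v) : (T.tile c.1.1).vertex (A.st c) =
    (T.tile (A.next.symm c).1.1).vertex (A.en (A.next.symm c)) := by
  have h := A.vertex_next (A.next.symm c)
  rw [Equiv.apply_symm_apply] at h
  exact h.symm

theorem prev_ne (c : T.cornersAt v) : A.next.symm c ≠ c := by
  intro h
  rw [Equiv.symm_apply_eq] at h
  exact A.next_ne c h.symm

/-- The corner on the other side of the last side of `c`. -/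
theorem eq_next {c c' : T.cornersAt v} (hne : c' ≠ c) {i : ZMod (T.sides c'.1.1)}
    (hi : IsNext c'.1.2 i) (h : (T.tile c'.1.1).vertex i = (T.tile c.1.1).vertex (A.en c)) :
    c' = A.next c := by
  rcases A.eq_st_or_eq_en c' hi with rfl | rfl
  · rw [A.vertex_next] at h
    exact A.st_inj _ _ h
  · exact absurd (A.en_inj _ _ h) hne

/-- The corner on the other side of the first side of `c`. -/
theorem eq_prev {c c' : T.cornersAt v} (hne : c' ≠ c) {i : ZMod (T.sides c'.1.1)}
    (hi : IsNext c'.1.2 i) (h : (T.tile c'.1.1).vertex i = (T.tile c.1.1).vertex (A.st c)) :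
    c' = A.next.symm c := by
  rcases A.eq_st_or_eq_en c' hi with rfl | rfl
  · exact absurd (A.st_inj _ _ h) hne
  · rw [A.vertex_prev] at h
    exact A.en_inj _ _ h

end VertexArrangement

theorem cornersAt_vertex_nonempty (k : Fin T.numTiles) (i : ZMod (T.sides k)) :
    (T.cornersAt ((T.tile k).vertex i)).Nonempty := ⟨⟨k, i⟩, rfl⟩

/-- The standing assumptions on a dihedral tiling. -/
structure IsRegularQuadTiling {m : ℕ} (P : SphericalPolygon m) (Q : SphericalPolygon 4)
    (T : SphericalTiling) (x y α β γ : ℝ) : Prop where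
  four_le : 4 ≤ m
  regular : P.IsRegular x α
  quad : Q.HasEqualOppositeEdges x y β γ
  lt : γ < β
  dihedral : T.IsDihedral P Q

/-- The number of corners of `P` at `v`. -/
noncomputable def numP (T : SphericalTiling) {m : ℕ} (P : SphericalPolygon m) (v : S2) : ℕ :=
  {s ∈ T.cornersAt v | P.Congruent (T.tile s.1)}.ncard

/-- The number of corners of `Q` at `v` with angle `θ`. -/
noncomputable def numQ (T : SphericalTiling) (Q : SphericalPolygon 4) (θ : ℝ) (v : S2) : ℕ :=
  {s ∈ T.cornersAt v | Q.Congruent (T.tile s.1) ∧ (T.tile s.1).angle s.2 = θ}.ncard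

namespace IsRegularQuadTiling

variable {m : ℕ} {P : SphericalPolygon m} {Q : SphericalPolygon 4} {x y α β γ : ℝ}

theorem tile_P (H : IsRegularQuadTiling P Q T x y α β γ) {k : Fin T.numTiles}
    (hk : P.Congruent (T.tile k)) (i : ZMod (T.sides k)) :
    (T.tile k).angle i = α ∧ (T.tile k).edgeLength i = x := by
  obtain ⟨σ, h1, h2 | h2⟩ := hk.exists_equiv
  · exact ⟨by rw [h1, H.regular.2], by rw [(h2 i).2, H.regular.1]⟩
  · exact ⟨by rw [h1, H.regular.2], by rw [(h2 i).2, H.regular.1]⟩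

theorem quad_cases (H : IsRegularQuadTiling P Q T x y α β γ) (i : ZMod 4) :
    ((Q.angle i = β ∧ Q.angle (i + 1) = γ) ∨ (Q.angle i = γ ∧ Q.angle (i + 1) = β)) ∧
    ((Q.edgeLength i = x ∧ Q.edgeLength (i + 1) = y) ∨
      (Q.edgeLength i = y ∧ Q.edgeLength (i + 1) = x)) := by
  obtain ⟨-, l0, l1, l2, l3, a0, a1, a2, a3⟩ := H.quad
  have e0 : (0 : ZMod 4) + 1 = 1 ∧ (1 : ZMod 4) + 1 = 2 ∧ (2 : ZMod 4) + 1 = 3 ∧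
    (3 : ZMod 4) + 1 = 0 := by decide
  have e1 : i = 0 ∨ i = 1 ∨ i = 2 ∨ i = 3 := by revert i; decide
  rcases e1 with rfl | rfl | rfl | rfl <;> simp [e0, l0, l1, l2, l3, a0, a1, a2, a3]

theorem tile_Q (H : IsRegularQuadTiling P Q T x y α β γ) {k : Fin T.numTiles}
    (hk : Q.Congruent (T.tile k)) (i : ZMod (T.sides k)) :
    (((T.tile k).angle i = β ∧ (T.tile k).angle (i + 1) = γ) ∨
      ((T.tile k).angle i = γ ∧ (T.tile k).angle (i + 1) = β)) ∧
    (((T.tile k).edgeLength i = x ∧ (T.tile k).edgeLength (i + 1) = y) ∨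
      ((T.tile k).edgeLength i = y ∧ (T.tile k).edgeLength (i + 1) = x)) := by
  obtain ⟨σ, h1, h2 | h2⟩ := hk.exists_equiv
  · rw [h1, h1, (h2 i).2, (h2 (i + 1)).2, (h2 i).1]
    exact H.quad_cases (σ i)
  · rw [h1, h1, (h2 i).2, (h2 (i + 1)).2, (h2 i).1]
    have q1 := (H.quad_cases (σ i - 1)).1
    have q2 := (H.quad_cases (σ i - 1 - 1)).2
    rw [sub_add_cancel] at q1 q2
    refine ⟨?_, ?_⟩
    · tauto
    · tauto

/-- For `m = 4` the number of sides does not separate the prototiles, but `x ≠ y` does. -/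
theorem not_P_of_Q (H : IsRegularQuadTiling P Q T x y α β γ) {k : Fin T.numTiles}
    (hk : Q.Congruent (T.tile k)) : ¬P.Congruent (T.tile k) := by
  intro hk'
  have h1 := (H.tile_P hk' 0).2
  have h2 := (H.tile_P hk' (0 + 1)).2
  have hxy := H.quad.1
  rcases (H.tile_Q hk 0).2 with ⟨h3, h4⟩ | ⟨h3, h4⟩
  · exact hxy (h2.symm.trans h4)
  · exact hxy (h1.symm.trans h3)

theorem next_Q (H : IsRegularQuadTiling P Q T x y α β γ) {k : Fin T.numTiles}
    (hk : Q.Congruent (T.tile k)) {i i' : ZMod (T.sides k)} (h : IsNext i i') :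
    ((T.tile k).angle i = β ∧ (T.tile k).angle i' = γ) ∨
      ((T.tile k).angle i = γ ∧ (T.tile k).angle i' = β) := by
  rcases h with rfl | rfl
  · exact (H.tile_Q hk i).1
  · have := (H.tile_Q hk (i - 1)).1
    rw [sub_add_cancel] at this
    tauto

/-- The distance of two vertices of the tiling. -/
noncomputable def len (v w : S2) : ℝ := InnerProductGeometry.angle (v : E3) (w : E3)

theorem len_P (H : IsRegularQuadTiling P Q T x y α β γ) {k : Fin T.numTiles}
    (hk : P.Congruent (T.tile k)) {i i' : ZMod (T.sides k)} (h : IsNext i i') :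
    len ((T.tile k).vertex i) ((T.tile k).vertex i') = x := by
  rcases h with rfl | rfl
  · exact (H.tile_P hk i).2
  · have := (H.tile_P hk (i - 1)).2
    rw [edgeLength, sub_add_cancel] at this
    rw [len, InnerProductGeometry.angle_comm]; exact this

theorem len_Q (H : IsRegularQuadTiling P Q T x y α β γ) {k : Fin T.numTiles}
    (hk : Q.Congruent (T.tile k)) (i : ZMod (T.sides k)) :
    (len ((T.tile k).vertex i) ((T.tile k).vertex (i + 1)) = x ∧
      len ((T.tile k).vertex i) ((T.tile k).vertex (i - 1)) = y) ∨
    (len ((T.tile k).vertex i) ((T.tile k).vertex (i + 1)) = y ∧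
      len ((T.tile k).vertex i) ((T.tile k).vertex (i - 1)) = x) := by
  have := (H.tile_Q hk (i - 1)).2
  rw [sub_add_cancel, edgeLength, edgeLength, sub_add_cancel,
    InnerProductGeometry.angle_comm] at this
  simp only [len]
  tauto

theorem corner_cases (H : IsRegularQuadTiling P Q T x y α β γ) (s : Σ k, ZMod (T.sides k)) :
    (P.Congruent (T.tile s.1) ∧ ¬Q.Congruent (T.tile s.1) ∧ (T.tile s.1).angle s.2 = α) ∨
    (¬P.Congruent (T.tile s.1) ∧ Q.Congruent (T.tile s.1) ∧ (T.tile s.1).angle s.2 = β) ∨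
    (¬P.Congruent (T.tile s.1) ∧ Q.Congruent (T.tile s.1) ∧ (T.tile s.1).angle s.2 = γ) := by
  rcases H.dihedral.1 s.1 with h | h
  · exact Or.inl ⟨h, fun h' => H.not_P_of_Q h' h, (H.tile_P h _).1⟩
  · right
    rcases (H.tile_Q h s.2).1 with h' | h'
    · exact Or.inl ⟨H.not_P_of_Q h, h, h'.1⟩
    · exact Or.inr ⟨H.not_P_of_Q h, h, h'.1⟩

/-! ### Counting corners at a vertex -/

/-- Summation over the corners at a vertex of a function of the kind of the corner. -/
theorem sum_corners (H : IsRegularQuadTiling P Q T x y α β γ) (v : S2)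
    [Fintype (T.cornersAt v)] {f : T.cornersAt v → ℝ} {a b c : ℝ}
    (ha : ∀ s : T.cornersAt v, P.Congruent (T.tile s.1.1) → f s = a)
    (hb : ∀ s : T.cornersAt v, Q.Congruent (T.tile s.1.1) → (T.tile s.1.1).angle s.1.2 = β →
      f s = b)
    (hc : ∀ s : T.cornersAt v, Q.Congruent (T.tile s.1.1) → (T.tile s.1.1).angle s.1.2 = γ →
      f s = c) :
    ∑ s, f s = T.numP P v * a + T.numQ Q β v * b + T.numQ Q γ v * c := by
  classical
  have hcard : ∀ p : (Σ k, ZMod (T.sides k)) → Prop,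
      {s ∈ T.cornersAt v | p s}.ncard = ∑ s : T.cornersAt v, if p s.1 then 1 else 0 := by
    intro p
    have himg : {s ∈ T.cornersAt v | p s} =
        Subtype.val '' (↑(Finset.univ.filter fun s : T.cornersAt v => p s.1) :
          Set (T.cornersAt v)) := by
      ext s
      simp only [Finset.coe_filter, Finset.mem_univ, true_and, Set.mem_ofPred_eq, Set.mem_image,
        Subtype.exists, exists_and_left, exists_prop, exists_eq_right_right]
      exact and_comm
    rw [Finset.sum_boole, Nat.cast_id, himg, Set.ncard_image_of_injective _ Subtype.val_injective,
      Set.ncard_coe_finset]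
  rw [numP, numQ, numQ, hcard, hcard, hcard]
  push_cast
  rw [Finset.sum_mul, Finset.sum_mul, Finset.sum_mul, ← Finset.sum_add_distrib,
    ← Finset.sum_add_distrib]
  refine Finset.sum_congr rfl fun s _ => ?_
  have hne := H.lt.ne
  rcases H.corner_cases s.1 with ⟨h1, h2, h3⟩ | ⟨h1, h2, h3⟩ | ⟨h1, h2, h3⟩
  · simp [ha s h1, h1, h2]
  · simp [hb s h2 h3, h1, h2, h3, hne.symm]
  · simp [hc s h2 h3, h1, h2, h3, hne]

theorem angle_sum (H : IsRegularQuadTiling P Q T x y α β γ) {v : S2}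
    (hv : (T.cornersAt v).Nonempty) :
    T.numP P v * α + T.numQ Q β v * β + T.numQ Q γ v * γ = 2 * Real.pi := by
  obtain ⟨A⟩ := T.exists_vertexArrangement hv
  have hfin : Finite (T.cornersAt v) := inferInstance
  have := Fintype.ofFinite (T.cornersAt v)
  rw [← A.sum_angle, finsum_eq_sum_of_fintype]
  exact (H.sum_corners v (fun s hs => (H.tile_P hs _).1) (fun s _ h => h) (fun s _ h => h)).symm

theorem three_le_num (H : IsRegularQuadTiling P Q T x y α β γ) {v : S2}
    (hv : (T.cornersAt v).Nonempty) :
    3 ≤ T.numP P v + T.numQ Q β v + T.numQ Q γ v := by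
  have hfin : Finite (T.cornersAt v) := inferInstance
  have := Fintype.ofFinite (T.cornersAt v)
  have h1 := H.sum_corners v (f := fun _ => 1) (a := 1) (b := 1) (c := 1) (fun _ _ => rfl)
    (fun _ _ _ => rfl) (fun _ _ _ => rfl)
  obtain ⟨⟨j, i⟩, hc⟩ := hv
  have h2 := T.three_le_degree j i
  rw [show (T.tile j).vertex i = v from hc] at h2
  change 3 ≤ (T.cornersAt v).ncard at h2
  rw [Finset.sum_const, Finset.card_univ, ← Nat.card_eq_fintype_card, nsmul_eq_mul, mul_one, mul_one,
    mul_one, mul_one] at h1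
  have h3 : Nat.card (T.cornersAt v) = (T.cornersAt v).ncard := rfl
  rw [h3] at h1
  have h4 : (T.cornersAt v).ncard = T.numP P v + T.numQ Q β v + T.numQ Q γ v := by
    exact_mod_cast h1
  omega

theorem len_st_en_Q (H : IsRegularQuadTiling P Q T x y α β γ) {v : S2} (A : T.VertexArrangement v)
    {c : T.cornersAt v} (hc : Q.Congruent (T.tile c.1.1)) :
    (len v ((T.tile c.1.1).vertex (A.st c)) = x ∧ len v ((T.tile c.1.1).vertex (A.en c)) = y) ∨
    (len v ((T.tile c.1.1).vertex (A.st c)) = y ∧ len v ((T.tile c.1.1).vertex (A.en c)) = x) := by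
  have h := H.len_Q hc c.1.2
  rw [show (T.tile c.1.1).vertex c.1.2 = v from c.2] at h
  rcases A.st_en c with ⟨h1, h2⟩ | ⟨h1, h2⟩ <;> rw [h1, h2]
  · exact h
  · tauto

theorem len_corner_P (H : IsRegularQuadTiling P Q T x y α β γ) {v : S2}
    {c : T.cornersAt v} (hc : P.Congruent (T.tile c.1.1)) {i : ZMod (T.sides c.1.1)}
    (hi : IsNext c.1.2 i) : len v ((T.tile c.1.1).vertex i) = x := by
  have h := H.len_P hc hi
  rwa [show (T.tile c.1.1).vertex c.1.2 = v from c.2] at h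

open Classical in
/-- Half of the corners of quadrilaterals at a vertex have a last side of length `y`. -/
theorem num_eq_two_mul (H : IsRegularQuadTiling P Q T x y α β γ) {v : S2}
    (A : T.VertexArrangement v) [Fintype (T.cornersAt v)] :
    T.numQ Q β v + T.numQ Q γ v =
      2 * (Finset.univ.filter fun c : T.cornersAt v =>
        len v ((T.tile c.1.1).vertex (A.en c)) = y).card := by
  let F : T.cornersAt v → ℝ := fun c => if len v ((T.tile c.1.1).vertex (A.st c)) = y then 1 else 0
  let G : T.cornersAt v → ℝ := fun c => if len v ((T.tile c.1.1).vertex (A.en c)) = y then 1 else 0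
  -- The last side of a corner is the first side of the next, so sides of length `y` are counted
  -- equally often as first and as last sides.
  have hFG : ∑ c, G c = ∑ c, F c := by
    rw [← Equiv.sum_comp A.next F]
    refine Finset.sum_congr rfl fun c _ => ?_
    simp only [F, G, A.vertex_next]
  have hxy := H.quad.1
  have h1 := H.sum_corners v (f := fun c => F c + G c) (a := 0) (b := 1) (c := 1)
    (fun s hs => by
      simp only [F, G, H.len_corner_P hs (A.isNext_st s), H.len_corner_P hs (A.isNext_en s), hxy,
        if_false, add_zero])
    (fun s hs _ => by
      rcases H.len_st_en_Q A hs with ⟨h1, h2⟩ | ⟨h1, h2⟩ <;> simp [F, G, h1, h2, hxy])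
    (fun s hs _ => by
      rcases H.len_st_en_Q A hs with ⟨h1, h2⟩ | ⟨h1, h2⟩ <;> simp [F, G, h1, h2, hxy])
  rw [Finset.sum_add_distrib, ← hFG] at h1
  have h2 : ∑ c, G c = ((Finset.univ.filter fun c : T.cornersAt v =>
        len v ((T.tile c.1.1).vertex (A.en c)) = y).card : ℝ) := Finset.sum_boole _ _
  rw [h2] at h1
  have h3 : ((T.numQ Q β v + T.numQ Q γ v : ℕ) : ℝ) = ((2 * (Finset.univ.filter
      fun c : T.cornersAt v => len v ((T.tile c.1.1).vertex (A.en c)) = y).card : ℕ) : ℝ) := by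
    push_cast; linarith
  exact_mod_cast h3

theorem even_num (H : IsRegularQuadTiling P Q T x y α β γ) {v : S2}
    (hv : (T.cornersAt v).Nonempty) : Even (T.numQ Q β v + T.numQ Q γ v) := by
  obtain ⟨A⟩ := T.exists_vertexArrangement hv
  have hfin : Finite (T.cornersAt v) := inferInstance
  have := Fintype.ofFinite (T.cornersAt v)
  rw [H.num_eq_two_mul A]
  exact even_two_mul _

/-! ### Sides shared with copies of `Q` -/

/-- The side from the vertex `i` to the vertex `i'` of the tile `k` is shared with a copy of `Q`. -/
def SideQ (T : SphericalTiling) (Q : SphericalPolygon 4) (k : Fin T.numTiles)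
    (i i' : ZMod (T.sides k)) : Prop :=
  ∃ (l : Fin T.numTiles) (j j' : ZMod (T.sides l)), Q.Congruent (T.tile l) ∧ IsNext j j' ∧
    (T.tile l).vertex j = (T.tile k).vertex i ∧ (T.tile l).vertex j' = (T.tile k).vertex i'

theorem SideQ.symm {k : Fin T.numTiles} {i i' : ZMod (T.sides k)} (h : SideQ T Q k i i') :
    SideQ T Q k i' i := by
  obtain ⟨l, j, j', h1, h2, h3, h4⟩ := h
  exact ⟨l, j', j, h1, h2.symm, h4, h3⟩

theorem sideQ_en_iff (H : IsRegularQuadTiling P Q T x y α β γ) {v : S2}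
    (A : T.VertexArrangement v) {c : T.cornersAt v} (hc : P.Congruent (T.tile c.1.1)) :
    SideQ T Q c.1.1 c.1.2 (A.en c) ↔ Q.Congruent (T.tile (A.next c).1.1) := by
  have hcv : (T.tile c.1.1).vertex c.1.2 = v := c.2
  constructor
  · rintro ⟨l, j, j', h1, h2, h3, h4⟩
    have hd := A.eq_next (c := c) (c' := ⟨⟨l, j⟩, h3.trans hcv⟩) (by
      intro he; rw [← he] at hc; exact H.not_P_of_Q h1 hc) h2 h4
    rw [← hd]; exact h1
  · intro h
    exact ⟨_, (A.next c).1.2, A.st (A.next c), h, A.isNext_st _,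
      (show _ = v from (A.next c).2).trans hcv.symm, (A.vertex_next c).symm⟩

theorem sideQ_st_iff (H : IsRegularQuadTiling P Q T x y α β γ) {v : S2}
    (A : T.VertexArrangement v) {c : T.cornersAt v} (hc : P.Congruent (T.tile c.1.1)) :
    SideQ T Q c.1.1 c.1.2 (A.st c) ↔ Q.Congruent (T.tile (A.next.symm c).1.1) := by
  have hcv : (T.tile c.1.1).vertex c.1.2 = v := c.2
  constructor
  · rintro ⟨l, j, j', h1, h2, h3, h4⟩
    have hd := A.eq_prev (c := c) (c' := ⟨⟨l, j⟩, h3.trans hcv⟩) (by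
      intro he; rw [← he] at hc; exact H.not_P_of_Q h1 hc) h2 h4
    rw [← hd]; exact h1
  · intro h
    exact ⟨_, (A.next.symm c).1.2, A.en (A.next.symm c), h, A.isNext_en _,
      (show _ = v from (A.next.symm c).2).trans hcv.symm, (A.vertex_prev c).symm⟩

theorem numP_pos {k : Fin T.numTiles} (hk : P.Congruent (T.tile k)) (i : ZMod (T.sides k)) :
    0 < T.numP P ((T.tile k).vertex i) :=
  (Set.ncard_pos (Set.toFinite _)).2 ⟨⟨k, i⟩, rfl, hk⟩

theorem numQ_pos {θ : ℝ} {k : Fin T.numTiles} (hk : Q.Congruent (T.tile k)) {i : ZMod (T.sides k)}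
    (hi : (T.tile k).angle i = θ) : 0 < T.numQ Q θ ((T.tile k).vertex i) :=
  (Set.ncard_pos (Set.toFinite _)).2 ⟨⟨k, i⟩, rfl, hk, hi⟩

/-- At a vertex with only one corner of `P`, both sides of that corner belong to copies of `Q`. -/
theorem sideQ_of_numP_eq_one (H : IsRegularQuadTiling P Q T x y α β γ) {k : Fin T.numTiles}
    (hk : P.Congruent (T.tile k)) {i i' : ZMod (T.sides k)} (hi : IsNext i i')
    (h1 : T.numP P ((T.tile k).vertex i) = 1) : SideQ T Q k i i' := by
  obtain ⟨A⟩ := T.exists_vertexArrangement (T.cornersAt_vertex_nonempty k i)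
  let c : T.cornersAt ((T.tile k).vertex i) := ⟨⟨k, i⟩, rfl⟩
  have key : ∀ d : T.cornersAt ((T.tile k).vertex i), d ≠ c → Q.Congruent (T.tile d.1.1) := by
    intro d hd
    refine (H.dihedral.1 d.1.1).resolve_left fun hP => hd ?_
    obtain ⟨s, hs⟩ := Set.ncard_eq_one.1 h1
    have e1 : d.1 ∈ ({s} : Set _) := by rw [← hs]; exact ⟨d.2, hP⟩
    have e2 : c.1 ∈ ({s} : Set _) := by rw [← hs]; exact ⟨c.2, hk⟩
    exact Subtype.ext (e1.trans e2.symm)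
  rcases A.eq_st_or_eq_en c hi with rfl | rfl
  · exact (H.sideQ_st_iff A (c := c) hk).2 (key _ (A.prev_ne c))
  · exact (H.sideQ_en_iff A (c := c) hk).2 (key _ (A.next_ne c))

/-- At a vertex with two corners of `P` and two of `Q`, exactly one side of each corner of `P`
belongs to a copy of `Q`. -/
theorem sideQ_iff_of_two (H : IsRegularQuadTiling P Q T x y α β γ) (hα : α < Real.pi)
    {k : Fin T.numTiles} (hk : P.Congruent (T.tile k)) (i : ZMod (T.sides k))
    (h1 : T.numP P ((T.tile k).vertex i) = 2)
    (h2 : T.numQ Q β ((T.tile k).vertex i) + T.numQ Q γ ((T.tile k).vertex i) = 2) :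
    SideQ T Q k i (i + 1) ↔ ¬SideQ T Q k i (i - 1) := by
  classical
  obtain ⟨A⟩ := T.exists_vertexArrangement (T.cornersAt_vertex_nonempty k i)
  have hfin : Finite (T.cornersAt ((T.tile k).vertex i)) := inferInstance
  have := Fintype.ofFinite (T.cornersAt ((T.tile k).vertex i))
  let c : T.cornersAt ((T.tile k).vertex i) := ⟨⟨k, i⟩, rfl⟩
  have hcP : P.Congruent (T.tile c.1.1) := hk
  obtain ⟨c₂, hne, hc₂, honly⟩ : ∃ c₂ : T.cornersAt ((T.tile k).vertex i), c₂ ≠ c ∧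
      P.Congruent (T.tile c₂.1.1) ∧ ∀ d : T.cornersAt ((T.tile k).vertex i), d ≠ c →
        P.Congruent (T.tile d.1.1) → d = c₂ := by
    obtain ⟨s, t, hst, hs⟩ := Set.ncard_eq_two.1 h1
    have hmem : ∀ d : T.cornersAt ((T.tile k).vertex i), P.Congruent (T.tile d.1.1) →
        d.1 = s ∨ d.1 = t := by
      intro d hd
      have : d.1 ∈ ({s, t} : Set _) := by rw [← hs]; exact ⟨d.2, hd⟩
      exact this
    have hs' : s ∈ T.cornersAt ((T.tile k).vertex i) ∧ P.Congruent (T.tile s.1) := by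
      have : s ∈ ({s, t} : Set _) := Or.inl rfl
      rw [← hs] at this; exact this
    have ht' : t ∈ T.cornersAt ((T.tile k).vertex i) ∧ P.Congruent (T.tile t.1) := by
      have : t ∈ ({s, t} : Set _) := Or.inr rfl
      rw [← hs] at this; exact this
    rcases hmem c hcP with hc | hc
    · refine ⟨⟨t, ht'.1⟩, ?_, ht'.2, fun d hd hdP => ?_⟩
      · intro h
        exact hst (hc.symm.trans (congrArg Subtype.val h).symm)
      · rcases hmem d hdP with h | h
        · exact absurd (Subtype.ext (h.trans hc.symm)) hd
        · exact Subtype.ext h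
    · refine ⟨⟨s, hs'.1⟩, ?_, hs'.2, fun d hd hdP => ?_⟩
      · intro h
        exact hst ((congrArg Subtype.val h).trans hc)
      · rcases hmem d hdP with h | h
        · exact Subtype.ext h
        · exact absurd (Subtype.ext (h.trans hc.symm)) hd
  have hhalf := H.num_eq_two_mul A
  rw [h2] at hhalf
  have hcard : (Finset.univ.filter fun c : T.cornersAt ((T.tile k).vertex i) =>
      len ((T.tile k).vertex i) ((T.tile c.1.1).vertex (A.en c)) = y).card = 1 := by omega
  -- A corner of `Q` that follows a corner of `P` begins with a side `x`, so it ends with a side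
  -- `y`. Only one corner here ends with `y`.
  have hen : ∀ d : T.cornersAt ((T.tile k).vertex i), P.Congruent (T.tile d.1.1) →
      Q.Congruent (T.tile (A.next d).1.1) →
      len ((T.tile k).vertex i) ((T.tile (A.next d).1.1).vertex (A.en (A.next d))) = y := by
    intro d hd hq
    rcases H.len_st_en_Q A hq with h | h
    · exact h.2
    · have h3 := H.len_corner_P hd (A.isNext_en d)
      rw [A.vertex_next, h.1] at h3
      exact absurd h3.symm H.quad.1
  have hiff : Q.Congruent (T.tile (A.next c).1.1) ↔
      ¬Q.Congruent (T.tile (A.next.symm c).1.1) := by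
    constructor
    · intro hq hq'
      -- If both corners of `P` were followed by corners of `Q`, two corners would end with `y`.
      -- Otherwise `c₂` is followed by `c`, so a corner of `P` precedes `c`.
      by_cases h3 : Q.Congruent (T.tile (A.next c₂).1.1)
      · obtain ⟨s, hs⟩ := Finset.card_eq_one.1 hcard
        have e1 : A.next c ∈ ({s} : Finset _) := by
          rw [← hs]; exact Finset.mem_filter.2 ⟨Finset.mem_univ _, hen c hcP hq⟩
        have e2 : A.next c₂ ∈ ({s} : Finset _) := by
          rw [← hs]; exact Finset.mem_filter.2 ⟨Finset.mem_univ _, hen c₂ hc₂ h3⟩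
        rw [Finset.mem_singleton] at e1 e2
        exact hne (A.next.injective (e2.trans e1.symm))
      · have h4 := (H.dihedral.1 (A.next c₂).1.1).resolve_right h3
        have h5 : A.next c₂ = c := by
          by_contra h6
          exact A.next_ne c₂ (honly _ h6 h4)
        rw [← h5, Equiv.symm_apply_apply] at hq'
        exact H.not_P_of_Q hq' hc₂
    · intro hq
      by_contra hq'
      have h3 := honly _ (A.next_ne c) ((H.dihedral.1 _).resolve_right hq')
      have h4 := honly _ (A.prev_ne c) ((H.dihedral.1 _).resolve_right hq)
      -- With `c₂` on both sides of `c`, the two corners of `P` would fill the whole turn, giving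
      -- `2α = 2π`.
      have h5 : A.next (A.next c) = c := by
        rw [h3, ← h4, Equiv.apply_symm_apply]
      have h6 := A.add_angle c h5
      rw [h3, (H.tile_P hcP _).1, (H.tile_P hc₂ _).1] at h6
      linarith
  rw [← H.sideQ_en_iff A hcP, ← H.sideQ_st_iff A hcP] at hiff
  rcases A.st_en c with ⟨e1, e2⟩ | ⟨e1, e2⟩ <;> rw [e1, e2] at hiff
  · change SideQ T Q k i (i - 1) ↔ ¬SideQ T Q k i (i + 1) at hiff
    tauto
  · exact hiff

/-- Along a side that is shared with a copy of `Q`, angles `β` and `γ` alternate. -/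
theorem num_of_sideQ (H : IsRegularQuadTiling P Q T x y α β γ) {k : Fin T.numTiles}
    {i i' : ZMod (T.sides k)} (h : SideQ T Q k i i') :
    (0 < T.numQ Q β ((T.tile k).vertex i) ∧ 0 < T.numQ Q γ ((T.tile k).vertex i')) ∨
    (0 < T.numQ Q γ ((T.tile k).vertex i) ∧ 0 < T.numQ Q β ((T.tile k).vertex i')) := by
  obtain ⟨l, j, j', h1, h2, h3, h4⟩ := h
  rw [← h3, ← h4]
  exact (H.next_Q h1 h2).imp (fun h => ⟨numQ_pos h1 h.1, numQ_pos h1 h.2⟩)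
    (fun h => ⟨numQ_pos h1 h.1, numQ_pos h1 h.2⟩)

end IsRegularQuadTiling
end SphericalTiling

/-! ### Possible vertex types and the two global contradictions -/

namespace SphericalTiling

open SphericalPolygon

/-- The possible numbers of corners at a vertex, if there is a vertex of type `αβ²`. -/
theorem vertex_types {α β γ : ℝ} (h1 : α + 2 * β = 2 * Real.pi) (h2 : Real.pi < β + γ)
    (h3 : γ < β) (h4 : Real.pi < 2 * α) {a b c : ℕ}
    (hs : a * α + b * β + c * γ = 2 * Real.pi) (h5 : 3 ≤ a + b + c) (h6 : Even (b + c)) :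
    (a = 1 ∧ b = 2 ∧ c = 0) ∨ (a = 3 ∧ b = 0 ∧ c = 0) ∨ (a = 2 ∧ b = 0 ∧ c = 2) ∨
      (a = 1 ∧ b = 0 ∧ c = 4) ∨ (a = 0 ∧ b < c) := by
  have hpi := Real.pi_pos
  have hγ : α < 2 * γ := by linarith
  have hβ : Real.pi < 2 * β := by linarith
  obtain ⟨d, hd⟩ := h6
  -- `α` and `β` exceed `π/2`, and `γ > α/2 > π/4`. The remaining finite list is settled by parity
  -- and by linear arithmetic in the angles.
  have ha : a < 4 := by
    by_contra hlt
    have : (4 : ℝ) ≤ a := by exact_mod_cast (by omega : 4 ≤ a)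
    have e1 : 0 ≤ (b : ℝ) * β := mul_nonneg (by positivity) (by linarith)
    have e2 : 0 ≤ (c : ℝ) * γ := mul_nonneg (by positivity) (by linarith)
    nlinarith
  have hb : b < 4 := by
    by_contra hlt
    have : (4 : ℝ) ≤ b := by exact_mod_cast (by omega : 4 ≤ b)
    have e1 : 0 ≤ (a : ℝ) * α := mul_nonneg (by positivity) (by linarith)
    have e2 : 0 ≤ (c : ℝ) * γ := mul_nonneg (by positivity) (by linarith)
    nlinarith
  have hc : c < 8 := by
    by_contra hlt
    have : (8 : ℝ) ≤ c := by exact_mod_cast (by omega : 8 ≤ c)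
    have e1 : 0 ≤ (a : ℝ) * α := mul_nonneg (by positivity) (by linarith)
    have e2 : 0 ≤ (b : ℝ) * β := mul_nonneg (by positivity) (by linarith)
    nlinarith
  interval_cases a <;> interval_cases b <;> interval_cases c <;>
    first
    | omega
    | (exfalso; push_cast at hs; linarith)

namespace IsRegularQuadTiling

variable {T : SphericalTiling} {m : ℕ} {P : SphericalPolygon m} {Q : SphericalPolygon 4}
  {x y α β γ : ℝ}

/-- Counting the angles `β` and `γ` excludes a tiling in which every corner of `P` is at a vertex
of type `αβ²` or `αγ⁴`, and no two consecutive corners are at vertices of type `αβ²`. -/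
theorem not_alternating (H : IsRegularQuadTiling P Q T x y α β γ)
    (htypes : ∀ v, (T.cornersAt v).Nonempty →
      (T.numP P v = 1 ∧ T.numQ Q β v = 2 ∧ T.numQ Q γ v = 0) ∨
      (T.numP P v = 1 ∧ T.numQ Q β v = 0 ∧ T.numQ Q γ v = 4) ∨
      (T.numP P v = 0 ∧ T.numQ Q β v < T.numQ Q γ v))
    (halt : ∀ k, P.Congruent (T.tile k) → ∀ i, 0 < T.numQ Q β ((T.tile k).vertex i) →
      ¬0 < T.numQ Q β ((T.tile k).vertex (i + 1))) : False := by
  classical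
  let V : (Σ k, ZMod (T.sides k)) → S2 := fun s => (T.tile s.1).vertex s.2
  let sh : (Σ k, ZMod (T.sides k)) ≃ (Σ k, ZMod (T.sides k)) :=
    Equiv.sigmaCongrRight fun k => Equiv.addRight (1 : ZMod (T.sides k))
  -- `W` counts `β` minus `γ`. The weights `2` and `-4` of `g` on corners of `P` are the values of
  -- this difference at vertices `αβ²` and `αγ⁴`.
  let W : (Σ k, ZMod (T.sides k)) → ℝ := fun s =>
    if Q.Congruent (T.tile s.1) then (if (T.tile s.1).angle s.2 = β then 1 else -1) else 0
  let g : (Σ k, ZMod (T.sides k)) → ℝ := fun s =>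
    if P.Congruent (T.tile s.1) then (if 0 < T.numQ Q β (V s) then 2 else -4) else 0
  have hW : ∑ s, W s = 0 := by
    have h1 : ∑ s, W (sh s) = ∑ s, W s := Equiv.sum_comp sh W
    have h2 : ∀ s, W (sh s) = -W s := by
      rintro ⟨k, i⟩
      change W ⟨k, i + 1⟩ = -W ⟨k, i⟩
      by_cases hk : Q.Congruent (T.tile k)
      · rcases (H.tile_Q hk i).1 with ⟨h3, h4⟩ | ⟨h3, h4⟩ <;> simp [W, hk, h3, h4, H.lt.ne]
      · simp [W, hk]
    simp only [h2, Finset.sum_neg_distrib] at h1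
    linarith
  have hg : ∑ s, g s < 0 := by
    have h1 : ∑ s, g (sh s) = ∑ s, g s := Equiv.sum_comp sh g
    -- Two consecutive corners of `P` are not both of weight `2`, so each pair contributes at most
    -- `2 - 4`. Pairing every corner with its successor also handles odd `m`.
    have h2 : ∑ s, (g s + g (sh s)) < ∑ s : (Σ k, ZMod (T.sides k)), (0 : ℝ) := by
      have h3 : ∀ s, P.Congruent (T.tile s.1) → g s + g (sh s) < 0 := by
        rintro ⟨k, i⟩ hk
        change g ⟨k, i⟩ + g ⟨k, i + 1⟩ < 0
        have hk : P.Congruent (T.tile k) := hk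
        have h4 := halt k hk i
        simp only [g, V, hk, if_true]
        split_ifs with h5 h6
        · exact absurd h6 (h4 h5)
        all_goals norm_num
      obtain ⟨j, hj⟩ := H.dihedral.2.1
      refine Finset.sum_lt_sum (fun s _ => ?_) ⟨⟨j, 0⟩, Finset.mem_univ _, h3 _ hj⟩
      by_cases hs : P.Congruent (T.tile s.1)
      · exact (h3 s hs).le
      · have hs' : ¬P.Congruent (T.tile (sh s).1) := hs
        simp [g, hs, hs']
    rw [Finset.sum_add_distrib, h1, Finset.sum_const_zero] at h2
    linarith
  -- Grouped by vertices, the difference is `0` at `αβ²` and `αγ⁴`, and it is the excess of `γ` over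
  -- `β` at vertices without `α`.
  have hle : 0 ≤ ∑ s, (g s - W s) := by
    rw [← Finset.sum_fiberwise_of_maps_to (s := Finset.univ) (t := Finset.univ.image V) (g := V)
      (fun s _ => Finset.mem_image_of_mem V (Finset.mem_univ s))]
    refine Finset.sum_nonneg fun v hv => ?_
    obtain ⟨s₀, -, hs₀⟩ := Finset.mem_image.1 hv
    have hne : (T.cornersAt v).Nonempty := ⟨s₀, hs₀⟩
    have hfin : Finite (T.cornersAt v) := inferInstance
    have := Fintype.ofFinite (T.cornersAt v)
    rw [Finset.sum_subtype (p := fun s => s ∈ T.cornersAt v) _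
      (fun s => by simp only [Finset.mem_filter, Finset.mem_univ, true_and]; rfl)]
    have hsum := H.sum_corners v (f := fun s => g s.1 - W s.1)
      (a := if 0 < T.numQ Q β v then 2 else -4) (b := -1) (c := 1)
      (fun s hs => by
        have hV : V s.1 = v := s.2
        have hq : ¬Q.Congruent (T.tile s.1.1) := fun h => H.not_P_of_Q h hs
        simp [g, W, hs, hq, hV])
      (fun s hs ha => by simp [g, W, hs, ha, H.not_P_of_Q hs])
      (fun s hs ha => by simp [g, W, hs, ha, H.not_P_of_Q hs, H.lt.ne])
    refine le_of_le_of_eq ?_ hsum.symm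
    rcases htypes v hne with ⟨h1, h2, h3⟩ | ⟨h1, h2, h3⟩ | ⟨h1, h2⟩
    · rw [h1, h2, h3]; norm_num
    · rw [h1, h2, h3]; norm_num
    · rw [h1]
      have : (T.numQ Q β v : ℝ) < T.numQ Q γ v := by exact_mod_cast h2
      push_cast; linarith
  rw [Finset.sum_sub_distrib, hW] at hle
  linarith

/-- Around a copy of `P` all of whose vertices have type `αβ²` or `α²γ²`, the types have
period three. -/
theorem types_periodic (H : IsRegularQuadTiling P Q T x y α β γ) (hα : α < Real.pi)
    {k : Fin T.numTiles} (hk : P.Congruent (T.tile k))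
    (htypes : ∀ i, (T.numP P ((T.tile k).vertex i) = 1 ∧ T.numQ Q β ((T.tile k).vertex i) = 2 ∧
        T.numQ Q γ ((T.tile k).vertex i) = 0) ∨
      (T.numP P ((T.tile k).vertex i) = 2 ∧ T.numQ Q β ((T.tile k).vertex i) = 0 ∧
        T.numQ Q γ ((T.tile k).vertex i) = 2))
    {i : ZMod (T.sides k)} (hi : 0 < T.numQ Q β ((T.tile k).vertex i)) :
    ¬0 < T.numQ Q β ((T.tile k).vertex (i + 1)) ∧
      0 < T.numQ Q β ((T.tile k).vertex (i + 1 + 1 + 1)) := by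
  have hB : ∀ i i', IsNext i i' → 0 < T.numQ Q β ((T.tile k).vertex i) → SideQ T Q k i i' := by
    intro i i' hi hb
    rcases htypes i with h | h
    · exact H.sideQ_of_numP_eq_one hk hi h.1
    · omega
  have hC : ∀ i, ¬0 < T.numQ Q β ((T.tile k).vertex i) →
      (SideQ T Q k i (i + 1) ↔ ¬SideQ T Q k i (i - 1)) := by
    intro i hb
    rcases htypes i with h | h
    · omega
    · exact H.sideQ_iff_of_two hα hk i h.1 (by omega)
  have hE : ∀ i i', SideQ T Q k i i' → (0 < T.numQ Q β ((T.tile k).vertex i) ↔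
      ¬0 < T.numQ Q β ((T.tile k).vertex i')) := by
    intro i i' hq
    have h1 := H.num_of_sideQ hq
    have h2 := htypes i
    have h3 := htypes i'
    omega
  -- From a vertex `αβ²`, the side to `i + 1` is shared with a copy of `Q`, so `i + 1` has type
  -- `α²γ²` and its other side is not shared. Hence `i + 2` also has type `α²γ²`, its next side is
  -- shared, and the far end `i + 3` of that side carries `β` again.
  have q1 := hB i (i + 1) (Or.inl rfl) hi
  have b1 := (hE _ _ q1).1 hi
  have q2 : ¬SideQ T Q k (i + 1) (i + 1 + 1) := fun h =>
    (hC _ b1).1 h (by rw [add_sub_cancel_right]; exact q1.symm)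
  have b2 : ¬0 < T.numQ Q β ((T.tile k).vertex (i + 1 + 1)) := fun h =>
    q2 (hB (i + 1 + 1) (i + 1) (Or.inr (by ring)) h).symm
  have q3 : SideQ T Q k (i + 1 + 1) (i + 1 + 1 + 1) := (hC _ b2).2 fun h =>
    q2 (by rw [add_sub_cancel_right] at h; exact h.symm)
  refine ⟨b1, ?_⟩
  by_contra hcon
  exact b2 ((hE _ _ q3).2 hcon)

end IsRegularQuadTiling

end SphericalTiling

/-! ### The theorem -/

theorem proposition3p2 (m : ℕ) (hm : 4 ≤ m) (x y α β γ : ℝ)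
    (P : SphericalPolygon m) (hP : P.IsRegular x α)
    (Q : SphericalPolygon 4) (hQ : Q.HasEqualOppositeEdges x y β γ) (hβγ : γ < β)
    (T : SphericalTiling) (hT : T.IsDihedral P Q) :
    ¬ T.HasVertexOfType P Q β γ 1 2 0 := by
  rintro ⟨v, hv, ha, hb, hc⟩
  have H : SphericalTiling.IsRegularQuadTiling P Q T x y α β γ := ⟨hm, hP, hQ, hβγ, hT⟩
  have ha : T.numP P v = 1 := ha
  have hb : T.numQ Q β v = 2 := hb
  have hc : T.numQ Q γ v = 0 := hc
  have hpi := Real.pi_pos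
  have hm' : (4 : ℝ) ≤ m := by exact_mod_cast hm
  have hα0 : 0 < α := by rw [← hP.2 0]; exact (P.isInteriorAngle 0).1
  have h1 : α + 2 * β = 2 * Real.pi := by
    have := H.angle_sum hv
    rw [ha, hb, hc] at this
    push_cast at this
    linarith
  have h2 : Real.pi < β + γ :=
    SphericalPolygon.pi_lt_add_of_hasEqualOppositeEdges hQ (by linarith)
  have h4 := hP.angle_gt hm
  have h4' : Real.pi < 2 * α := by nlinarith
  have htypes : ∀ v, (T.cornersAt v).Nonempty → _ := fun v hv =>
    SphericalTiling.vertex_types h1 h2 hβγ h4' (H.angle_sum hv) (H.three_le_num hv) (H.even_num hv)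
  obtain ⟨⟨k, i⟩, hki, hk⟩ : {s ∈ T.cornersAt v | P.Congruent (T.tile s.1)}.Nonempty := by
    rw [← Set.ncard_pos (Set.toFinite _)]
    change 0 < T.numP P v
    omega
  have hki : (T.tile k).vertex i = v := hki
  have hk : P.Congruent (T.tile k) := hk
  subst hki
  have hq := H.sideQ_of_numP_eq_one hk (i' := i + 1) (Or.inl rfl) ha
  -- The shared side has no `γ` at the vertex `αβ²`, so the copy of `Q` has `β` there and `γ` at the
  -- other end. This leaves `α²γ²` and `αγ⁴` for the vertex `i + 1`.
  have hg : 0 < T.numQ Q γ ((T.tile k).vertex (i + 1)) := by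
    rcases H.num_of_sideQ hq with h | h <;> omega
  have hp := SphericalTiling.IsRegularQuadTiling.numP_pos hk (i + 1)
  have hsum := H.angle_sum (T.cornersAt_vertex_nonempty k (i + 1))
  rcases htypes _ (T.cornersAt_vertex_nonempty k (i + 1)) with h | h | h | h | h
  · omega
  · omega
  · rw [h.1, h.2.1, h.2.2] at hsum
    push_cast at hsum
    -- Now `α + γ = π`. Either of `α³` and `αγ⁴` would make `α = 2π/3 = 2γ`, against `α < 2γ`.
    have ht : ∀ j, (T.numP P ((T.tile k).vertex j) = 1 ∧ T.numQ Q β ((T.tile k).vertex j) = 2 ∧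
        T.numQ Q γ ((T.tile k).vertex j) = 0) ∨
      (T.numP P ((T.tile k).vertex j) = 2 ∧ T.numQ Q β ((T.tile k).vertex j) = 0 ∧
        T.numQ Q γ ((T.tile k).vertex j) = 2) := by
      intro j
      have hj := H.angle_sum (T.cornersAt_vertex_nonempty k j)
      have hjp := SphericalTiling.IsRegularQuadTiling.numP_pos hk j
      rcases htypes _ (T.cornersAt_vertex_nonempty k j) with h' | h' | h' | h' | h'
      · exact Or.inl h'
      · rw [h'.1, h'.2.1, h'.2.2] at hj
        push_cast at hj
        linarith
      · exact Or.inr h'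
      · rw [h'.1, h'.2.1, h'.2.2] at hj
        push_cast at hj
        linarith
      · omega
    have hper := fun {j} => H.types_periodic (i := j) (by linarith) hk ht
    -- `α + γ = π` and `α < 2γ` give `α < 2π/3`, while `m ≥ 6` would give `α > 2π/3`.
    have hm6 : m < 6 := by
      by_contra hlt
      have : (6 : ℝ) ≤ m := by exact_mod_cast (by omega : 6 ≤ m)
      nlinarith
    have hi : 0 < T.numQ Q β ((T.tile k).vertex i) := by omega
    obtain ⟨b1, b3⟩ := hper hi
    obtain ⟨b4, b6⟩ := hper b3
    have hsides : T.sides k = m := hk.sides_eq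
    have hcast : ((m : ℕ) : ZMod (T.sides k)) = 0 := by
      rw [← hsides]; exact ZMod.natCast_self _
    -- Six steps of the pattern are known from `i` on. For `m = 4` the vertex `i + 4` is `i`, and
    -- for `m = 5` the vertex `i + 6` is `i + 1`; each would both carry and not carry `β`.
    rcases (by omega : m = 4 ∨ m = 5) with h5 | h5
    · rw [h5] at hcast
      push_cast at hcast
      have e : i + 1 + 1 + 1 + 1 = i := by linear_combination hcast
      rw [e] at b4
      exact b4 hi
    · rw [h5] at hcast
      push_cast at hcast
      have e : i + 1 + 1 + 1 + 1 + 1 + 1 = i + 1 := by linear_combination hcast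
      rw [e] at b6
      exact b1 b6
  · rw [h.1, h.2.1, h.2.2] at hsum
    push_cast at hsum
    -- Now `α + 4γ = 2π`, and either of `α³` and `α²γ²` would again make `α = 2γ`.
    have ht : ∀ w, (T.cornersAt w).Nonempty →
        (T.numP P w = 1 ∧ T.numQ Q β w = 2 ∧ T.numQ Q γ w = 0) ∨
        (T.numP P w = 1 ∧ T.numQ Q β w = 0 ∧ T.numQ Q γ w = 4) ∨
        (T.numP P w = 0 ∧ T.numQ Q β w < T.numQ Q γ w) := by
      intro w hw
      have hj := H.angle_sum hw
      rcases htypes w hw with h' | h' | h' | h' | h'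
      · exact Or.inl h'
      · rw [h'.1, h'.2.1, h'.2.2] at hj
        push_cast at hj
        linarith
      · rw [h'.1, h'.2.1, h'.2.2] at hj
        push_cast at hj
        linarith
      · exact Or.inr (Or.inl h')
      · exact Or.inr (Or.inr h')
    -- A side between two vertices `αβ²` would be shared with a copy of `Q`, which has `γ` at one of
    -- its ends.
    refine H.not_alternating ht fun l hl j hj hj' => ?_
    have n1 := T.cornersAt_vertex_nonempty l j
    have n2 := T.cornersAt_vertex_nonempty l (j + 1)
    have hq := H.sideQ_of_numP_eq_one hl (i := j) (i' := j + 1) (Or.inl rfl) (by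
      have := ht _ n1
      have := SphericalTiling.IsRegularQuadTiling.numP_pos hl j
      omega)
    have := H.num_of_sideQ hq
    have := ht _ n1
    have := ht _ n2
    have := SphericalTiling.IsRegularQuadTiling.numP_pos hl j
    have := SphericalTiling.IsRegularQuadTiling.numP_pos hl (j + 1)
    omega
  · omega
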